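/- Let $K$ be a perfect field with algebraic closure $\overline{K}$, and let $S$ be a non-trivial Severi-Brauer surface over $K$, that is, a projective $K$-scheme $S$ such that $S\times_{\operatorname{Spec} K}\operatorname{Spec}\overline{K}$ is isomorphic to $\mathbb{P}^2_{\overline{K}}$ over $\overline{K}$, but $S$ is not isomorphic to $\mathbb{P}^2_K$ over $K$. A point of degree $d$ of $S$ is a closed point that corresponds to exactly $d$ $\overline{K}$-points of $S$ (which then form one $\operatorname{Gal}(\overline{K}/K)$-orbit), and its splitting field is the smallest subfield of $\overline{K}$ containing $K$ over which all these $\overline{K}$-points are defined. Then there are two points $p,q$ of degree $3$ of $S$ whose splitting fields are different. In particular, there is no automorphism $\alpha\in\operatorname{Aut}_K(S)$ with $\alpha(p)=q$. -/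

import Mathlib

open CategoryTheory CategoryTheory.Limits AlgebraicGeometry

universe u

namespace SeveriBrauer

noncomputable section

attribute [local instance] MvPolynomial.gradedAlgebra

/-- Projective `n`-space `ℙⁿ_R = Proj R[X₀, …, Xₙ]`, with the grading by the total degree. -/
def ProjSpace (n : ℕ) (R : Type u) [CommRing R] : Scheme.{u} :=
  Proj (MvPolynomial.homogeneousSubmodule (Fin (n + 1)) R)

/-- The structure morphism `ℙⁿ_R ⟶ Spec R`: the canonical morphism from `Proj R[X₀, …, Xₙ]` to the
spectrum of the degree `0` part, followed by the morphism given by `R → R[X₀, …, Xₙ]₀`. -/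
def ProjSpace.toSpec (n : ℕ) (R : Type u) [CommRing R] :
    ProjSpace n R ⟶ Spec (CommRingCat.of R) :=
  Proj.toSpecZero (MvPolynomial.homogeneousSubmodule (Fin (n + 1)) R) ≫
    Spec.map (CommRingCat.ofHom
      (algebraMap R (MvPolynomial.homogeneousSubmodule (Fin (n + 1)) R 0)))

/-- Two schemes `a : X ⟶ B` and `b : Y ⟶ B` over `B` are isomorphic over `B`. -/
def IsoOver {X Y B : Scheme.{u}} (a : X ⟶ B) (b : Y ⟶ B) : Prop :=
  ∃ e : X ≅ Y, e.hom ≫ b = a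

/-- The morphism of spectra `Spec L ⟶ Spec K` of a field extension `L / K`. -/
abbrev specMap (K L : Type u) [Field K] [Field L] [Algebra K L] :
    Spec (CommRingCat.of L) ⟶ Spec (CommRingCat.of K) :=
  Spec.map (CommRingCat.ofHom (algebraMap K L))

section

variable {K : Type u} [Field K] {S : Scheme.{u}} (π : S ⟶ Spec (CommRingCat.of K))

/-- A `K`-scheme is projective if it is isomorphic, over `K`, to a closed subscheme of some `ℙⁿ_K`. -/
def IsProjective : Prop :=
  ∃ (n : ℕ) (i : S ⟶ ProjSpace n K), IsClosedImmersion i ∧ i ≫ ProjSpace.toSpec n K = π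

variable (Kbar : Type u) [Field Kbar] [Algebra K Kbar]

/-- `S` is a Severi-Brauer surface over `K`, where `Kbar` is an algebraic closure of `K`: it is
projective over `K` and `S ×_{Spec K} Spec Kbar` is isomorphic to `ℙ²` over `Kbar`. -/
structure IsSeveriBrauerSurface : Prop where
  projective : IsProjective π
  geometric : IsoOver (pullback.snd π (specMap K Kbar)) (ProjSpace.toSpec 2 Kbar)

/-- A Severi-Brauer surface over `K` is trivial if it is isomorphic to `ℙ²` over `K`. -/
def IsTrivial : Prop :=
  IsoOver π (ProjSpace.toSpec 2 K)

/-- The set of `L`-points of the `K`-scheme `S`, that is, of morphisms `Spec L ⟶ S` over `K`. -/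
def points (L : Type u) [Field L] [Algebra K L] : Set (Spec (CommRingCat.of L) ⟶ S) :=
  {g | g ≫ π = specMap K L}

/-- The `Kbar`-points of `S` that lie over the point `x` of the scheme `S`. -/
def pointsOver (x : S) : Set (Spec (CommRingCat.of Kbar) ⟶ S) :=
  {g | g ∈ points π Kbar ∧ g (IsLocalRing.closedPoint Kbar) = x}

/-- `x` is a point of degree `d` of `S` (for `K` perfect with algebraic closure `Kbar`, and `d ≥ 1`):
a closed point to which correspond exactly `d` points of `S` over `Kbar`. These points, which are the
`K`-embeddings of the residue field of `x` in `Kbar`, automatically form one Galois orbit, and `d` is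
the degree of the residue field over `K`. -/
def IsPointOfDegree (d : ℕ) (x : S) : Prop :=
  IsClosed {x} ∧ (pointsOver π Kbar x).ncard = d

/-- The point `g` of `S` over `Kbar` is defined over the intermediate field `L`: it comes from an
`L`-point of `S`. -/
def IsDefinedOver (L : IntermediateField K Kbar) (g : Spec (CommRingCat.of Kbar) ⟶ S) : Prop :=
  ∃ h ∈ points π L, specMap L Kbar ≫ h = g

/-- The splitting field of `x`: the smallest intermediate field `L` of `Kbar / K` over which all
`Kbar`-points over `x` are defined. -/
def splittingField (x : S) : IntermediateField K Kbar :=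
  sInf {L | ∀ g ∈ pointsOver π Kbar x, IsDefinedOver π Kbar L g}

/-- The point of `S` over `Kbar` given by an embedding of the residue field of `x` is defined over
`L` if and only if the image of the embedding is contained in `L`. -/
lemma isDefinedOver_iff (L : IntermediateField K Kbar) (x : S) (φ : S.residueField x ⟶ .of Kbar)
   (hg : Spec.map φ ≫ S.fromSpecResidueField x ∈ points π Kbar) :
   IsDefinedOver π Kbar L (Spec.map φ ≫ S.fromSpecResidueField x) ↔ ∀ a, φ.hom a ∈ L := by
  constructor
  · rintro ⟨h, hh, e⟩ a
    obtain ⟨⟨y, ψ⟩, rfl⟩ := (Scheme.SpecToEquivOfField L S).symm.surjective h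
    have e2 : (Scheme.SpecToEquivOfField Kbar S).symm ⟨y, ψ ≫ CommRingCat.ofHom (algebraMap L Kbar)⟩ = (Scheme.SpecToEquivOfField Kbar S).symm ⟨x, φ⟩ := by
      rw [Scheme.SpecToEquivOfField_symm_apply, Scheme.SpecToEquivOfField_symm_apply, ← e]
      simp [specMap]
    have e3 := (Scheme.SpecToEquivOfField Kbar S).symm.injective e2
    obtain rfl : y = x := congrArg Sigma.fst e3
    have e4 := eq_of_heq (Sigma.mk.inj e3).2
    rw [← e4]
    exact (ψ.hom a).2
  · intro H
    let ψ : S.residueField x ⟶ .of L := CommRingCat.ofHom (φ.hom.codRestrict L.toSubfield H)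
    have hψ : ψ ≫ CommRingCat.ofHom (algebraMap L Kbar) = φ := by ext a; rfl
    have key : specMap L Kbar ≫ Spec.map ψ ≫ S.fromSpecResidueField x = Spec.map φ ≫ S.fromSpecResidueField x := by
      rw [← hψ]; simp [specMap]
    refine ⟨Spec.map ψ ≫ S.fromSpecResidueField x, ?_, key⟩
    have h1 : (specMap L Kbar ≫ Spec.map ψ ≫ S.fromSpecResidueField x) ≫ π = specMap K Kbar := by
      rw [key]; exact hg
    change (Spec.map ψ ≫ S.fromSpecResidueField x) ≫ π = specMap K L
    obtain ⟨χ, hχ⟩ := Spec.map_surjective ((Spec.map ψ ≫ S.fromSpecResidueField x) ≫ π)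
    rw [Category.assoc, ← hχ, specMap, specMap, ← Spec.map_comp, Spec.map_inj] at h1
    rw [← hχ, specMap, Spec.map_inj]
    ext a
    have := congr($(h1).hom a)
    simpa using this

/-- There is a smallest field over which all `Kbar`-points over `x` are defined. -/
theorem splittingField_isLeast (x : S) :
   IsLeast {L | ∀ g ∈ pointsOver π Kbar x, IsDefinedOver π Kbar L g} (splittingField π Kbar x) := by
  refine ⟨?_, fun L hL => sInf_le hL⟩
  intro g hg
  obtain ⟨⟨y, φ⟩, rfl⟩ := (Scheme.SpecToEquivOfField Kbar S).symm.surjective g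
  have hy : y = x := (Scheme.fromSpecResidueField_apply y _).symm.trans hg.2
  subst hy
  refine (isDefinedOver_iff π Kbar _ y φ hg.1).2 fun a => ?_
  rw [splittingField, IntermediateField.mem_sInf]
  intro L hL
  exact (isDefinedOver_iff π Kbar L y φ hg.1).1 (hL _ hg) a
end

end

end SeveriBrauer

/-! Write L for the algebraic closure. Over L the surface becomes the projective plane, and each σ
in Gal(L/K) acts on its L-points by v ↦ N_σ σ(v), with N_σ a matrix determined up to a scalar
(`Trivialization.exists_isProjectiveCocycle`). This rests on the fact that every σ-semilinear
automorphism of the plane comes from a matrix (`IsLocallyPolynomial.exists_matrix`,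
`ProjSpace.exists_matrix`). The matrices M with N_σ σ(M) = M N_σ form a K-algebra A that spans M₃(L)
over L (`span_twistedAlgebra`): a central simple algebra of degree 3 attached to S.

If A contains a nonzero singular matrix, its kernel or its image is a line stable under the twisted
action. The cocycle is then trivial, and fpqc descent makes S isomorphic to the plane over K
(`Trivialization.isTrivial_of_matrix`). So A is a division algebra when S is non-trivial. A
non-scalar a in A then has an irreducible characteristic polynomial over K, hence three distinct
eigenvalues as K is perfect (`exists_isEigenframe`), and the Galois group permutes the three
eigenlines as it permutes the eigenvalues. The eigenlines are therefore the geometric points of a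
point of degree 3, and σ fixes all of them exactly when it fixes all eigenvalues.

It remains to find two elements of A whose eigenvalues generate different fields. Following
Wedderburn, A contains a non-scalar y with y³ = c scalar (`exists_cube`), which excludes
characteristic 3. With u = zy - yz nonzero, the element w = u y u⁻¹ y⁻¹ satisfies w y = y (-1 -
w⁻¹). From this one obtains r and y in A that do not commute, with y³ = c and r y = y g(r) for a
polynomial g over K (`exists_isEigenframe_pair`). Then y permutes the eigenlines of r cyclically and
K(r) is a cyclic cubic field. If the splitting field of r contained the cube roots of c, some
polynomial f(r) would agree with y on a nonzero vector; in a division algebra this forces y = f(r),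
against non-commutation (`exists_fix_and_ne`).

A σ that fixes the eigenvalues of r and moves one of y fixes every geometric point over p and moves
one over q. Hence the splitting fields differ; and since automorphisms of S over K commute with the
Galois action, none maps p to q. -/

namespace SeveriBrauer

/-! ### Galois descent for vector spaces -/

section GaloisDescent

variable {K L V : Type*} [Field K] [Field L] [Algebra K L] [IsGalois K L] [AddCommGroup V]
  [Module L V]

/-- Galois descent for vector spaces: a vector with open stabilizer for a semilinear action of the
Galois group lies in the span of the invariant vectors. -/
theorem mem_span_invariants (ρ : (L ≃ₐ[K] L) → V → V)
    (hadd : ∀ σ x y, ρ σ (x + y) = ρ σ x + ρ σ y)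
    (hsmul : ∀ σ (c : L) x, ρ σ (c • x) = σ c • ρ σ x)
    (hmul : ∀ σ τ x, ρ (σ * τ) x = ρ σ (ρ τ x)) (v : V)
    (E : IntermediateField K L) [FiniteDimensional K E]
    (hE : ∀ σ ∈ E.fixingSubgroup, ρ σ v = v) :
    v ∈ Submodule.span L {x | ∀ σ, ρ σ x = x} := by
  classical
  have hext : ∀ f : E →ₐ[K] L, ∃ σ : L ≃ₐ[K] L, ∀ x : E, σ x = f x := fun f => by
    refine ⟨AlgEquiv.ofBijective (f.liftNormal L) (AlgHom.normal_bijective K L L _), fun x => ?_⟩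
    exact f.liftNormal_commutes L x
  choose s hs using hext
  -- The translate of `v` depends only on the restriction to `E`, so the sum over embeddings of `E`
  -- below is a finite substitute for a sum over the Galois group.
  have hwd : ∀ σ τ : L ≃ₐ[K] L, (∀ x : E, σ x = τ x) → ρ σ v = ρ τ v := fun σ τ h => by
    have h1 : τ⁻¹ * σ ∈ E.fixingSubgroup := by
      rw [IntermediateField.mem_fixingSubgroup_iff]
      intro x hx
      rw [AlgEquiv.mul_apply, h ⟨x, hx⟩]
      exact τ.symm_apply_apply x
    have h2 := hE _ h1
    calc ρ σ v = ρ (τ * (τ⁻¹ * σ)) v := by rw [mul_inv_cancel_left]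
      _ = ρ τ v := by rw [hmul, h2]
  have hzero : ∀ σ, ρ σ 0 = 0 := fun σ => by
    have := hadd σ 0 0
    simpa using this
  -- The trace of `c • v`; it is invariant because the Galois group permutes the embeddings of `E`.
  let tr : E → V := fun c => ∑ f : E →ₐ[K] L, f c • ρ (s f) v
  have htr : ∀ c, tr c ∈ {x | ∀ σ, ρ σ x = x} := fun c τ => by
    have hsum : ρ τ (tr c) = ∑ f : E →ₐ[K] L, ρ τ (f c • ρ (s f) v) :=
      map_sum (⟨⟨ρ τ, hzero τ⟩, hadd τ⟩ : V →+ V) _ _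
    rw [hsum]
    refine Fintype.sum_bijective (fun f : E →ₐ[K] L => (τ : L →ₐ[K] L).comp f) ?_ _ _ ?_
    · refine ⟨fun f g h => ?_, fun g => ⟨(τ.symm : L →ₐ[K] L).comp g, ?_⟩⟩
      · ext x
        exact τ.injective (DFunLike.congr_fun h x)
      · ext x
        simp
    · intro f
      rw [hsmul, ← hmul]
      congr 1
      refine hwd _ _ fun x => ?_
      rw [AlgEquiv.mul_apply, hs, hs]
      rfl
  by_contra hv
  obtain ⟨φ, hφv, hφ⟩ := Submodule.exists_le_ker_of_notMem hv
  -- A functional that kills all traces gives a linear relation between the embeddings of `E`. By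
  -- Dedekind its coefficients vanish, and the one at the inclusion is the value at `v`.
  have hind := linearIndependent_toLinearMap K E L
  rw [Fintype.linearIndependent_iff] at hind
  have h0 := hind (fun f => φ (ρ (s f) v)) (by
    ext c
    have := hφ (Submodule.subset_span (htr c))
    simp only [tr, LinearMap.mem_ker, map_sum, map_smul, smul_eq_mul] at this
    simpa [mul_comm] using this) E.val
  refine hφv ?_
  rwa [hwd (s E.val) 1 (fun x => by rw [hs]; rfl), hE 1 (one_mem _)] at h0

end GaloisDescent

/-! ### Projective cocycles and the twisted matrix algebra -/

section Twisted

variable {K L : Type*} [Field K] [Field L] [Algebra K L]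

/-- A family of matrices `N σ` such that `v ↦ N σ *ᵥ σ(v)` is a semilinear action of the Galois
group on lines, with open stabilizers. -/
structure IsProjectiveCocycle (N : (L ≃ₐ[K] L) → Matrix (Fin 3) (Fin 3) L) : Prop where
  det_ne_zero : ∀ σ, (N σ).det ≠ 0
  cocycle : ∀ σ τ, ∃ c : L, N σ * (N τ).map σ = c • N (σ * τ)
  exists_fixes : ∀ v : Fin 3 → L, v ≠ 0 → ∃ E : IntermediateField K L, FiniteDimensional K E ∧
    ∀ σ ∈ E.fixingSubgroup, ∃ c : L, (N σ).mulVec (σ ∘ v) = c • v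

/-- The algebra of matrices that are invariant under the twisted Galois action. -/
def twistedAlgebra (N : (L ≃ₐ[K] L) → Matrix (Fin 3) (Fin 3) L) :
    Subalgebra K (Matrix (Fin 3) (Fin 3) L) where
  carrier := {M | ∀ σ, N σ * M.map σ = M * N σ}
  mul_mem' {a b} ha hb σ := by
    rw [Matrix.map_mul, ← mul_assoc, ha σ, mul_assoc, hb σ, mul_assoc]
  add_mem' {a b} ha hb σ := by
    rw [Matrix.map_add _ (map_add σ), mul_add, ha σ, hb σ, add_mul]
  algebraMap_mem' r σ := by
    have : (algebraMap K (Matrix (Fin 3) (Fin 3) L) r).map σ = algebraMap K _ r := by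
      ext i j
      simp only [Matrix.algebraMap_matrix_apply, Matrix.map_apply]
      split_ifs <;> simp
    rw [this]
    exact (Algebra.commutes r (N σ)).symm

theorem map_mulVec_comp (σ : L ≃ₐ[K] L) (M : Matrix (Fin 3) (Fin 3) L) (v : Fin 3 → L) :
    σ ∘ (M.mulVec v) = (M.map σ).mulVec (σ ∘ v) := by
  ext i
  simp [Matrix.mulVec, dotProduct]

theorem comp_smul_vec (σ : L ≃ₐ[K] L) (c : L) (v : Fin 3 → L) :
    σ ∘ (c • v) = σ c • (σ ∘ v) := by
  ext i
  simp

namespace IsProjectiveCocycle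

variable {N : (L ≃ₐ[K] L) → Matrix (Fin 3) (Fin 3) L}

theorem isUnit_det (hN : IsProjectiveCocycle N) (σ) : IsUnit (N σ).det :=
  (hN.det_ne_zero σ).isUnit

theorem mulVec_ne_zero (hN : IsProjectiveCocycle N) (σ) {v : Fin 3 → L} (hv : v ≠ 0) :
    (N σ).mulVec (σ ∘ v) ≠ 0 := by
  intro h
  have h1 := Matrix.eq_zero_of_mulVec_eq_zero (hN.det_ne_zero σ) h
  refine hv (funext fun i => ?_)
  have := congrFun h1 i
  simpa using this

/-- A matrix that preserves the three coordinate lines and the line of (1, 1, 1) is scalar, and each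
of the four lines has an open stabilizer. -/
theorem exists_scalar (hN : IsProjectiveCocycle N) :
    ∃ E : IntermediateField K L, FiniteDimensional K E ∧
      ∀ σ ∈ E.fixingSubgroup, ∃ c : L, N σ = c • 1 := by
  have h1 : ∀ i : Fin 3, (Pi.single i 1 : Fin 3 → L) ≠ 0 := fun i => by simp
  have h2 : (fun _ => 1 : Fin 3 → L) ≠ 0 := fun h => one_ne_zero (congrFun h 0)
  choose E hE hfix using fun i => hN.exists_fixes _ (h1 i)
  obtain ⟨E', hE', hfix'⟩ := hN.exists_fixes _ h2
  have := hE 0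
  have := hE 1
  have := hE 2
  refine ⟨E' ⊔ (E 0 ⊔ (E 1 ⊔ E 2)), inferInstance, fun σ hσ => ?_⟩
  have hE'' : ∀ i, E i ≤ E' ⊔ (E 0 ⊔ (E 1 ⊔ E 2)) := by
    intro i
    fin_cases i
    · exact le_sup_left.trans le_sup_right
    · exact (le_sup_left.trans le_sup_right).trans le_sup_right
    · exact (le_sup_right.trans le_sup_right).trans le_sup_right
  choose c hc using fun i => hfix i σ (IntermediateField.fixingSubgroup_le (hE'' i) hσ)
  obtain ⟨d, hd⟩ := hfix' σ (IntermediateField.fixingSubgroup_le le_sup_left hσ)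
  have hs : ∀ i, σ ∘ (Pi.single i 1 : Fin 3 → L) = Pi.single i 1 := fun i => by
    ext j
    by_cases h : j = i
    · subst h; simp
    · simp [h]
  have h3 : ∀ i j, N σ j i = if j = i then c i else 0 := fun i j => by
    have := congrFun (hc i) j
    rw [hs, Matrix.mulVec_single_one] at this
    simpa [Matrix.col_apply, Pi.single_apply] using this
  have h4 : ∀ i, c i = d := fun i => by
    have := congrFun hd i
    simpa [Matrix.mulVec, dotProduct, h3] using this
  refine ⟨d, ?_⟩
  ext i j
  rw [h3, h4]
  simp [Matrix.one_apply]

section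

variable [IsGalois K L]

/-- On matrices the action M ↦ N_σ σ(M) N_σ⁻¹ is a genuine one, since the scalar ambiguity of the
cocycle cancels in a conjugation. Descent applies because the matrix units have open stabilizers by
`exists_scalar`. -/
theorem span_twistedAlgebra (hN : IsProjectiveCocycle N) :
    Submodule.span L (twistedAlgebra N : Set (Matrix (Fin 3) (Fin 3) L)) = ⊤ := by
  obtain ⟨E, hE, hfix⟩ := hN.exists_scalar
  let ρ : (L ≃ₐ[K] L) → Matrix (Fin 3) (Fin 3) L → Matrix (Fin 3) (Fin 3) L :=
    fun σ M => N σ * M.map σ * (N σ)⁻¹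
  have hset : {x | ∀ σ, ρ σ x = x} = (twistedAlgebra N : Set (Matrix (Fin 3) (Fin 3) L)) := by
    ext M
    refine forall_congr' fun σ => ⟨fun h => ?_, fun h => ?_⟩
    · conv_rhs => rw [← h]
      rw [Matrix.nonsing_inv_mul_cancel_right _ _ (hN.isUnit_det σ)]
    · change N σ * M.map σ * (N σ)⁻¹ = M
      rw [h, Matrix.mul_nonsing_inv_cancel_right _ _ (hN.isUnit_det σ)]
  have hmul : ∀ σ τ x, ρ (σ * τ) x = ρ σ (ρ τ x) := fun σ τ x => by
    obtain ⟨c, hc⟩ := hN.cocycle σ τ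
    have hinv : ((N τ)⁻¹.map σ) = ((N τ).map σ)⁻¹ := by
      symm
      apply Matrix.inv_eq_right_inv
      rw [← Matrix.map_mul, Matrix.mul_nonsing_inv _ (hN.isUnit_det τ)]
      simp
    have hmm : (x.map τ).map σ = x.map (σ * τ) := rfl
    have hu : IsUnit ((N τ).map σ).det := by
      have : ((N τ).map σ).det = σ (N τ).det := (AlgEquiv.map_det σ (N τ)).symm
      rw [this]
      exact (hN.isUnit_det τ).map σ
    have h1 : N (σ * τ) * (x.map (σ * τ)) = ρ σ (ρ τ x) * N (σ * τ) := by
      have hc0 : c ≠ 0 := by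
        rintro rfl
        have := congrArg Matrix.det hc
        rw [zero_smul, Matrix.det_mul, Matrix.det_zero] at this
        exact mul_ne_zero (hN.det_ne_zero σ) hu.ne_zero this
      have : c • (N (σ * τ) * (x.map (σ * τ))) = c • (ρ σ (ρ τ x) * N (σ * τ)) := by
        rw [← smul_mul_assoc, ← mul_smul_comm, ← hc]
        simp only [ρ, Matrix.map_mul, hinv, hmm, mul_assoc]
        rw [Matrix.nonsing_inv_mul_cancel_left _ _ (hN.isUnit_det σ), Matrix.nonsing_inv_mul _ hu,
          mul_one]
      exact smul_right_injective _ hc0 this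
    change N (σ * τ) * (x.map (σ * τ)) * (N (σ * τ))⁻¹ = _
    rw [h1, Matrix.mul_nonsing_inv_cancel_right _ _ (hN.isUnit_det _)]
  rw [← hset, eq_top_iff]
  intro M _
  rw [Matrix.matrix_eq_sum_single M]
  refine sum_mem fun i _ => sum_mem fun j _ => ?_
  have : Matrix.single i j (M i j) = M i j • Matrix.single i j (1 : L) := by simp
  rw [this]
  refine Submodule.smul_mem _ _ (mem_span_invariants ρ (fun σ x y => ?_) (fun σ c x => ?_) hmul
    _ E fun σ hσ => ?_)
  · simp only [ρ]
    rw [Matrix.map_add _ (map_add σ), mul_add, add_mul]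
  · have : (c • x).map σ = σ c • x.map σ := by ext; simp
    simp only [ρ]
    rw [this, mul_smul_comm, smul_mul_assoc]
  · obtain ⟨c, hc⟩ := hfix σ hσ
    have hs : (Matrix.single i j (1 : L)).map σ = Matrix.single i j 1 := by simp
    have h1 : N σ * Matrix.single i j 1 = Matrix.single i j 1 * N σ := by rw [hc]; simp
    simp only [ρ]
    rw [hs, h1, Matrix.mul_nonsing_inv_cancel_right _ _ (hN.isUnit_det σ)]

/-- If the twisted action fixes a line, then the cocycle is trivial. -/
theorem exists_trivialization_of_fixed (hN : IsProjectiveCocycle N) {v₀ : Fin 3 → L}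
    (hv₀ : v₀ ≠ 0) (hfix : ∀ σ, ∃ c : L, (N σ).mulVec (σ ∘ v₀) = c • v₀) :
    ∃ P : Matrix (Fin 3) (Fin 3) L, P.det ≠ 0 ∧ ∀ σ, ∃ c : L, N σ * P.map σ = c • P := by
  choose c hc using hfix
  have hc0 : ∀ σ, c σ ≠ 0 := fun σ h => hN.mulVec_ne_zero σ hv₀ (by rw [hc, h, zero_smul])
  -- Normalizing N_σ so that `v₀` itself is fixed, and not just its line, turns the projective
  -- cocycle into an honest semilinear action.
  let ρ : (L ≃ₐ[K] L) → (Fin 3 → L) → (Fin 3 → L) :=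
    fun σ v => (c σ)⁻¹ • (N σ).mulVec (σ ∘ v)
  have hmul : ∀ σ τ x, ρ (σ * τ) x = ρ σ (ρ τ x) := fun σ τ x => by
    obtain ⟨d, hd⟩ := hN.cocycle σ τ
    have key : ∀ w : Fin 3 → L, (N σ).mulVec (σ ∘ ((N τ).mulVec (τ ∘ w))) =
        d • (N (σ * τ)).mulVec ((σ * τ : L ≃ₐ[K] L) ∘ w) := fun w => by
      rw [map_mulVec_comp, Matrix.mulVec_mulVec, hd, Matrix.smul_mulVec]
      rfl
    have h1 : d * c (σ * τ) = σ (c τ) * c σ := by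
      have h2 := key v₀
      rw [hc, hc, comp_smul_vec, Matrix.mulVec_smul, hc, smul_smul, smul_smul] at h2
      exact (smul_left_injective L hv₀ h2).symm
    have hd0 : d ≠ 0 := by
      rintro rfl
      rw [zero_mul] at h1
      exact mul_ne_zero (by simpa using hc0 τ) (hc0 σ) h1.symm
    simp only [ρ]
    rw [comp_smul_vec, Matrix.mulVec_smul, key, smul_smul, smul_smul, map_inv₀]
    congr 1
    have h3 : c (σ * τ) = σ (c τ) * c σ * d⁻¹ := by
      rw [← h1]
      field_simp
    rw [h3]
    simp only [mul_inv, inv_inv]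
    ring
  have hspan : Submodule.span L {x | ∀ σ, ρ σ x = x} = ⊤ := by
    obtain ⟨E, hE, hE1⟩ := hN.exists_scalar
    have : FiniteDimensional K (IntermediateField.adjoin K (Set.range v₀)) := by
      apply IntermediateField.finiteDimensional_adjoin
      rintro x -
      exact Algebra.IsIntegral.isIntegral x
    rw [eq_top_iff]
    intro v _
    rw [pi_eq_sum_univ' v]
    refine sum_mem fun i _ => Submodule.smul_mem _ _ ?_
    -- Over `E` the matrix N_σ is a scalar, and once the coordinates of `v₀` are fixed too this
    -- scalar must be `c σ`; so the normalized action fixes the standard basis.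
    refine mem_span_invariants ρ (fun σ x y => ?_) (fun σ c x => ?_) hmul _
      (E ⊔ IntermediateField.adjoin K (Set.range v₀)) fun σ hσ => ?_
    · have : σ ∘ (x + y) = σ ∘ x + σ ∘ y := by ext; simp
      simp only [ρ]
      rw [this, Matrix.mulVec_add, smul_add]
    · simp only [ρ]
      rw [comp_smul_vec, Matrix.mulVec_smul, smul_comm]
    · obtain ⟨d, hd⟩ := hE1 σ (IntermediateField.fixingSubgroup_le le_sup_left hσ)
      have hσv : σ ∘ v₀ = v₀ := by
        ext i
        have h1 := IntermediateField.fixingSubgroup_le le_sup_right hσ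
        rw [IntermediateField.mem_fixingSubgroup_iff] at h1
        exact h1 _ (IntermediateField.subset_adjoin K _ ⟨i, rfl⟩)
      have h2 := hc σ
      rw [hσv, hd, Matrix.smul_mulVec, Matrix.one_mulVec] at h2
      have h3 : d = c σ := smul_left_injective L hv₀ h2
      have hs : σ ∘ (Pi.single i 1 : Fin 3 → L) = Pi.single i 1 := by
        ext j
        by_cases h : j = i
        · subst h; simp
        · simp [h]
      simp only [ρ]
      rw [hs, hd, h3, Matrix.smul_mulVec, Matrix.one_mulVec, smul_smul, inv_mul_cancel₀ (hc0 σ),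
        one_smul]
  obtain ⟨b, hb, hbs, hbi⟩ := exists_linearIndependent L {x | ∀ σ, ρ σ x = x}
  rw [hspan] at hbs
  let B := Module.Basis.mk hbi (by rw [Subtype.range_coe, hbs])
  have : Finite b := Module.Finite.finite_basis B
  have : Fintype b := Fintype.ofFinite b
  have hcard : Fintype.card b = 3 := by
    rw [← Module.finrank_eq_card_basis B, Module.finrank_fin_fun]
  let e : b ≃ Fin 3 := Fintype.equivFinOfCardEq hcard
  let P : Matrix (Fin 3) (Fin 3) L := Matrix.of fun i j => (e.symm j : Fin 3 → L) i
  refine ⟨P, ?_, fun σ => ⟨c σ, ?_⟩⟩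
  · have hli : LinearIndependent L P.col := by
      have := hbi.comp e.symm e.symm.injective
      exact this
    have := Matrix.linearIndependent_cols_iff_isUnit.1 hli
    rw [Matrix.isUnit_iff_isUnit_det] at this
    exact this.ne_zero
  · ext i j
    have h1 := hb (e.symm j).2 σ
    have h2 := congrFun h1 i
    simp only [ρ, Pi.smul_apply, smul_eq_mul] at h2
    rw [inv_mul_eq_iff_eq_mul₀ (hc0 σ)] at h2
    exact h2

/-- Unless the cocycle is trivial, the twisted algebra is a division algebra. -/
theorem exists_trivialization_or_det_ne_zero (hN : IsProjectiveCocycle N) :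
    (∃ P : Matrix (Fin 3) (Fin 3) L, P.det ≠ 0 ∧ ∀ σ, ∃ c : L, N σ * P.map σ = c • P) ∨
      ∀ M ∈ twistedAlgebra N, M ≠ 0 → M.det ≠ 0 := by
  rw [or_iff_not_imp_right]
  intro h
  push Not at h
  obtain ⟨M, hM, hM0, hdet⟩ := h
  have hrk := M.mulVecLin.finrank_range_add_finrank_ker
  rw [Module.finrank_fin_fun] at hrk
  have hker : Module.finrank L (LinearMap.ker M.mulVecLin) ≠ 0 := fun h0 => by
    obtain ⟨v, hv, hv'⟩ := Matrix.exists_mulVec_eq_zero_iff.2 hdet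
    have := Submodule.finrank_eq_zero.1 h0
    exact hv ((Submodule.eq_bot_iff _).1 this v hv')
  have hran : Module.finrank L (LinearMap.range M.mulVecLin) ≠ 0 := fun h0 => by
    have := LinearMap.range_eq_bot.1 (Submodule.finrank_eq_zero.1 h0)
    refine hM0 ?_
    ext i j
    have := congrFun (DFunLike.congr_fun this (Pi.single j 1)) i
    simpa using this
  have hline : ∀ W : Submodule L (Fin 3 → L), Module.finrank L W = 1 →
      (∀ σ, ∀ w ∈ W, (N σ).mulVec (σ ∘ w) ∈ W) →
      ∃ P : Matrix (Fin 3) (Fin 3) L, P.det ≠ 0 ∧ ∀ σ, ∃ c : L, N σ * P.map σ = c • P := by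
    intro W hW hst
    obtain ⟨v, hv, hall⟩ := finrank_eq_one_iff'.1 hW
    refine hN.exists_trivialization_of_fixed (v₀ := v) (by simpa using hv) fun σ => ?_
    obtain ⟨c, hc⟩ := hall ⟨_, hst σ v v.2⟩
    exact ⟨c, (congrArg Subtype.val hc).symm⟩
  -- Kernel and image are both nonzero and their dimensions add up to 3, so one of them is a line.
  -- Both are stable because `M` commutes with the twisted action.
  by_cases h1 : Module.finrank L (LinearMap.ker M.mulVecLin) = 1
  · refine hline _ h1 fun σ w hw => ?_
    simp only [LinearMap.mem_ker, Matrix.mulVecLin_apply] at hw ⊢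
    rw [Matrix.mulVec_mulVec, ← hM σ, ← Matrix.mulVec_mulVec, ← map_mulVec_comp, hw]
    have : σ ∘ (0 : Fin 3 → L) = 0 := by ext; simp
    rw [this, Matrix.mulVec_zero]
  · refine hline (LinearMap.range M.mulVecLin) (by omega) fun σ w hw => ?_
    obtain ⟨x, rfl⟩ := hw
    refine ⟨(N σ).mulVec (σ ∘ x), ?_⟩
    simp only [Matrix.mulVecLin_apply]
    rw [map_mulVec_comp, Matrix.mulVec_mulVec, Matrix.mulVec_mulVec, hM σ]

end

end IsProjectiveCocycle

end Twisted

end SeveriBrauer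

namespace SeveriBrauer

/-! ### Trace and adjugate identities in size 3 -/

section MatrixIdentities

variable {L : Type*} [Field L]

/-- The Cayley–Hamilton theorem in size 3, in a form that also covers singular matrices; the trace
of the adjugate is the second coefficient of the characteristic polynomial. -/
theorem adjugate_eq_sq_sub (M : Matrix (Fin 3) (Fin 3) L) :
    M.adjugate = M * M - M.trace • M + M.adjugate.trace • 1 := by
  rw [Matrix.adjugate_fin_three]
  ext i j
  fin_cases i <;> fin_cases j <;>
    simp [Matrix.mul_apply, Fin.sum_univ_three, Matrix.trace] <;> ring

theorem cube_eq_det_smul_one {M : Matrix (Fin 3) (Fin 3) L} (h1 : M.trace = 0)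
    (h2 : M.adjugate.trace = 0) : M * (M * M) = M.det • 1 := by
  have := M.mul_adjugate
  rwa [adjugate_eq_sq_sub, h1, h2, zero_smul, zero_smul, sub_zero, add_zero] at this

/-- Conjugation by Y preserves the trace of U and also multiplies it by k. -/
theorem trace_eq_zero_of_mul_eq_smul {Y U : Matrix (Fin 3) (Fin 3) L} {k : L} (hY : Y.det ≠ 0)
    (hk : k ≠ 1) (h : Y * U = k • (U * Y)) : U.trace = 0 := by
  have h1 : U.trace = k * U.trace := by
    have h2 : Y * U * Y⁻¹ = k • U := by
      rw [h, smul_mul_assoc, Matrix.mul_nonsing_inv_cancel_right _ _ hY.isUnit]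
    have h3 := congrArg Matrix.trace h2
    rwa [Matrix.trace_mul_cycle, Matrix.nonsing_inv_mul _ hY.isUnit, one_mul, Matrix.trace_smul,
      smul_eq_mul] at h3
  have h4 : (k - 1) * U.trace = 0 := by linear_combination -h1
  exact (mul_eq_zero.1 h4).resolve_left (sub_ne_zero.2 hk)

end MatrixIdentities

/-! ### Eigenvalues and eigenlines of elements of the twisted algebra -/

section Twisted

variable {K L : Type*} [Field K] [Field L] [Algebra K L]

theorem exists_algebraMap_eq_of_fixed [IsGalois K L] {x : L} (h : ∀ σ : L ≃ₐ[K] L, σ x = x) :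
    ∃ k, algebraMap K L k = x := by
  have h1 : x ∈ IntermediateField.fixedField (⊥ : IntermediateField K L).fixingSubgroup :=
    fun σ => h σ
  rwa [InfiniteGalois.fixedField_fixingSubgroup, IntermediateField.mem_bot] at h1

/-- By the Galois correspondence y lies in K(x), and K(x) = K[x] as x is algebraic. -/
theorem exists_aeval_eq_of_fixed [IsGalois K L] {x y : L}
    (h : ∀ σ : L ≃ₐ[K] L, σ x = x → σ y = y) : ∃ f : Polynomial K, Polynomial.aeval x f = y := by
  have h1 : y ∈ IntermediateField.fixedField
      (IntermediateField.adjoin K {x} : IntermediateField K L).fixingSubgroup := fun σ =>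
    h σ ((IntermediateField.mem_fixingSubgroup_iff _ _).1 σ.2 x
      (IntermediateField.mem_adjoin_simple_self K x))
  rw [InfiniteGalois.fixedField_fixingSubgroup] at h1
  have h2 := IntermediateField.adjoin_simple_toSubalgebra_of_isAlgebraic
    (Algebra.IsAlgebraic.isAlgebraic (R := K) x)
  have h3 : y ∈ (IntermediateField.adjoin K {x} : IntermediateField K L).toSubalgebra := h1
  rw [h2, Algebra.adjoin_singleton_eq_range_aeval] at h3
  exact h3

theorem aeval_mulVec_of_eigen {a : Matrix (Fin 3) (Fin 3) L} {v : Fin 3 → L} {μ : L}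
    (h : a.mulVec v = μ • v) (f : Polynomial K) :
    (Polynomial.aeval a f).mulVec v = Polynomial.aeval μ f • v := by
  induction f using Polynomial.induction_on' with
  | add p q hp hq => simp only [map_add, Matrix.add_mulVec, hp, hq, add_smul]
  | monomial n c =>
    have hpow : ∀ n : ℕ, (a ^ n).mulVec v = μ ^ n • v := fun n => by
      induction n with
      | zero => simp
      | succ n ih => rw [pow_succ, ← Matrix.mulVec_mulVec, h, Matrix.mulVec_smul, ih, smul_smul,
          pow_succ, mul_comm]
    simp only [Polynomial.aeval_monomial]
    rw [← Matrix.mulVec_mulVec, hpow, Matrix.mulVec_smul, Algebra.algebraMap_eq_smul_one,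
      Matrix.smul_mulVec, Matrix.one_mulVec, mul_smul,
      algebraMap_smul, smul_comm]

/-- Eigenvalues and eigenvectors of a matrix of size `3` whose eigenvalues are distinct and form an
orbit of the Galois group. -/
structure IsEigenframe (K : Type*) {L : Type*} [Field K] [Field L] [Algebra K L]
    (a : Matrix (Fin 3) (Fin 3) L) (ev : Fin 3 → L) (vec : Fin 3 → Fin 3 → L) :
    Prop where
  injective : Function.Injective ev
  ne_zero : ∀ i, vec i ≠ 0
  eigen : ∀ i, a.mulVec (vec i) = ev i • vec i
  orbit : ∀ (σ : L ≃ₐ[K] L) i, ∃ j, σ (ev i) = ev j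
  transitive : ∀ i j, ∃ σ : L ≃ₐ[K] L, σ (ev i) = ev j

namespace IsEigenframe

variable {a : Matrix (Fin 3) (Fin 3) L} {ev : Fin 3 → L} {vec : Fin 3 → Fin 3 → L}

theorem linearIndependent (h : IsEigenframe K a ev vec) : LinearIndependent L vec :=
  Module.End.eigenvectors_linearIndependent' a.mulVecLin ev h.injective vec fun i =>
    ⟨Module.End.mem_eigenspace_iff.2 (h.eigen i), h.ne_zero i⟩

theorem exists_eq_sum (h : IsEigenframe K a ev vec) (w : Fin 3 → L) :
    ∃ c : Fin 3 → L, w = ∑ i, c i • vec i := by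
  let B := basisOfLinearIndependentOfCardEqFinrank h.linearIndependent (by simp)
  refine ⟨B.repr w, ?_⟩
  conv_lhs => rw [← B.sum_repr w]
  simp [B]

theorem smul_eq_of_eigen (h : IsEigenframe K a ev vec) {w : Fin 3 → L} {μ : L}
    (hw : a.mulVec w = μ • w) : ∃ c : Fin 3 → L, (∀ i, c i * (ev i - μ) = 0) ∧
      w = ∑ i, c i • vec i := by
  obtain ⟨c, hc⟩ := h.exists_eq_sum w
  refine ⟨c, ?_, hc⟩
  have h1 : ∑ i, (c i * (ev i - μ)) • vec i = 0 := by
    have : ∑ i, (c i * (ev i - μ)) • vec i = a.mulVec w - μ • w := by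
      rw [hc, Finset.smul_sum, Matrix.mulVec_sum, ← Finset.sum_sub_distrib]
      refine Finset.sum_congr rfl fun i _ => ?_
      rw [Matrix.mulVec_smul, h.eigen, smul_smul, smul_smul, ← sub_smul]
      congr 1
      ring
    rw [this, hw, sub_self]
  exact Fintype.linearIndependent_iff.1 h.linearIndependent _ h1

theorem exists_smul_eq (h : IsEigenframe K a ev vec) {w : Fin 3 → L} {i : Fin 3}
    (hw : a.mulVec w = ev i • w) : ∃ c : L, w = c • vec i := by
  obtain ⟨c, hc, hw'⟩ := h.smul_eq_of_eigen hw
  refine ⟨c i, ?_⟩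
  rw [hw']
  refine Finset.sum_eq_single i (fun j _ hj => ?_) (by simp)
  have := (mul_eq_zero.1 (hc j)).resolve_right (sub_ne_zero.2 (h.injective.ne hj))
  rw [this, zero_smul]

theorem exists_ev_eq (h : IsEigenframe K a ev vec) {w : Fin 3 → L} (hw0 : w ≠ 0) {μ : L}
    (hw : a.mulVec w = μ • w) : ∃ i, μ = ev i := by
  obtain ⟨c, hc, hw'⟩ := h.smul_eq_of_eigen hw
  by_contra! hne
  refine hw0 ?_
  rw [hw']
  refine Finset.sum_eq_zero fun i _ => ?_
  have := (mul_eq_zero.1 (hc i)).resolve_right (sub_ne_zero.2 (hne i).symm)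
  rw [this, zero_smul]

/-- The twisted Galois action permutes the eigenlines as the Galois group permutes the
eigenvalues. -/
theorem twisted_mulVec_eq (h : IsEigenframe K a ev vec) {N : (L ≃ₐ[K] L) → Matrix (Fin 3) (Fin 3) L}
    (ha : a ∈ twistedAlgebra N) {σ : L ≃ₐ[K] L} {i j : Fin 3}
    (hσ : σ (ev i) = ev j) : ∃ c : L, (N σ).mulVec (σ ∘ vec i) = c • vec j := by
  refine h.exists_smul_eq ?_
  rw [Matrix.mulVec_mulVec, ← ha σ, ← Matrix.mulVec_mulVec, ← map_mulVec_comp, h.eigen,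
    comp_smul_vec, Matrix.mulVec_smul, hσ]

theorem eq_of_smul_eq (h : IsEigenframe K a ev vec) {i j : Fin 3} {c : L}
    (hc : vec i = c • vec j) : i = j := by
  have h1 := h.eigen i
  rw [hc, Matrix.mulVec_smul, h.eigen, smul_smul, smul_smul] at h1
  have hc0 : c ≠ 0 := by
    rintro rfl
    exact h.ne_zero i (by rw [hc, zero_smul])
  have h2 := smul_left_injective L (h.ne_zero j) h1
  refine h.injective (mul_left_cancel₀ hc0 ?_)
  rw [h2]
  ring

end IsEigenframe

variable {N : (L ≃ₐ[K] L) → Matrix (Fin 3) (Fin 3) L}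

theorem smul_mem_twistedAlgebra [IsGalois K L] {M : Matrix (Fin 3) (Fin 3) L}
    (hM : M ∈ twistedAlgebra N) {k : L} (hk : ∀ σ : L ≃ₐ[K] L, σ k = k) :
    k • M ∈ twistedAlgebra N := by
  obtain ⟨k, rfl⟩ := exists_algebraMap_eq_of_fixed hk
  rw [algebraMap_smul]
  exact Subalgebra.smul_mem _ hM k

theorem smul_one_mem_twistedAlgebra [IsGalois K L] {k : L} (hk : ∀ σ : L ≃ₐ[K] L, σ k = k) :
    k • (1 : Matrix (Fin 3) (Fin 3) L) ∈ twistedAlgebra N :=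
  smul_mem_twistedAlgebra (one_mem _) hk

namespace IsProjectiveCocycle

theorem map_eq_conj (hN : IsProjectiveCocycle N) {M : Matrix (Fin 3) (Fin 3) L}
    (hM : M ∈ twistedAlgebra N) (σ : L ≃ₐ[K] L) :
    M.map σ = (N σ)⁻¹ * M * N σ := by
  rw [mul_assoc, ← hM σ, Matrix.nonsing_inv_mul_cancel_left _ _ (hN.isUnit_det σ)]

theorem trace_fixed (hN : IsProjectiveCocycle N) {M : Matrix (Fin 3) (Fin 3) L}
    (hM : M ∈ twistedAlgebra N) (σ : L ≃ₐ[K] L) : σ M.trace = M.trace := by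
  have h1 : σ M.trace = (M.map σ).trace := by simp [Matrix.trace]
  rw [h1, hN.map_eq_conj hM, Matrix.trace_mul_cycle, Matrix.mul_nonsing_inv _ (hN.isUnit_det σ),
    one_mul]

theorem det_fixed (hN : IsProjectiveCocycle N) {M : Matrix (Fin 3) (Fin 3) L}
    (hM : M ∈ twistedAlgebra N) (σ : L ≃ₐ[K] L) : σ M.det = M.det := by
  have h1 : σ M.det = (M.map σ).det := AlgEquiv.map_det σ M
  rw [h1, hN.map_eq_conj hM, Matrix.det_mul_right_comm, Matrix.nonsing_inv_mul _ (hN.isUnit_det σ),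
    one_mul]

/-- Taking adjugates reverses the defining relation; multiplying by N_σ on both sides restores its
shape up to the nonzero factor det N_σ. -/
theorem adjugate_mem (hN : IsProjectiveCocycle N) {M : Matrix (Fin 3) (Fin 3) L}
    (hM : M ∈ twistedAlgebra N) : M.adjugate ∈ twistedAlgebra N := fun σ => by
  have h1 : M.adjugate.map σ = (M.map σ).adjugate :=
    (RingHom.map_adjugate (σ : L →+* L) M)
  have h2 := congrArg Matrix.adjugate (hM σ)
  rw [Matrix.adjugate_mul_distrib, Matrix.adjugate_mul_distrib, ← h1] at h2
  have h3 : N σ * (M.adjugate.map σ * (N σ).adjugate) * N σ =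
      N σ * ((N σ).adjugate * M.adjugate) * N σ := by rw [h2]
  rw [← mul_assoc (N σ) (N σ).adjugate, Matrix.mul_adjugate, ← mul_assoc,
    mul_assoc _ (N σ).adjugate, Matrix.adjugate_mul, mul_smul_comm, mul_one, smul_mul_assoc,
    one_mul, smul_mul_assoc] at h3
  exact smul_right_injective _ (hN.det_ne_zero σ) h3

theorem inv_mem [IsGalois K L] (hN : IsProjectiveCocycle N) {M : Matrix (Fin 3) (Fin 3) L}
    (hM : M ∈ twistedAlgebra N) : M⁻¹ ∈ twistedAlgebra N := by
  rw [Matrix.inv_def, Ring.inverse_eq_inv']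
  exact smul_mem_twistedAlgebra (hN.adjugate_mem hM) fun σ => by rw [map_inv₀, hN.det_fixed hM]

theorem scalar_fixed (hN : IsProjectiveCocycle N) {k : L}
    (hk : k • (1 : Matrix (Fin 3) (Fin 3) L) ∈ twistedAlgebra N) (σ : L ≃ₐ[K] L) : σ k = k := by
  have h1 := hN.map_eq_conj hk σ
  rw [mul_smul_comm, mul_one, smul_mul_assoc, Matrix.nonsing_inv_mul _ (hN.isUnit_det σ)] at h1
  have h2 := congrFun (congrFun h1 0) 0
  simpa using h2

/-- In a twisted division algebra, every element that is not a scalar has three distinct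
eigenvalues, which form a Galois orbit. -/
theorem exists_isEigenframe [PerfectField K] [IsAlgClosed L] [IsGalois K L]
    (hN : IsProjectiveCocycle N) (hdiv : ∀ M ∈ twistedAlgebra N, M ≠ 0 → M.det ≠ 0)
    {a : Matrix (Fin 3) (Fin 3) L} (ha : a ∈ twistedAlgebra N) (hns : ∀ k : L, a ≠ k • 1) :
    ∃ ev vec, IsEigenframe K a ev vec := by
  classical
  have hχ : ∀ σ : L ≃ₐ[K] L, a.charpoly.map (σ : L →+* L) = a.charpoly := fun σ => by
    rw [← Matrix.charpoly_map]
    change (a.map σ).charpoly = _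
    let u : (Matrix (Fin 3) (Fin 3) L)ˣ := ((Matrix.isUnit_iff_isUnit_det _).2 (hN.isUnit_det σ)).unit
    have h1 : a.map σ = (↑u⁻¹ : Matrix (Fin 3) (Fin 3) L) * a * (↑u : Matrix (Fin 3) (Fin 3) L) := by
      rw [hN.map_eq_conj ha, Matrix.coe_units_inv]
      rfl
    rw [h1, Matrix.coe_units_inv]
    exact Matrix.charpoly_units_conj' u a
  have hlift : a.charpoly ∈ Polynomial.lifts (algebraMap K L) := by
    rw [Polynomial.lifts_iff_coeff_lifts]
    intro n
    obtain ⟨k, hk⟩ := exists_algebraMap_eq_of_fixed (K := K) (x := a.charpoly.coeff n) fun σ => by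
      conv_rhs => rw [← hχ σ]
      rw [Polynomial.coeff_map]
      rfl
    exact ⟨k, hk⟩
  obtain ⟨q, hq, hdeg, hmon⟩ := Polynomial.lifts_and_natDegree_eq_and_monic hlift
    a.charpoly_monic
  rw [Matrix.charpoly_natDegree_eq_dim, Fintype.card_fin] at hdeg
  -- A cubic is irreducible as soon as it has no root. A root k in K would make a - k a nonzero
  -- singular element of the division algebra.
  have hirr : Irreducible q := by
    rw [hmon.irreducible_iff_roots_eq_zero_of_degree_le_three (by omega) (by omega)]
    rw [Multiset.eq_zero_iff_forall_notMem]
    intro k hk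
    have h1 := (Polynomial.mem_roots'.1 hk).2
    have h2 : a.charpoly.eval (algebraMap K L k) = 0 := by
      rw [← hq, Polynomial.eval_map_algebraMap, Polynomial.aeval_algebraMap_apply]
      rw [Polynomial.IsRoot.def] at h1
      simp [h1]
    rw [Matrix.eval_charpoly] at h2
    have h3 : Matrix.scalar (Fin 3) (algebraMap K L k) - a ∈ twistedAlgebra N := by
      refine sub_mem ?_ ha
      have := (twistedAlgebra N).algebraMap_mem k
      convert! this using 1
    have h4 : Matrix.scalar (Fin 3) (algebraMap K L k) - a = 0 := by
      by_contra h
      exact hdiv _ h3 h h2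
    refine hns (algebraMap K L k) ?_
    rw [← sub_eq_zero.1 h4, Matrix.scalar_apply, Matrix.smul_one_eq_diagonal]
  -- Perfectness of K enters here: an irreducible polynomial is separable.
  have hnodup : a.charpoly.roots.Nodup := by
    rw [← hq]
    exact Polynomial.nodup_roots ((PerfectField.separable_of_irreducible hirr).map)
  have hcard : a.charpoly.roots.toFinset.card = 3 := by
    rw [Multiset.toFinset_card_of_nodup hnodup, IsAlgClosed.card_roots_eq_natDegree,
      Matrix.charpoly_natDegree_eq_dim, Fintype.card_fin]
  let e := (Finset.equivFinOfCardEq hcard).symm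
  have hroot : ∀ i, a.charpoly.eval (e i : L) = 0 := fun i => by
    have := (e i).2
    rw [Multiset.mem_toFinset] at this
    exact (Polynomial.mem_roots'.1 this).2
  have hroot' : ∀ i, Polynomial.aeval (e i : L) q = 0 := fun i => by
    rw [← Polynomial.eval_map_algebraMap, hq, hroot]
  have hmin : ∀ i, q = minpoly K (e i : L) := fun i =>
    minpoly.eq_of_irreducible_of_monic hirr (hroot' i) hmon
  have hvec : ∀ i, ∃ v : Fin 3 → L, v ≠ 0 ∧ a.mulVec v = (e i : L) • v := fun i => by
    have h1 := hroot i
    rw [Matrix.eval_charpoly, ← Matrix.exists_mulVec_eq_zero_iff] at h1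
    obtain ⟨v, hv, hv'⟩ := h1
    refine ⟨v, hv, ?_⟩
    rw [Matrix.sub_mulVec, sub_eq_zero] at hv'
    rw [← hv', Matrix.scalar_apply, ← Matrix.smul_one_eq_diagonal, Matrix.smul_mulVec,
      Matrix.one_mulVec]
  choose v hv hv' using hvec
  refine ⟨fun i => e i, v, fun i j h => e.injective (Subtype.ext h), hv, hv', fun σ i => ?_,
    fun i j => ?_⟩
  · have h0 := Polynomial.aeval_algHom_apply (σ : L →ₐ[K] L) (e i : L) q
    rw [hroot' i, map_zero, ← Polynomial.eval_map_algebraMap, hq] at h0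
    have h1 : σ (e i : L) ∈ a.charpoly.roots.toFinset := by
      rw [Multiset.mem_toFinset, Polynomial.mem_roots a.charpoly_monic.ne_zero]
      exact h0
    exact ⟨e.symm ⟨_, h1⟩, by simp⟩
  · exact minpoly.exists_algEquiv_of_root (Algebra.IsAlgebraic.isAlgebraic _)
      (by rw [← hmin j, hroot' i])

end IsProjectiveCocycle

end Twisted

end SeveriBrauer

namespace SeveriBrauer

/-! ### Comparison of the splitting fields of two elements -/

section Twisted

variable {K L : Type*} [Field K] [Field L] [Algebra K L]
  {N : (L ≃ₐ[K] L) → Matrix (Fin 3) (Fin 3) L}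

theorem aeval_mem_twistedAlgebra {M : Matrix (Fin 3) (Fin 3) L} (hM : M ∈ twistedAlgebra N)
    (f : Polynomial K) : Polynomial.aeval M f ∈ twistedAlgebra N := by
  have := (Polynomial.aeval (⟨M, hM⟩ : twistedAlgebra N) f).2
  rwa [← Subalgebra.coe_val, ← Polynomial.aeval_algHom_apply] at this

/-- In a division algebra, an element that kills a nonzero vector is zero. -/
theorem eq_of_mulVec_eq (hdiv : ∀ M ∈ twistedAlgebra N, M ≠ 0 → M.det ≠ 0)
    {a b : Matrix (Fin 3) (Fin 3) L} (ha : a ∈ twistedAlgebra N) (hb : b ∈ twistedAlgebra N)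
    {v : Fin 3 → L} (hv : v ≠ 0) (h : a.mulVec v = b.mulVec v) : a = b := by
  by_contra hne
  refine hdiv _ (sub_mem ha hb) (sub_ne_zero.2 hne) (Matrix.exists_mulVec_eq_zero_iff.1 ⟨v, hv, ?_⟩)
  rw [Matrix.sub_mulVec, h, sub_self]

/-- The three elements are all the roots of T³ - c, whose constant coefficient gives their product.
-/
theorem mul_mul_eq_of_pairwise_ne {c t₀ t₁ t₂ : L} (h0 : t₀ ^ 3 = c) (h1 : t₁ ^ 3 = c)
    (h2 : t₂ ^ 3 = c) (h01 : t₀ ≠ t₁) (h12 : t₁ ≠ t₂) (h02 : t₀ ≠ t₂) : t₀ * t₁ * t₂ = c := by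
  have e1 : t₀ ^ 2 + t₀ * t₁ + t₁ ^ 2 = 0 :=
    (mul_eq_zero.1 (by linear_combination h0 - h1 :
      (t₀ - t₁) * (t₀ ^ 2 + t₀ * t₁ + t₁ ^ 2) = 0)).resolve_left (sub_ne_zero.2 h01)
  have e2 : t₀ ^ 2 + t₀ * t₂ + t₂ ^ 2 = 0 :=
    (mul_eq_zero.1 (by linear_combination h0 - h2 :
      (t₀ - t₂) * (t₀ ^ 2 + t₀ * t₂ + t₂ ^ 2) = 0)).resolve_left (sub_ne_zero.2 h02)
  have e3 : t₀ + t₁ + t₂ = 0 :=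
    (mul_eq_zero.1 (by linear_combination e1 - e2 :
      (t₁ - t₂) * (t₀ + t₁ + t₂) = 0)).resolve_left (sub_ne_zero.2 h12)
  linear_combination t₀ * t₁ * e3 - t₀ * e1 + h0

namespace IsEigenframe

/-- If conjugation by `y`, where `y ^ 3` is a scalar, maps `r` to another polynomial in `r`, then
the splitting field of `y` is not contained in the splitting field of `r`. -/
theorem exists_fix_and_ne [IsGalois K L]
    (hdiv : ∀ M ∈ twistedAlgebra N, M ≠ 0 → M.det ≠ 0)
    {r y : Matrix (Fin 3) (Fin 3) L} (hr : r ∈ twistedAlgebra N) (hy : y ∈ twistedAlgebra N)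
    {c : L} (hyc : y * (y * y) = c • 1) {g : Polynomial K}
    (hry : r * y = y * Polynomial.aeval r g) (hne : r * y ≠ y * r)
    {ev : Fin 3 → L} {u : Fin 3 → Fin 3 → L} (h : IsEigenframe K r ev u)
    {ev' : Fin 3 → L} {w : Fin 3 → Fin 3 → L} (h' : IsEigenframe K y ev' w) :
    ∃ σ : L ≃ₐ[K] L, (∀ i, σ (ev i) = ev i) ∧ ∃ i, σ (ev' i) ≠ ev' i := by
  by_contra! hcon
  have hy0 : y ≠ 0 := by
    rintro rfl
    simp at hne
  have hydet := hdiv y hy hy0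
  -- The relation r y = y g(r) says that y sends an eigenvector of r for x to one for g(x).
  let G : L → L := fun x => Polynomial.aeval x g
  have hstep : ∀ (x : L) (v : Fin 3 → L), r.mulVec v = x • v →
      r.mulVec (y.mulVec v) = G x • y.mulVec v := fun x v hv => by
    rw [Matrix.mulVec_mulVec, hry, ← Matrix.mulVec_mulVec, aeval_mulVec_of_eigen hv,
      Matrix.mulVec_smul]
  have hynz : ∀ v : Fin 3 → L, v ≠ 0 → y.mulVec v ≠ 0 := fun v hv hv' =>
    hv (Matrix.eq_zero_of_mulVec_eq_zero hydet hv')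
  have hG : ∀ (x : L) (v : Fin 3 → L), v ≠ 0 → r.mulVec v = x • v → G x ≠ x := fun x v hv hx he => by
    have h1 : Polynomial.aeval r g = r :=
      eq_of_mulVec_eq hdiv (aeval_mem_twistedAlgebra hr g) hr hv
        (by rw [aeval_mulVec_of_eigen hx, hx]; exact congrArg (· • v) he)
    exact hne (by rw [hry, h1])
  -- Applying y cycles through three eigenvectors of r; the cycle closes up to the factor c because
  -- y³ = c.
  set u₀ := u 0 with hu₀
  set u₁ := y.mulVec u₀ with hu₁
  set u₂ := y.mulVec u₁ with hu₂
  have hu₃ : y.mulVec u₂ = c • u₀ := by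
    rw [hu₂, hu₁, Matrix.mulVec_mulVec, Matrix.mulVec_mulVec, mul_assoc, hyc, Matrix.smul_mulVec,
      Matrix.one_mulVec]
  have hc0 : c ≠ 0 := by
    rintro rfl
    exact hynz _ (hynz _ (hynz _ (h.ne_zero 0))) (by rw [hu₃, zero_smul])
  set l₀ := ev 0 with hl₀
  set l₁ := G l₀ with hl₁
  set l₂ := G l₁ with hl₂
  have n₀ : u₀ ≠ 0 := h.ne_zero 0
  have n₁ : u₁ ≠ 0 := hynz _ n₀
  have n₂ : u₂ ≠ 0 := hynz _ n₁
  have e₀ : r.mulVec u₀ = l₀ • u₀ := h.eigen 0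
  have e₁ : r.mulVec u₁ = l₁ • u₁ := hstep _ _ e₀
  have e₂ : r.mulVec u₂ = l₂ • u₂ := hstep _ _ e₁
  have hGl₂ : G l₂ = l₀ := by
    have h1 := hstep _ _ e₂
    rw [hu₃, Matrix.mulVec_smul, e₀, smul_smul, smul_smul, mul_comm] at h1
    exact (mul_right_cancel₀ hc0 (smul_left_injective L n₀ h1)).symm
  have d₀₁ : l₁ ≠ l₀ := hG _ _ n₀ e₀
  have d₁₂ : l₂ ≠ l₁ := hG _ _ n₁ e₁
  have d₂₀ : l₀ ≠ l₂ := fun he => hG _ _ n₂ e₂ (hGl₂.trans he)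
  obtain ⟨k₁, hk₁⟩ := h.exists_ev_eq n₁ e₁
  obtain ⟨k₂, hk₂⟩ := h.exists_ev_eq n₂ e₂
  have hfix : ∀ σ : L ≃ₐ[K] L, σ l₀ = l₀ → ∀ i, σ (ev i) = ev i := fun σ hσ i => by
    have hGσ : ∀ x, σ x = x → σ (G x) = G x := fun x hx => by
      have := Polynomial.aeval_algHom_apply (σ : L →ₐ[K] L) x g
      change Polynomial.aeval (σ x) g = σ (G x) at this
      rw [hx] at this
      exact this.symm
    have s₁ : σ l₁ = l₁ := hGσ _ hσ
    have s₂ : σ l₂ = l₂ := hGσ _ s₁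
    have hi : i = 0 ∨ i = k₁ ∨ i = k₂ := by
      have a₁ : k₁ ≠ 0 := fun h0 => d₀₁ (by rw [hk₁, h0])
      have a₂ : k₂ ≠ 0 := fun h0 => d₂₀ (by rw [hk₂, h0])
      have a₃ : k₂ ≠ k₁ := fun h0 => d₁₂ (by rw [hk₂, hk₁, h0])
      omega
    rcases hi with rfl | rfl | rfl
    · exact hσ
    · rwa [← hk₁]
    · rwa [← hk₂]
  -- The other eigenvalues of r are polynomials in l₀ over K, so fixing l₀ fixes them all. By the
  -- assumption for contradiction it then fixes `ev' 0`, a cube root of c, which is thus a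
  -- polynomial in l₀.
  obtain ⟨f, hf⟩ := exists_aeval_eq_of_fixed (K := K) (x := l₀) (y := ev' 0)
    fun σ hσ => hcon σ (hfix σ hσ) 0
  have hroot : ∀ i, ev' i ^ 3 = c := fun i => by
    have h1 : (y * (y * y)).mulVec (w i) = (ev' i ^ 3) • w i := by
      rw [← Matrix.mulVec_mulVec, ← Matrix.mulVec_mulVec, h'.eigen, Matrix.mulVec_smul, h'.eigen,
        Matrix.mulVec_smul, Matrix.mulVec_smul, h'.eigen, smul_smul, smul_smul]
      congr 1
      ring
    rw [hyc, Matrix.smul_mulVec, Matrix.one_mulVec] at h1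
    exact (smul_left_injective L (h'.ne_zero i) h1).symm
  let F : L → L := fun x => Polynomial.aeval x f
  have hF0 : F l₀ = ev' 0 := hf
  set v := Polynomial.aeval r f with hv
  have hvA : v ∈ twistedAlgebra N := aeval_mem_twistedAlgebra hr f
  have hcube : ∀ x : L, ∀ z : Fin 3 → L, r.mulVec z = x • z →
      (v ^ 3).mulVec z = F x ^ 3 • z := fun x z hx => by
    have h1 := aeval_mulVec_of_eigen hx (f ^ 3)
    rwa [map_pow, map_pow] at h1
  have hcA : c • (1 : Matrix (Fin 3) (Fin 3) L) ∈ twistedAlgebra N := by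
    rw [← hyc]
    exact mul_mem hy (mul_mem hy hy)
  have hv3 : v ^ 3 = c • 1 := eq_of_mulVec_eq hdiv (pow_mem hvA 3) hcA n₀ (by
    rw [hcube _ _ e₀, hF0, hroot, Matrix.smul_mulVec, Matrix.one_mulVec])
  have hF3 : ∀ (x : L) (z : Fin 3 → L), z ≠ 0 → r.mulVec z = x • z → F x ^ 3 = c :=
    fun x z hz hx => by
      have h1 := hcube x z hx
      rw [hv3, Matrix.smul_mulVec, Matrix.one_mulVec] at h1
      exact (smul_left_injective L hz h1).symm
  have hcomp : ∀ x : L, Polynomial.aeval x (f.comp g) = F (G x) := fun x => by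
    rw [Polynomial.aeval_comp]
  -- The elements f(g(r)) and f(r) of the division algebra are equal once they agree on one
  -- eigenvector, so F ∘ G = F at one eigenvalue of r implies it at all of them.
  have hall : ∀ (x : L) (z : Fin 3 → L), z ≠ 0 → r.mulVec z = x • z → F (G x) = F x →
      ∀ (x' : L) (z' : Fin 3 → L), z' ≠ 0 → r.mulVec z' = x' • z' → F (G x') = F x' :=
    fun x z hz hx he x' z' hz' hx' => by
      have h1 : Polynomial.aeval r (f.comp g) = v :=
        eq_of_mulVec_eq hdiv (aeval_mem_twistedAlgebra hr _) hvA hz (by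
          rw [aeval_mulVec_of_eigen hx, hv, aeval_mulVec_of_eigen hx, hcomp, he])
      have h2 := aeval_mulVec_of_eigen hx' (f.comp g)
      rw [h1, hv, aeval_mulVec_of_eigen hx', hcomp] at h2
      exact (smul_left_injective L hz' h2).symm
  -- The norm of f(r). By `hall` the three cube roots of c are either all equal or pairwise
  -- distinct, and their product is c in both cases.
  have hprod : F l₀ * F l₁ * F l₂ = c := by
    have hsame : F (G l₀) = F l₀ → F (G l₁) = F l₁ → F l₀ * F l₁ * F l₂ = c := fun h1 h2 => by
      have h1' : F l₁ = F l₀ := h1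
      have h2' : F l₂ = F l₁ := h2
      rw [h2', h1', ← hF3 _ _ n₀ e₀]
      ring
    by_cases c₁ : F l₁ = F l₀
    · exact hsame c₁ (hall _ _ n₀ e₀ c₁ _ _ n₁ e₁)
    by_cases c₂ : F l₂ = F l₁
    · exact hsame (hall _ _ n₁ e₁ c₂ _ _ n₀ e₀) c₂
    by_cases c₃ : F (G l₂) = F l₂
    · exact hsame (hall _ _ n₂ e₂ c₃ _ _ n₀ e₀) (hall _ _ n₂ e₂ c₃ _ _ n₁ e₁)
    rw [hGl₂] at c₃
    exact mul_mul_eq_of_pairwise_ne (hF3 _ _ n₀ e₀) (hF3 _ _ n₁ e₁) (hF3 _ _ n₂ e₂) (Ne.symm c₁)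
      (Ne.symm c₂) c₃
  -- The coefficients solve y e = f(r) e in the basis u₀, u₁, u₂; the equation at u₀ is the norm
  -- condition `hprod`.
  let e : Fin 3 → L := (F l₁ * F l₂) • u₀ + F l₂ • u₁ + u₂
  have he0 : e ≠ 0 := by
    intro he
    have hli := Module.End.eigenvectors_linearIndependent' r.mulVecLin ![l₀, l₁, l₂]
      (by
        intro i j hij
        fin_cases i <;> fin_cases j <;>
          first
          | rfl
          | exact absurd hij d₀₁
          | exact absurd hij d₀₁.symm
          | exact absurd hij d₁₂
          | exact absurd hij d₁₂.symm
          | exact absurd hij d₂₀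
          | exact absurd hij d₂₀.symm) ![u₀, u₁, u₂] (by
        intro i
        rw [Module.End.hasEigenvector_iff, Module.End.mem_eigenspace_iff]
        fin_cases i
        · exact ⟨e₀, n₀⟩
        · exact ⟨e₁, n₁⟩
        · exact ⟨e₂, n₂⟩)
    have h1 := Fintype.linearIndependent_iff.1 hli ![F l₁ * F l₂, F l₂, 1] (by
      simp only [Fin.sum_univ_three]
      simpa [e] using he) 2
    simp at h1
  have hve : ∀ x z, r.mulVec z = x • z → v.mulVec z = F x • z := fun x z hx =>
    aeval_mulVec_of_eigen hx f
  have hyv : y = v := by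
    refine eq_of_mulVec_eq hdiv hy hvA he0 ?_
    simp only [e, Matrix.mulVec_add, Matrix.mulVec_smul]
    rw [← hu₁, ← hu₂, hu₃, hve _ _ e₀, hve _ _ e₁, hve _ _ e₂, smul_smul, smul_smul, ← hprod,
      mul_comm (F l₂) (F l₁), mul_comm (F l₁ * F l₂) (F l₀), mul_assoc]
    abel
  refine hne ?_
  have hcomm : Commute r v := by
    have := (Commute.all Polynomial.X f).map (Polynomial.aeval (R := K) r)
    rwa [Polynomial.aeval_X] at this
  rw [hyv]
  exact hcomm

end IsEigenframe

end Twisted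

end SeveriBrauer

namespace SeveriBrauer

/-! ### Wedderburn's element with scalar cube -/

namespace IsProjectiveCocycle

section

variable {K L : Type*} [Field K] [Field L] [Algebra K L] [IsGalois K L]
  {N : (L ≃ₐ[K] L) → Matrix (Fin 3) (Fin 3) L}

/-- A matrix commuting with the twisted algebra commutes with its span, which is the full matrix
algebra, and is therefore scalar. -/
theorem exists_mem_not_commute (hN : IsProjectiveCocycle N) {y : Matrix (Fin 3) (Fin 3) L}
    (hy : ∀ k : L, y ≠ k • 1) : ∃ z ∈ twistedAlgebra N, z * y ≠ y * z := by
  by_contra! h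
  have h1 : ∀ M : Matrix (Fin 3) (Fin 3) L, M * y = y * M := fun M => by
    have hM : M ∈ Submodule.span L (twistedAlgebra N : Set (Matrix (Fin 3) (Fin 3) L)) := by
      rw [hN.span_twistedAlgebra]
      trivial
    induction hM using Submodule.span_induction with
    | mem x hx => exact h x hx
    | zero => simp
    | add a b _ _ ha hb => rw [add_mul, mul_add, ha, hb]
    | smul k a _ ha => rw [smul_mul_assoc, mul_smul_comm, ha]
  obtain ⟨k, hk⟩ := Matrix.mem_range_scalar_of_commute_single (M := y) fun i j _ => h1 _
  refine hy k ?_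
  rw [← hk, Matrix.scalar_apply, Matrix.smul_one_eq_diagonal]

theorem exists_mem_not_scalar (hN : IsProjectiveCocycle N) :
    ∃ x ∈ twistedAlgebra N, ∀ k : L, x ≠ k • 1 := by
  have h01 : ∀ k : L, Matrix.single (0 : Fin 3) (1 : Fin 3) (1 : L) ≠ k • 1 := fun k h => by
    have := congrFun (congrFun h 0) 1
    simp at this
  obtain ⟨z, hz, hne⟩ := hN.exists_mem_not_commute h01
  refine ⟨z, hz, fun k hk => hne ?_⟩
  rw [hk]
  simp

/-- A twisted algebra contains nonzero elements that are orthogonal, for the trace form, to three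
given elements. -/
theorem exists_trace_mul_eq_zero (hN : IsProjectiveCocycle N)
    (x : Fin 3 → Matrix (Fin 3) (Fin 3) L) (hx : ∀ i, x i ∈ twistedAlgebra N) :
    ∃ g ∈ twistedAlgebra N, g ≠ 0 ∧ ∀ i, (g * x i).trace = 0 := by
  let e := LinearEquiv.ofInjective (Algebra.linearMap K L) (algebraMap K L).injective
  let φ : Fin 3 → twistedAlgebra N →ₗ[K] K := fun i =>
    (e.symm : _ →ₗ[K] K) ∘ₗ LinearMap.codRestrict (LinearMap.range (Algebra.linearMap K L))
      ((Matrix.traceLinearMap (Fin 3) K L) ∘ₗ (LinearMap.mulRight K (x i)) ∘ₗ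
        (twistedAlgebra N).val.toLinearMap)
      (fun a => by
        obtain ⟨k, hk⟩ := exists_algebraMap_eq_of_fixed (K := K)
          (hN.trace_fixed (mul_mem a.2 (hx i)))
        exact ⟨k, hk⟩)
  have hφ : ∀ i a, φ i a = 0 → ((a : Matrix (Fin 3) (Fin 3) L) * x i).trace = 0 := fun i a h => by
    have h1 := (LinearEquiv.map_eq_zero_iff e.symm).1 h
    exact congrArg Subtype.val h1
  -- Otherwise the three trace forms embed the algebra in K³, while its L-span has dimension 9.
  by_contra! hcon
  have hinj : Function.Injective (LinearMap.pi φ) := by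
    rw [← LinearMap.ker_eq_bot, Submodule.eq_bot_iff]
    intro a ha
    by_contra ha0
    obtain ⟨i, hi⟩ := hcon a a.2 (by simpa using ha0)
    exact hi (hφ i a (congrFun ha i))
  have hfin : Module.Finite K (twistedAlgebra N) := Module.Finite.of_injective _ hinj
  have hle := LinearMap.finrank_le_finrank_of_injective hinj
  rw [Module.finrank_fin_fun] at hle
  let B := Module.finBasis K (twistedAlgebra N)
  have hspan : Submodule.span L (Set.range fun i => (B i : Matrix (Fin 3) (Fin 3) L)) = ⊤ := by
    rw [eq_top_iff, ← hN.span_twistedAlgebra, Submodule.span_le]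
    intro a ha
    have h1 := congrArg Subtype.val (B.sum_repr ⟨a, ha⟩)
    rw [SetLike.mem_coe]
    change _ = a at h1
    rw [← h1]
    simp only [AddSubmonoidClass.coe_finsetSum, SetLike.val_smul]
    refine sum_mem fun i _ => ?_
    rw [← algebraMap_smul L]
    exact Submodule.smul_mem _ _ (Submodule.subset_span ⟨i, rfl⟩)
  have h1 := finrank_range_le_card (R := L) fun i => (B i : Matrix (Fin 3) (Fin 3) L)
  rw [Set.finrank, hspan, finrank_top, Module.finrank_matrix, Module.finrank_self] at h1
  simp only [Fintype.card_fin] at h1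
  omega

variable [PerfectField K] [IsAlgClosed L]

/-- All three eigenvalues of y are cube roots of c, and in characteristic 3 cube roots are unique,
against the distinctness of the eigenvalues. -/
theorem three_ne_zero_of_cube (hN : IsProjectiveCocycle N)
    (hdiv : ∀ M ∈ twistedAlgebra N, M ≠ 0 → M.det ≠ 0) {y : Matrix (Fin 3) (Fin 3) L}
    (hy : y ∈ twistedAlgebra N) (hns : ∀ k : L, y ≠ k • 1) {c : L}
    (hyc : y * (y * y) = c • 1) : (3 : L) ≠ 0 := by
  intro h3
  obtain ⟨ev, w, h⟩ := hN.exists_isEigenframe hdiv hy hns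
  have hroot : ∀ i, ev i ^ 3 = c := fun i => by
    have h1 : (y * (y * y)).mulVec (w i) = (ev i ^ 3) • w i := by
      rw [← Matrix.mulVec_mulVec, ← Matrix.mulVec_mulVec, h.eigen, Matrix.mulVec_smul, h.eigen,
        Matrix.mulVec_smul, Matrix.mulVec_smul, h.eigen, smul_smul, smul_smul]
      congr 1
      ring
    rw [hyc, Matrix.smul_mulVec, Matrix.one_mulVec] at h1
    exact (smul_left_injective L (h.ne_zero i) h1).symm
  have h1 : (ev 0 - ev 1) ^ 3 = 0 := by
    linear_combination hroot 0 - hroot 1 + (ev 0 * ev 1 ^ 2 - ev 0 ^ 2 * ev 1) * h3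
  have h2 := h.injective (sub_eq_zero.1 (pow_eq_zero_iff (by norm_num) |>.1 h1))
  exact absurd h2 (by decide)

/-- There is an element, not a scalar, whose cube is a scalar. -/
theorem exists_cube (hN : IsProjectiveCocycle N)
    (hdiv : ∀ M ∈ twistedAlgebra N, M ≠ 0 → M.det ≠ 0) :
    ∃ y ∈ twistedAlgebra N, (∀ k : L, y ≠ k • 1) ∧ ∃ c : L, y * (y * y) = c • 1 := by
  obtain ⟨x, hx, hxs⟩ := hN.exists_mem_not_scalar
  -- By `cube_eq_det_smul_one` a cube is scalar when the traces of the element and of its adjugate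
  -- vanish. The orthogonality of g to 1, x, x² makes this attainable for g itself or for a scalar
  -- multiple of (x - t) g⁻¹, with t in K.
  obtain ⟨g, hg, hg0, hgx⟩ := hN.exists_trace_mul_eq_zero ![1, x, x * x]
    (by
      intro i
      fin_cases i
      · exact one_mem _
      · exact hx
      · exact mul_mem hx hx)
  have g1 : g.trace = 0 := by simpa using hgx 0
  have g2 : (g * x).trace = 0 := hgx 1
  have g3 : (g * (x * x)).trace = 0 := hgx 2
  have hgd := hdiv g hg hg0
  have hshift : ∀ t : L, (∀ σ : L ≃ₐ[K] L, σ t = t) →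
      x - t • 1 ∈ twistedAlgebra N ∧ (∀ k : L, x - t • 1 ≠ k • 1) ∧
      (g * (x - t • 1)).trace = 0 ∧ (g * ((x - t • 1) * (x - t • 1))).trace = 0 := fun t ht => by
    refine ⟨sub_mem hx (smul_one_mem_twistedAlgebra ht), fun k hk => hxs (k + t) ?_, ?_, ?_⟩
    · rw [add_smul, ← hk, sub_add_cancel]
    · rw [mul_sub, Matrix.trace_sub, g2, mul_smul_comm, mul_one, Matrix.trace_smul, g1]
      simp
    · have : g * ((x - t • 1) * (x - t • 1)) = g * (x * x) - (2 * t) • (g * x) + (t * t) • g := by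
        simp only [mul_sub, sub_mul, mul_smul_comm, smul_mul_assoc, mul_one, one_mul]
        module
      rw [this, Matrix.trace_add, Matrix.trace_sub, Matrix.trace_smul, Matrix.trace_smul, g1, g2,
        g3]
      simp
  -- If 3 = 0, the trace of Cayley–Hamilton makes the adjugate of m traceless too, so m³ is scalar
  -- and `three_ne_zero_of_cube` is contradicted.
  have hbad : ∀ m ∈ twistedAlgebra N, (∀ k : L, m ≠ k • 1) → m.trace = 0 →
      (m * m).trace = 0 → (3 : L) ≠ 0 := fun m hm hms m1 m2 h3 => by
    have e1 := congrArg Matrix.trace (adjugate_eq_sq_sub m)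
    rw [Matrix.trace_add, Matrix.trace_sub, Matrix.trace_smul, Matrix.trace_smul, m1, m2,
      Matrix.trace_one, Fintype.card_fin] at e1
    have e2 : m.adjugate.trace = 0 := by
      simp only [smul_eq_mul, mul_zero, sub_zero, zero_add, Nat.cast_ofNat, h3] at e1
      exact e1
    exact hN.three_ne_zero_of_cube hdiv hm hms (cube_eq_det_smul_one m1 e2) h3
  by_cases hadj : g.adjugate.trace = 0
  -- If g were scalar, its zero trace would give 3 = 0, and the orthogonality to x and x² would make
  -- x an element excluded by `hbad`.
  · refine ⟨g, hg, fun k hk => ?_, _, cube_eq_det_smul_one g1 hadj⟩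
    have hk0 : k ≠ 0 := by
      rintro rfl
      exact hg0 (by rw [hk, zero_smul])
    rw [hk] at g1 g2 g3
    simp only [Matrix.trace_smul, Matrix.trace_one, smul_mul_assoc, one_mul, smul_eq_mul,
      mul_eq_zero, hk0, false_or, Fintype.card_fin, Nat.cast_ofNat] at g1 g2 g3
    exact hbad x hx hxs g2 g3 g1
  -- The unique shift for which (x - t) adj(g) has trace zero; it is Galois-fixed because both
  -- traces are.
  · set t := (x * g.adjugate).trace / g.adjugate.trace with ht
    have hgA := hN.adjugate_mem hg
    have htf : ∀ σ : L ≃ₐ[K] L, σ t = t := fun σ => by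
      rw [ht, map_div₀, hN.trace_fixed hgA, hN.trace_fixed (mul_mem hx hgA)]
    obtain ⟨hm, hms, m1, m2⟩ := hshift t htf
    set m := x - t • 1 with hmdef
    have hmd : m.det ≠ 0 := hdiv m hm fun h => hms 0 (by rw [h, zero_smul])
    have t1 : (m * g.adjugate).trace = 0 := by
      rw [hmdef, sub_mul, Matrix.trace_sub, smul_mul_assoc, one_mul, Matrix.trace_smul, smul_eq_mul,
        ht, div_mul_cancel₀ _ hadj, sub_self]
    -- This adjugate is det(g) · g · adj(m), and adj(m) is a combination of 1, m, m², all orthogonal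
    -- to g.
    have t2 : (m * g.adjugate).adjugate.trace = 0 := by
      rw [Matrix.adjugate_mul_distrib, Matrix.adjugate_adjugate _ (by simp), smul_mul_assoc,
        Matrix.trace_smul, adjugate_eq_sq_sub m, mul_add, mul_sub, Matrix.trace_add,
        Matrix.trace_sub, m2, mul_smul_comm, Matrix.trace_smul, m1, mul_smul_comm, mul_one,
        Matrix.trace_smul, g1]
      simp
    refine ⟨m * g.adjugate, mul_mem hm hgA, fun k hk => ?_, _, cube_eq_det_smul_one t1 t2⟩
    -- If m adj(g) were scalar, m would be proportional to g and inherit its orthogonality, so m, m²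
    -- and m³ would be traceless. Taking the trace of m adj(m) = det(m) then gives 3 = 0, which
    -- `hbad` forbids.
    have hgm : g.det • m = k • g := by
      have := congrArg (· * g) hk
      simpa only [mul_assoc, Matrix.adjugate_mul, mul_smul_comm, mul_one, smul_mul_assoc, one_mul]
        using this
    have hk0 : k ≠ 0 := by
      rintro rfl
      rw [zero_smul] at hgm
      exact hmd (by
        rw [(smul_eq_zero.1 hgm).resolve_left hgd]
        simp)
    have hsub : ∀ b : Matrix (Fin 3) (Fin 3) L, (g * b).trace = 0 → (m * b).trace = 0 :=
      fun b hb => by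
        have h1 : g.det * (m * b).trace = 0 := by
          rw [← smul_eq_mul, ← Matrix.trace_smul, ← smul_mul_assoc, hgm, smul_mul_assoc,
            Matrix.trace_smul, hb, smul_zero]
        exact (mul_eq_zero.1 h1).resolve_left hgd
    have n0 : m.trace = 0 := by simpa using hsub 1 (by simpa using g1)
    have n1 : (m * m).trace = 0 := hsub m m1
    have n2 : (m * (m * m)).trace = 0 := hsub _ m2
    have n3 := congrArg Matrix.trace m.mul_adjugate
    rw [adjugate_eq_sq_sub m, mul_add, mul_sub, Matrix.trace_add, Matrix.trace_sub, n2,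
      mul_smul_comm, Matrix.trace_smul, n1, mul_smul_comm, mul_one, Matrix.trace_smul, n0,
      Matrix.trace_smul, Matrix.trace_one] at n3
    simp only [smul_eq_mul, mul_zero, sub_zero, add_zero, Fintype.card_fin, Nat.cast_ofNat] at n3
    exact hbad m hm hms n0 n1 ((mul_eq_zero.1 n3.symm).resolve_left hmd)

end

end IsProjectiveCocycle

end SeveriBrauer

namespace SeveriBrauer

/-! ### Two elements with different splitting fields -/

namespace IsProjectiveCocycle

section

variable {K L : Type*} [Field K] [Field L] [Algebra K L] [IsGalois K L]
  {N : (L ≃ₐ[K] L) → Matrix (Fin 3) (Fin 3) L}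

/-- The inverse of an invertible element is a polynomial in that element. -/
theorem exists_aeval_eq_inv (hN : IsProjectiveCocycle N) {w : Matrix (Fin 3) (Fin 3) L}
    (hw : w ∈ twistedAlgebra N) : ∃ f : Polynomial K, Polynomial.aeval w f = w⁻¹ := by
  obtain ⟨t, ht⟩ := exists_algebraMap_eq_of_fixed (hN.trace_fixed hw)
  obtain ⟨s, hs⟩ := exists_algebraMap_eq_of_fixed (hN.trace_fixed (hN.adjugate_mem hw))
  obtain ⟨d, hd⟩ := exists_algebraMap_eq_of_fixed (hN.det_fixed hw)
  -- Cayley–Hamilton for w. A singular w needs no separate treatment, since the inverses of w and of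
  -- d are then both zero by convention.
  refine ⟨Polynomial.C d⁻¹ * (Polynomial.X * Polynomial.X - Polynomial.C t * Polynomial.X +
    Polynomial.C s), ?_⟩
  have halg : ∀ k : K, algebraMap K (Matrix (Fin 3) (Fin 3) L) k = algebraMap K L k • 1 :=
    fun k => by rw [Algebra.algebraMap_eq_smul_one, algebraMap_smul]
  simp only [map_mul, map_add, map_sub, Polynomial.aeval_C, Polynomial.aeval_X, halg]
  rw [Matrix.inv_def, Ring.inverse_eq_inv', adjugate_eq_sq_sub w, ht, hs, map_inv₀, hd,
    smul_mul_assoc, one_mul, smul_mul_assoc, one_mul]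

variable [PerfectField K] [IsAlgClosed L]

/-- A twisted division algebra contains two elements with different splitting fields. -/
theorem exists_isEigenframe_pair (hN : IsProjectiveCocycle N)
    (hdiv : ∀ M ∈ twistedAlgebra N, M ≠ 0 → M.det ≠ 0) :
    ∃ a ∈ twistedAlgebra N, ∃ b ∈ twistedAlgebra N, ∃ ev u ev' w,
      IsEigenframe K a ev u ∧ IsEigenframe K b ev' w ∧
      ∃ σ : L ≃ₐ[K] L, (∀ i, σ (ev i) = ev i) ∧ ∃ i, σ (ev' i) ≠ ev' i := by
  suffices h : ∃ r ∈ twistedAlgebra N, ∃ y ∈ twistedAlgebra N, ∃ (c : L) (g : Polynomial K),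
      y * (y * y) = c • 1 ∧ r * y = y * Polynomial.aeval r g ∧ r * y ≠ y * r by
    obtain ⟨r, hr, y, hy, c, g, hyc, hry, hne⟩ := h
    obtain ⟨ev, u, h1⟩ := hN.exists_isEigenframe hdiv hr fun k hk => hne (by rw [hk]; simp)
    obtain ⟨ev', w, h2⟩ := hN.exists_isEigenframe hdiv hy fun k hk => hne (by rw [hk]; simp)
    exact ⟨r, hr, y, hy, ev, u, ev', w, h1, h2, h1.exists_fix_and_ne hdiv hr hy hyc hry hne h2⟩
  obtain ⟨y, hy, hys, c, hyc⟩ := hN.exists_cube hdiv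
  have h3 := hN.three_ne_zero_of_cube hdiv hy hys hyc
  obtain ⟨z, hz, hzy⟩ := hN.exists_mem_not_commute hys
  set u := z * y - y * z with hu
  have huA : u ∈ twistedAlgebra N := sub_mem (mul_mem hz hy) (mul_mem hy hz)
  have hu0 : u ≠ 0 := sub_ne_zero.2 hzy
  have hyd := hdiv y hy fun h => hys 0 (by rw [h, zero_smul])
  have hud := hdiv u huA hu0
  -- The left side is the commutator of z with y³, by the Leibniz rule, and y³ is scalar.
  have hrel : u * (y * y) + y * u * y + y * y * u = 0 := by
    have : u * (y * y) + y * u * y + y * y * u = z * (y * (y * y)) - (y * (y * y)) * z := by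
      rw [hu]
      noncomm_ring
    rw [this, hyc]
    simp
  set w := u * y * u⁻¹ * y⁻¹ with hw
  have hwA : w ∈ twistedAlgebra N :=
    mul_mem (mul_mem (mul_mem huA hy) (hN.inv_mem huA)) (hN.inv_mem hy)
  have hwinv : w⁻¹ = y * (u * (y⁻¹ * u⁻¹)) := by
    apply Matrix.inv_eq_right_inv
    rw [hw]
    simp only [mul_assoc]
    rw [Matrix.nonsing_inv_mul_cancel_left _ _ hyd.isUnit,
      Matrix.nonsing_inv_mul_cancel_left _ _ hud.isUnit,
      Matrix.mul_nonsing_inv_cancel_left _ _ hyd.isUnit, Matrix.mul_nonsing_inv _ hud.isUnit]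
  have hwy : w * y = y * (-1 - w⁻¹) := by
    have h1 : w * y = u * y * u⁻¹ := by
      rw [hw, Matrix.nonsing_inv_mul_cancel_right _ _ hyd.isUnit]
    have h2 : u * y * u⁻¹ * (u * y) = y * (-1 - w⁻¹) * (u * y) := by
      rw [← mul_assoc, Matrix.nonsing_inv_mul_cancel_right _ _ hud.isUnit, hwinv]
      have h3 : y * (u * (y⁻¹ * u⁻¹)) * (u * y) = y * u := by
        simp only [mul_assoc]
        rw [Matrix.nonsing_inv_mul_cancel_left _ _ hud.isUnit, Matrix.nonsing_inv_mul _ hyd.isUnit,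
          mul_one]
      have h4 : y * (-1 - y * (u * (y⁻¹ * u⁻¹))) * (u * y) =
          -(y * u * y) - y * (y * (u * (y⁻¹ * u⁻¹)) * (u * y)) := by noncomm_ring
      rw [h4, h3, ← sub_eq_zero, ← hrel]
      noncomm_ring
    have h5 : IsUnit (u * y).det := by
      rw [Matrix.det_mul]
      exact (mul_ne_zero hud hyd).isUnit
    have h6 := congrArg (· * (u * y)⁻¹) h2
    simp only [Matrix.mul_nonsing_inv_cancel_right _ _ h5] at h6
    rw [h1, h6]
  -- If w is a scalar k, then k is a primitive cube root of unity and u y = k y u. Here y plays the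
  -- role of r, and u is the element with scalar cube.
  by_cases hws : ∃ k : L, w = k • 1
  · obtain ⟨k, hk⟩ := hws
    have huy : u * y = k • (y * u) := by
      have h1 : w * (y * u) = u * y := by
        rw [hw]
        simp only [mul_assoc]
        rw [Matrix.nonsing_inv_mul_cancel_left _ _ hyd.isUnit, Matrix.nonsing_inv_mul _ hud.isUnit,
          mul_one]
      rw [← h1, hk, smul_mul_assoc, one_mul]
    have hk0 : k ≠ 0 := by
      rintro rfl
      rw [zero_smul] at huy
      have := congrArg Matrix.det huy
      rw [Matrix.det_mul] at this
      exact mul_ne_zero hud hyd (by simpa using this)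
    have hkk : k ^ 2 + k + 1 = 0 := by
      have h1 : (k ^ 2 + k + 1) • (y * y * u) = 0 := by
        rw [← hrel]
        have e1 : u * (y * y) = (k ^ 2) • (y * y * u) := by
          rw [← mul_assoc, huy, smul_mul_assoc, mul_assoc, huy, mul_smul_comm, smul_smul, mul_assoc,
            pow_two]
        have e2 : y * u * y = k • (y * y * u) := by
          rw [mul_assoc, huy, mul_smul_comm, mul_assoc]
        rw [e1, e2]
        module
      refine (smul_eq_zero.1 h1).resolve_right fun h => ?_
      have := congrArg Matrix.det h
      rw [Matrix.det_mul, Matrix.det_mul] at this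
      exact mul_ne_zero (mul_ne_zero hyd hyd) hud (by simpa using this)
    have hk1 : k ≠ 1 := by
      rintro rfl
      exact h3 (by linear_combination hkk)
    have hk2 : k ^ 2 ≠ 1 := fun h => h3 (by
      have e1 : k = -2 := by linear_combination hkk - h
      rw [e1] at h
      linear_combination h)
    have hkf : ∀ σ : L ≃ₐ[K] L, σ k = k := hN.scalar_fixed (N := N) (by rw [← hk]; exact hwA)
    obtain ⟨k', hk'⟩ := exists_algebraMap_eq_of_fixed hkf
    have hyu : y * u = k⁻¹ • (u * y) := by rw [huy, smul_smul, inv_mul_cancel₀ hk0, one_smul]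
    have tr1 : u.trace = 0 :=
      trace_eq_zero_of_mul_eq_smul hyd (fun h => hk1 (inv_eq_one.1 h)) hyu
    have tr2 : u.adjugate.trace = 0 := by
      refine trace_eq_zero_of_mul_eq_smul (Y := y.adjugate) (k := k ^ 2) ?_ hk2 ?_
      · rw [Matrix.det_adjugate]
        exact pow_ne_zero _ hyd
      · have := congrArg Matrix.adjugate huy
        rwa [Matrix.adjugate_mul_distrib, Matrix.adjugate_smul, Matrix.adjugate_mul_distrib,
          Fintype.card_fin] at this
    refine ⟨y, hy, u, huA, u.det, Polynomial.C k'⁻¹ * Polynomial.X, cube_eq_det_smul_one tr1 tr2,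
      ?_, fun h => ?_⟩
    · have halg : algebraMap K (Matrix (Fin 3) (Fin 3) L) k'⁻¹ = k⁻¹ • 1 := by
        rw [Algebra.algebraMap_eq_smul_one, ← algebraMap_smul L, map_inv₀, hk']
      rw [map_mul, Polynomial.aeval_C, Polynomial.aeval_X, halg, smul_mul_assoc, one_mul,
        mul_smul_comm, hyu]
    · rw [huy] at h
      have h1 : (k - 1) • (y * u) = 0 := by rw [sub_smul, one_smul, ← h, sub_self]
      have := congrArg Matrix.det ((smul_eq_zero.1 h1).resolve_left (sub_ne_zero.2 hk1))
      rw [Matrix.det_mul] at this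
      exact mul_ne_zero hyd hud (by simpa using this)
  · push Not at hws
    obtain ⟨f, hf⟩ := hN.exists_aeval_eq_inv hwA
    -- Otherwise w plays the role of r. Should it commute with y, it would satisfy w² + w + 1 = 0, a
    -- quadratic equation with room for only two of its three distinct eigenvalues.
    refine ⟨w, hwA, y, hy, c, -1 - f, hyc, ?_, fun h => ?_⟩
    · rw [map_sub, map_neg, map_one, hf, hwy]
    · have hwd := hdiv w hwA fun h => hws 0 (by rw [h, zero_smul])
      have h1 : w = -1 - w⁻¹ := by
        rw [hwy] at h
        have := congrArg (y⁻¹ * ·) h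
        simpa only [Matrix.nonsing_inv_mul_cancel_left _ _ hyd.isUnit] using this.symm
      have h2 : w * w + w + 1 = 0 := by
        have : w * w = w * (-1 - w⁻¹) := congrArg (w * ·) h1
        rw [mul_sub, Matrix.mul_nonsing_inv _ hwd.isUnit] at this
        rw [this]
        noncomm_ring
      obtain ⟨ev, v, hfr⟩ := hN.exists_isEigenframe hdiv hwA hws
      have hroot : ∀ i, ev i ^ 2 + ev i + 1 = 0 := fun i => by
        have h3 : (w * w + w + 1).mulVec (v i) = (ev i ^ 2 + ev i + 1) • v i := by
          rw [Matrix.add_mulVec, Matrix.add_mulVec, ← Matrix.mulVec_mulVec, hfr.eigen,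
            Matrix.mulVec_smul, hfr.eigen, Matrix.one_mulVec]
          module
        rw [h2, Matrix.zero_mulVec] at h3
        exact (smul_eq_zero.1 h3.symm).resolve_right (hfr.ne_zero i)
      have d : ∀ i j, i ≠ j → ev i + ev j + 1 = 0 := fun i j hij => by
        have : (ev i - ev j) * (ev i + ev j + 1) = 0 := by
          linear_combination hroot i - hroot j
        exact (mul_eq_zero.1 this).resolve_left (sub_ne_zero.2 (hfr.injective.ne hij))
      have : ev 1 = ev 2 := by linear_combination d 0 1 (by decide) - d 0 2 (by decide)
      exact absurd (hfr.injective this) (by decide)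

end

end IsProjectiveCocycle

end SeveriBrauer

namespace SeveriBrauer

/-! ### Factors of homogeneous polynomials -/

section Homogeneous

open Polynomial in
/-- A factor of a nonzero homogeneous polynomial is homogeneous. -/
theorem exists_isHomogeneous_of_mul {ι R : Type*} [CommRing R] [IsDomain R] {a b : MvPolynomial ι R}
    {n : ℕ} (h : (a * b).IsHomogeneous n) (hab : a * b ≠ 0) : ∃ k, b.IsHomogeneous k := by
  classical
  -- Substituting Xᵢ ↦ Xᵢ T makes the homogeneous components the coefficients in T. Top and bottom
  -- degree in T are additive on products, so if they agree for the product they agree for each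
  -- factor.
  let φ : MvPolynomial ι R →ₐ[R] (MvPolynomial ι R)[X] :=
    MvPolynomial.aeval fun i => C (MvPolynomial.X i) * X
  have hmon : ∀ (d : ι →₀ ℕ) (r : R), φ (MvPolynomial.monomial d r) =
      C (MvPolynomial.monomial d r) * X ^ d.degree := fun d r => by
    simp only [φ]
    rw [MvPolynomial.aeval_monomial, MvPolynomial.monomial_eq, Finsupp.prod, Finsupp.prod,
      map_mul, map_prod]
    simp only [mul_pow, map_pow]
    rw [Finset.prod_mul_distrib, Finset.prod_pow_eq_pow_sum, mul_assoc]
    rfl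
  have hcoeff : ∀ (p : MvPolynomial ι R) (k : ℕ) (d : ι →₀ ℕ),
      MvPolynomial.coeff d ((φ p).coeff k) = if d.degree = k then MvPolynomial.coeff d p else 0 := by
    intro p k d
    induction p using MvPolynomial.induction_on' with
    | monomial e r =>
      rw [hmon, coeff_C_mul_X_pow]
      by_cases h1 : k = e.degree
      · subst h1
        rw [if_pos rfl, MvPolynomial.coeff_monomial]
        by_cases h2 : e = d
        · subst h2; simp
        · simp [h2]
      · rw [if_neg h1, MvPolynomial.coeff_zero, MvPolynomial.coeff_monomial]
        split_ifs with h2 h3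
        · subst h3
          exact absurd h2.symm h1
        · rfl
        · rfl
    | add p q hp hq =>
      rw [map_add, coeff_add, MvPolynomial.coeff_add, hp, hq, MvPolynomial.coeff_add]
      split_ifs <;> simp
  have hinj : ∀ p, φ p = 0 → p = 0 := fun p hp => by
    ext d
    have := hcoeff p d.degree d
    rw [hp] at this
    simpa using this.symm
  have ha : a ≠ 0 := left_ne_zero_of_mul hab
  have hb : b ≠ 0 := right_ne_zero_of_mul hab
  have hφa : φ a ≠ 0 := fun h0 => ha (hinj a h0)
  have hφb : φ b ≠ 0 := fun h0 => hb (hinj b h0)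
  have hφab : φ (a * b) = C (a * b) * X ^ n := by
    ext k d
    rw [hcoeff, coeff_C_mul_X_pow]
    by_cases h1 : d.degree = k
    · subst h1
      by_cases h2 : d.degree = n
      · rw [if_pos rfl, if_pos h2]
      · rw [if_pos rfl, if_neg h2, h.coeff_eq_zero h2, MvPolynomial.coeff_zero]
    · rw [if_neg h1]
      split_ifs with h2
      · rw [h.coeff_eq_zero]
        rwa [← h2]
      · simp
  have e1 : (φ a * φ b).natDegree = n := by
    rw [← map_mul, hφab, natDegree_C_mul_X_pow _ _ hab]
  have e2 : (φ a * φ b).natTrailingDegree = n := by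
    rw [← map_mul, hφab, C_mul_X_pow_eq_monomial, natTrailingDegree_monomial hab]
  rw [natDegree_mul hφa hφb] at e1
  rw [natTrailingDegree_mul hφa hφb] at e2
  have l1 := natTrailingDegree_le_natDegree (φ a)
  have l2 := natTrailingDegree_le_natDegree (φ b)
  refine ⟨(φ b).natDegree, fun d hd => ?_⟩
  rw [← MvPolynomial.mem_support_iff] at hd
  have h1 := hcoeff b d.degree d
  rw [if_pos rfl] at h1
  have h2 : (φ b).coeff d.degree ≠ 0 := fun h0 => by
    rw [h0, MvPolynomial.coeff_zero] at h1
    exact (MvPolynomial.mem_support_iff.1 hd) h1.symm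
  have l3 := le_natDegree_of_ne_zero h2
  have l4 := natTrailingDegree_le_of_ne_zero h2
  have : d.degree = (φ b).natDegree := by omega
  rw [← this, Finsupp.degree_eq_weight_one]
  rfl

end Homogeneous

/-! ### Proportional triples -/

section Proportional

/-- Two triples are proportional. -/
def Proportional {R : Type*} [CommRing R] (a b : Fin 3 → R) : Prop :=
  ∀ i j, a i * b j = a j * b i

theorem Proportional.symm {R : Type*} [CommRing R] {a b : Fin 3 → R} (h : Proportional a b) :
    Proportional b a := fun i j => by
  rw [mul_comm, h j i, mul_comm]

theorem Proportional.exists_smul {L : Type*} [Field L] {a b : Fin 3 → L} (h : Proportional a b)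
    (hb : b ≠ 0) : ∃ c : L, a = c • b := by
  obtain ⟨j, hj⟩ := Function.ne_iff.1 hb
  refine ⟨a j / b j, funext fun i => ?_⟩
  rw [Pi.smul_apply, smul_eq_mul, div_mul_eq_mul_div, eq_div_iff hj, h i j]

theorem proportional_smul {R : Type*} [CommRing R] (c : R) (b : Fin 3 → R) :
    Proportional (c • b) b := fun i j => by
  simp only [Pi.smul_apply, smul_eq_mul]
  ring

/-- Proportionality is transitive at nonzero triples. -/
theorem Proportional.trans {R : Type*} [CommRing R] [IsDomain R] {a b c : Fin 3 → R}
    (h : Proportional a b) (h' : Proportional b c) (hb : b ≠ 0) : Proportional a c := fun i j => by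
  obtain ⟨k, hk⟩ := Function.ne_iff.1 hb
  refine mul_right_cancel₀ hk ?_
  have e1 := h i k
  have e2 := h j k
  have e3 := h' j k
  have e4 := h' i k
  have e5 := h' i j
  simp only [Pi.zero_apply] at hk
  calc a i * c j * b k = (a i * b k) * c j := by ring
    _ = a k * (b i * c j) := by rw [e1]; ring
    _ = a k * (b j * c i) := by rw [e5]
    _ = (a k * b j) * c i := by ring
    _ = (a j * b k) * c i := by rw [e2]
    _ = a j * c i * b k := by ring

/-- Every nonzero triple in a factorial domain is a multiple of a triple of which all
proportional triples are multiples. -/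
theorem exists_primitive {R : Type*} [CommRing R] [IsDomain R] [UniqueFactorizationMonoid R]
    (A : Fin 3 → R) (hA : A ≠ 0) : ∃ (g : R) (F : Fin 3 → R), A = g • F ∧
      ∀ B, Proportional B F → ∃ c : R, B = c • F := by
  classical
  obtain ⟨inst⟩ : Nonempty (NormalizedGCDMonoid R) := inferInstance
  obtain ⟨F, hF, hF1⟩ := Finset.extract_gcd (s := Finset.univ) A ⟨0, Finset.mem_univ _⟩
  refine ⟨_, F, funext fun i => hF i (Finset.mem_univ i), fun B hB => ?_⟩
  have hdvd : ∀ j, F j ∣ B j := fun j => by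
    have h1 : F j ∣ Finset.univ.gcd fun l => F l * B j := Finset.dvd_gcd fun l _ => by
      rw [mul_comm, ← hB l j]
      exact dvd_mul_left _ _
    have h2 := Finset.gcd_mul_right' Finset.univ F (B j)
    rw [hF1, one_mul] at h2
    exact h1.trans h2.dvd
  have hF0 : ∃ j, F j ≠ 0 := by
    by_contra! h
    refine hA (funext fun i => ?_)
    rw [hF i (Finset.mem_univ i), h, mul_zero]
    rfl
  obtain ⟨j, hj⟩ := hF0
  obtain ⟨c, hc⟩ := hdvd j
  refine ⟨c, funext fun i => mul_right_cancel₀ hj ?_⟩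
  rw [hB i j, hc, Pi.smul_apply, smul_eq_mul]
  ring

end Proportional

/-! ### Locally polynomial maps of the plane -/

section PolynomialMaps

variable {L : Type*} [Field L]

/-- The value of a triple of polynomials. -/
noncomputable def evalTriple (A : Fin 3 → MvPolynomial (Fin 3) L) (w : Fin 3 → L) : Fin 3 → L :=
  fun i => MvPolynomial.eval w (A i)

theorem eval_smul_of_isHomogeneous {p : MvPolynomial (Fin 3) L} {n : ℕ} (hp : p.IsHomogeneous n)
    (c : L) (w : Fin 3 → L) :
    MvPolynomial.eval (c • w) p = c ^ n * MvPolynomial.eval w p := by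
  rw [MvPolynomial.eval_eq, MvPolynomial.eval_eq, Finset.mul_sum]
  refine Finset.sum_congr rfl fun d hd => ?_
  have h1 : ∑ i ∈ d.support, d i = n := by
    have h2 := hp (MvPolynomial.mem_support_iff.1 hd)
    have h3 := Finsupp.degree_eq_weight_one (R := ℕ) (σ := Fin 3)
    rw [← h2]
    exact DFunLike.congr_fun h3 d
  simp only [Pi.smul_apply, smul_eq_mul, mul_pow, Finset.prod_mul_distrib]
  rw [Finset.prod_pow_eq_pow_sum, h1]
  ring

theorem evalTriple_smul (c : MvPolynomial (Fin 3) L) (A : Fin 3 → MvPolynomial (Fin 3) L)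
    (w : Fin 3 → L) : evalTriple (c • A) w = MvPolynomial.eval w c • evalTriple A w := by
  ext i
  simp [evalTriple]

/-- A map on lines that is given, locally in the Zariski topology, by homogeneous polynomials of
the same degree, up to a field automorphism `σ`. -/
def IsLocallyPolynomial (σ : L ≃+* L) (Ψ : (Fin 3 → L) → Fin 3 → L) : Prop :=
  ∀ v, v ≠ 0 → ∃ (h : MvPolynomial (Fin 3) L) (m : ℕ) (A : Fin 3 → MvPolynomial (Fin 3) L),
    (∀ j, (A j).IsHomogeneous m) ∧ MvPolynomial.eval v h ≠ 0 ∧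
    ∀ w, w ≠ 0 → MvPolynomial.eval w h ≠ 0 → evalTriple A w ≠ 0 ∧
      Proportional (Ψ w) (σ ∘ evalTriple A w)

theorem comp_ne_zero (σ : L ≃+* L) {a : Fin 3 → L} (ha : a ≠ 0) : σ ∘ a ≠ 0 := fun h =>
  ha (funext fun i => by simpa using congrFun h i)

theorem Proportional.comp (σ : L ≃+* L) {a b : Fin 3 → L} (h : Proportional a b) :
    Proportional (σ ∘ a) (σ ∘ b) := fun i j => by
  simp only [Function.comp_apply, ← map_mul, h i j]

/-- Polynomial rings are factorial, so one local presentation can be divided by its gcd. Every other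
local presentation is a polynomial multiple of the resulting triple, which therefore cannot vanish
where the other one is valid. -/
theorem IsLocallyPolynomial.exists_global [Infinite L] {σ : L ≃+* L} {Ψ : (Fin 3 → L) → Fin 3 → L}
    (h : IsLocallyPolynomial σ Ψ) (hΨ : ∀ w, w ≠ 0 → Ψ w ≠ 0) :
    ∃ (d : ℕ) (F : Fin 3 → MvPolynomial (Fin 3) L), (∀ j, (F j).IsHomogeneous d) ∧
      ∀ w, w ≠ 0 → evalTriple F w ≠ 0 ∧ Proportional (Ψ w) (σ ∘ evalTriple F w) := by
  have h1 : (fun _ => 1 : Fin 3 → L) ≠ 0 := fun h => one_ne_zero (congrFun h 0)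
  obtain ⟨h₀, m, A₀, hA₀, hh₀, hw₀⟩ := h _ h1
  have hA₀0 : A₀ ≠ 0 := fun h0 => (hw₀ _ h1 hh₀).1 (by rw [h0]; ext; simp [evalTriple])
  obtain ⟨g, F, hgF, hF⟩ := exists_primitive A₀ hA₀0
  have hg : g ≠ 0 := by
    rintro rfl
    exact hA₀0 (by rw [hgF, zero_smul])
  have hh₀0 : h₀ ≠ 0 := by
    rintro rfl
    simp at hh₀
  have hF0 : F ≠ 0 := by
    rintro rfl
    exact hA₀0 (by rw [hgF, smul_zero])
  have hdeg : ∃ d, ∀ j, (F j).IsHomogeneous d := by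
    have hj : ∀ j, F j ≠ 0 → ∃ d, (F j).IsHomogeneous d := fun j hj => by
      refine exists_isHomogeneous_of_mul (a := g) (n := m) ?_ (mul_ne_zero hg hj)
      have := hA₀ j
      rwa [hgF] at this
    obtain ⟨j₀, hj₀⟩ := Function.ne_iff.1 hF0
    obtain ⟨d, hd⟩ := hj j₀ hj₀
    refine ⟨d, fun j => ?_⟩
    by_cases hj0 : F j = 0
    · rw [hj0]
      exact MvPolynomial.isHomogeneous_zero _ _ _
    · obtain ⟨d', hd'⟩ := hj j hj0
      obtain ⟨e, he⟩ : ∃ e, g.IsHomogeneous e := by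
        refine exists_isHomogeneous_of_mul (a := F j) (n := m) ?_ (mul_ne_zero hj0 hg)
        have := hA₀ j
        rw [hgF] at this
        rwa [mul_comm]
      have a1 := (he.mul hd').inj_right (n := m) (by
        have := hA₀ j
        rwa [hgF] at this) (mul_ne_zero hg hj0)
      have a2 := (he.mul hd).inj_right (n := m) (by
        have := hA₀ j₀
        rwa [hgF] at this) (mul_ne_zero hg hj₀)
      have : d' = d := by omega
      rwa [← this]
  obtain ⟨d, hd⟩ := hdeg
  refine ⟨d, F, hd, fun v hv => ?_⟩
  obtain ⟨k, n, A, hA, hk, hw⟩ := h v hv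
  have hk0 : k ≠ 0 := by
    rintro rfl
    simp at hk
  have hpar : Proportional A A₀ := fun i j => by
    -- The extra factor vanishes wherever one of the presentations is not valid and at the origin,
    -- so the identity can be tested at all points.
    have h0 : (A i * A₀ j - A j * A₀ i) * (k * h₀ * MvPolynomial.X 0) = 0 := by
      refine MvPolynomial.funext fun w => ?_
      rw [map_zero, map_mul]
      by_cases hz : MvPolynomial.eval w (k * h₀ * MvPolynomial.X 0) = 0
      · rw [hz, mul_zero]
      · rw [map_mul, map_mul, MvPolynomial.eval_X] at hz
        have hwz : w ≠ 0 := by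
          rintro rfl
          exact hz (mul_zero _)
        have hwk := hw w hwz (left_ne_zero_of_mul (left_ne_zero_of_mul hz))
        have hwk₀ := hw₀ w hwz (right_ne_zero_of_mul (left_ne_zero_of_mul hz))
        have h2 := hwk.2.symm.trans hwk₀.2 (hΨ w hwz)
        have h3 := h2 i j
        simp only [Function.comp_apply, ← map_mul] at h3
        have h4 := σ.injective h3
        simp only [evalTriple] at h4
        rw [map_sub, map_mul, map_mul, h4, sub_self, zero_mul]
    exact sub_eq_zero.1 ((mul_eq_zero.1 h0).resolve_right
      (mul_ne_zero (mul_ne_zero hk0 hh₀0) (MvPolynomial.X_ne_zero 0)))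
  have hA₀F : Proportional A₀ F := by
    rw [hgF]
    exact proportional_smul g F
  obtain ⟨c, hc⟩ := hF A (hpar.trans hA₀F hA₀0)
  have hv1 := hw v hv hk
  have hv2 : evalTriple F v ≠ 0 := fun h0 => hv1.1 (by rw [hc, evalTriple_smul, h0, smul_zero])
  refine ⟨hv2, hv1.2.trans ?_ (comp_ne_zero σ hv1.1)⟩
  refine Proportional.comp σ ?_
  rw [hc, evalTriple_smul]
  exact proportional_smul _ _

/-- A polynomial without zeros outside the origin is constant. -/
theorem exists_eq_C_of_eval_ne_zero [IsAlgClosed L] {c : MvPolynomial (Fin 3) L}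
    (hc : ∀ w : Fin 3 → L, w ≠ 0 → MvPolynomial.eval w c ≠ 0) :
    ∃ k : L, k ≠ 0 ∧ c = MvPolynomial.C k := by
  -- Nullstellensatz: each Xᵢ vanishes on the zero set of c. A common divisor of powers of X₀ and X₁
  -- is a unit.
  have hX : ∀ i : Fin 3, ∃ n, c ∣ MvPolynomial.X i ^ n := fun i => by
    have h1 : (MvPolynomial.X i : MvPolynomial (Fin 3) L) ∈ (Ideal.span {c}).radical := by
      rw [← MvPolynomial.vanishingIdeal_zeroLocus_eq_radical (K := L)]
      intro w hw
      have h2 : w = 0 := by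
        by_contra h
        refine hc w h ?_
        have := hw c (Ideal.mem_span_singleton_self c)
        rwa [MvPolynomial.aeval_eq_eval] at this
      rw [h2]
      simp
    obtain ⟨n, hn⟩ := Ideal.mem_radical_iff.1 h1
    exact ⟨n, Ideal.mem_span_singleton.1 hn⟩
  obtain ⟨n, hn⟩ := hX 0
  obtain ⟨m, hm⟩ := hX 1
  have h0 := MvPolynomial.X_prime (R := L) (i := (0 : Fin 3))
  obtain ⟨k, hk, hck⟩ := (dvd_prime_pow h0 n).1 hn
  have hk0 : k = 0 := by
    by_contra hk0
    have h1 : (MvPolynomial.X 0 : MvPolynomial (Fin 3) L) ∣ MvPolynomial.X 1 ^ m :=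
      ((dvd_pow_self _ hk0).trans hck.symm.dvd).trans hm
    have h2 := MvPolynomial.X_dvd_X.1 (h0.dvd_of_dvd_pow h1)
    exact absurd h2 (by decide)
  rw [hk0, pow_zero] at hck
  obtain ⟨r, hr, hcr⟩ := MvPolynomial.isUnit_iff_eq_C_of_isReduced.1
    (associated_one_iff_isUnit.1 hck)
  exact ⟨r, hr.ne_zero, hcr⟩

/-- A locally polynomial map with a locally polynomial inverse is linear. -/
theorem IsLocallyPolynomial.exists_matrix [IsAlgClosed L] {σ : L ≃+* L}
    {Ψ Ψ' : (Fin 3 → L) → Fin 3 → L} (h : IsLocallyPolynomial σ Ψ)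
    (h' : IsLocallyPolynomial σ.symm Ψ') (hΨ : ∀ w, w ≠ 0 → Ψ w ≠ 0)
    (hΨ' : ∀ w, w ≠ 0 → Ψ' w ≠ 0) (hinv : ∀ w, w ≠ 0 → Proportional (Ψ' (Ψ w)) w) :
    ∃ N : Matrix (Fin 3) (Fin 3) L, N.det ≠ 0 ∧
      ∀ w, w ≠ 0 → Proportional (Ψ w) (N.mulVec (σ ∘ w)) := by
  have := IsAlgClosed.instInfinite (K := L)
  obtain ⟨d, F, hFd, hF⟩ := h.exists_global hΨ
  obtain ⟨e, F', hFe, hF'⟩ := h'.exists_global hΨ'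
  -- The composite of the two maps. Moving the coefficients of F' by σ⁻¹ cancels the field
  -- automorphisms and leaves an honest polynomial map that is the identity on lines.
  let H : Fin 3 → MvPolynomial (Fin 3) L := fun j =>
    MvPolynomial.aeval F (MvPolynomial.map (σ.symm : L →+* L) (F' j))
  have hHd : ∀ j, (H j).IsHomogeneous (d * e) := fun j =>
    ((hFe j).map _).aeval F hFd
  have hHe : ∀ w, evalTriple H w = σ.symm ∘ evalTriple F' (σ ∘ evalTriple F w) := fun w => by
    ext j
    simp only [evalTriple, H, Function.comp_apply]
    have e1 : MvPolynomial.eval w (MvPolynomial.aeval F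
        (MvPolynomial.map (σ.symm : L →+* L) (F' j))) =
        MvPolynomial.eval (evalTriple F w) (MvPolynomial.map (σ.symm : L →+* L) (F' j)) := by
      rw [MvPolynomial.aeval_def, MvPolynomial.eval_eval₂, MvPolynomial.eval]
      congr 1
      ext x
      simp
    rw [e1, MvPolynomial.eval_map]
    have e2 := MvPolynomial.eval₂_comp_left (σ.symm : L →+* L) (RingHom.id L) (σ ∘ evalTriple F w)
      (F' j)
    have e3 : ((σ.symm : L →+* L) ∘ σ ∘ evalTriple F w : Fin 3 → L) = evalTriple F w := by
      ext i
      simp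
    rw [e3, RingHom.comp_id] at e2
    exact e2.symm
  have hH0 : ∀ w, w ≠ 0 → evalTriple H w ≠ 0 := fun w hw => by
    rw [hHe]
    exact comp_ne_zero _ (hF' _ (comp_ne_zero _ (hF w hw).1)).1
  have hHw : ∀ w, w ≠ 0 → Proportional (evalTriple H w) w := fun w hw => by
    have a1 := hF w hw
    have hn := comp_ne_zero σ a1.1
    obtain ⟨c, hc⟩ := a1.2.exists_smul hn
    have hc0 : c ≠ 0 := by
      rintro rfl
      exact hΨ w hw (by rw [hc, zero_smul])
    have a2 := hF' _ (hΨ w hw)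
    have a3 := hF' _ hn
    have a4 : Proportional (evalTriple F' (Ψ w)) (evalTriple F' (σ ∘ evalTriple F w)) := by
      rw [hc]
      have : evalTriple F' (c • (σ ∘ evalTriple F w)) =
          c ^ e • evalTriple F' (σ ∘ evalTriple F w) := by
        ext j
        simp only [evalTriple, Pi.smul_apply, smul_eq_mul]
        exact eval_smul_of_isHomogeneous (hFe j) _ _
      rw [this]
      exact proportional_smul _ _
    rw [hHe]
    have a5 := ((hinv w hw).symm.trans a2.2 (hΨ' _ (hΨ w hw))).trans (a4.comp σ.symm)
      (comp_ne_zero _ a2.1)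
    exact a5.symm
  have hHX : ∀ i j, H i * MvPolynomial.X j = H j * MvPolynomial.X i := fun i j => by
    have h0 : (H i * MvPolynomial.X j - H j * MvPolynomial.X i) * MvPolynomial.X 0 = 0 := by
      refine MvPolynomial.funext fun w => ?_
      by_cases hw : w = 0
      · simp [hw]
      · have := hHw w hw i j
        simp only [evalTriple] at this
        simp only [map_mul, map_sub, MvPolynomial.eval_X, map_zero]
        rw [this, sub_self, zero_mul]
    exact sub_eq_zero.1 ((mul_eq_zero.1 h0).resolve_right (MvPolynomial.X_ne_zero 0))
  have hdvd : (MvPolynomial.X 0 : MvPolynomial (Fin 3) L) ∣ H 0 := by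
    have h1 : (MvPolynomial.X 0 : MvPolynomial (Fin 3) L) ∣ H 0 * MvPolynomial.X 1 := by
      rw [hHX]
      exact dvd_mul_left _ _
    rcases MvPolynomial.X_prime.dvd_or_dvd h1 with h2 | h2
    · exact h2
    · exact absurd (MvPolynomial.X_dvd_X.1 h2) (by decide)
  obtain ⟨c, hc⟩ := hdvd
  have hHc : ∀ j, H j = c * MvPolynomial.X j := fun j => by
    refine mul_right_cancel₀ (MvPolynomial.X_ne_zero (0 : Fin 3)) ?_
    rw [hHX j 0, hc]
    ring
  obtain ⟨k, hk, hck⟩ := exists_eq_C_of_eval_ne_zero (c := c) fun w hw h0 => hH0 w hw (by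
    ext j
    simp only [evalTriple]
    rw [hHc, map_mul, h0, zero_mul]
    rfl)
  -- The composite is a nonzero constant times the identity, so its degree d · e is 1, and F is
  -- linear.
  have hde : d * e = 1 := by
    refine (hHd 0).inj_right ?_ (?_ : H 0 ≠ 0)
    · rw [hHc, hck]
      simpa using (MvPolynomial.isHomogeneous_C (Fin 3) k).mul (MvPolynomial.isHomogeneous_X L 0)
    · rw [hHc, hck]
      exact mul_ne_zero (by simpa using hk) (MvPolynomial.X_ne_zero 0)
  have hd1 : d = 1 := Nat.eq_one_of_mul_eq_one_right hde
  subst hd1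
  have hlin : ∀ j, ∃ a : Fin 3 → L, ∀ w, MvPolynomial.eval w (F j) = ∑ i, a i * w i := fun j => by
    have h1 : F j ∈ MvPolynomial.homogeneousSubmodule (Fin 3) L 1 := hFd j
    rw [MvPolynomial.homogeneousSubmodule_one_eq_span_X, Submodule.mem_span_range_iff_exists_fun]
      at h1
    obtain ⟨a, ha⟩ := h1
    refine ⟨a, fun w => ?_⟩
    rw [← ha]
    simp [MvPolynomial.smul_eval]
  choose a ha using hlin
  have hFa : ∀ w, evalTriple F w = (Matrix.of a).mulVec w := fun w => by
    ext j
    simp [evalTriple, ha, Matrix.mulVec, dotProduct]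
  have hcomp : ∀ w, (σ ∘ evalTriple F w) = ((Matrix.of a).map σ).mulVec (σ ∘ w) := fun w => by
    rw [hFa]
    ext i
    simp [Matrix.mulVec, dotProduct]
  refine ⟨(Matrix.of a).map σ, fun h0 => ?_, fun w hw => ?_⟩
  · obtain ⟨v, hv, hv'⟩ := Matrix.exists_mulVec_eq_zero_iff.2 h0
    have e1 : (σ ∘ σ.symm ∘ v) = v := by ext; simp
    have hv2 : σ.symm ∘ v ≠ 0 := comp_ne_zero _ hv
    refine comp_ne_zero σ (hF _ hv2).1 ?_
    rw [hcomp, e1, hv']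
  · rw [← hcomp]
    exact (hF w hw).2

end PolynomialMaps

end SeveriBrauer

namespace SeveriBrauer

noncomputable section

attribute [local instance] MvPolynomial.gradedAlgebra

open HomogeneousLocalization

/-- The grading of `R[X₀, …, Xₙ]` by the total degree. -/
abbrev grading (n : ℕ) (R : Type u) [CommRing R] :=
  MvPolynomial.homogeneousSubmodule (Fin (n + 1)) R

theorem eval₂_mul_of_isHomogeneous {ι R B : Type*} [CommRing R] [CommRing B] (g : R →+* B)
    {p : MvPolynomial ι R} {m : ℕ} (hp : p.IsHomogeneous m) (c : B) (w : ι → B) :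
    MvPolynomial.eval₂ g (fun j => c * w j) p = c ^ m * MvPolynomial.eval₂ g w p := by
  rw [MvPolynomial.eval₂_eq, MvPolynomial.eval₂_eq, Finset.mul_sum]
  refine Finset.sum_congr rfl fun d hd => ?_
  have h1 : ∑ i ∈ d.support, d i = m := by
    have h2 := hp (MvPolynomial.mem_support_iff.1 hd)
    rw [← h2]
    exact DFunLike.congr_fun (Finsupp.degree_eq_weight_one (R := ℕ) (σ := ι)) d
  simp only [mul_pow, Finset.prod_mul_distrib]
  rw [Finset.prod_pow_eq_pow_sum, h1]
  ring

variable {n : ℕ} {R : Type u} [CommRing R]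

/-! ### Rings of the standard charts of projective space -/

section Away

variable {B : Type*} [CommRing B] {h : MvPolynomial (Fin (n + 1)) R} {m : ℕ}

/-- The extension to degree zero fractions of a ring homomorphism that inverts the denominator. -/
def liftAway (g : MvPolynomial (Fin (n + 1)) R →+* B) (hu : IsUnit (g h)) :
    Away (grading n R) h →+* B :=
  (Localization.awayLift g h hu).comp (algebraMap (Away (grading n R) h) (Localization.Away h))

theorem liftAway_mk_mul (g : MvPolynomial (Fin (n + 1)) R →+* B) (hu : IsUnit (g h))
    (hh : h ∈ grading n R m) (k : ℕ) (x) (hx) :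
    liftAway g hu (Away.mk (grading n R) hh k x hx) * g h ^ k = g x := by
  obtain ⟨b, hb⟩ := hu.exists_right_inv
  have h1 : liftAway g hu (Away.mk (grading n R) hh k x hx) = g x * b ^ k := by
    rw [liftAway, RingHom.comp_apply, HomogeneousLocalization.algebraMap_apply, Away.val_mk]
    exact Localization.awayLift_mk g h _ _ hb k
  rw [h1, mul_assoc, ← mul_pow, mul_comm b, hb, one_pow, mul_one]

theorem away_hom_ext {f g : Away (grading n R) h →+* B} (hh : h ∈ grading n R m)
    (H : ∀ k x hx, f (Away.mk (grading n R) hh k x hx) = g (Away.mk (grading n R) hh k x hx)) :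
    f = g := by
  ext a
  obtain ⟨k, x, hx, rfl⟩ := Away.mk_surjective (grading n R) hh a
  exact H k x hx

/-- The ring homomorphism `R → R[X₀, …, Xₙ, h⁻¹]₀`. -/
def awayC (h : MvPolynomial (Fin (n + 1)) R) : R →+* Away (grading n R) h :=
  (fromZeroRingHom (grading n R) _).comp (algebraMap R (grading n R 0))

theorem val_awayC (r : R) :
    (awayC h r).val = algebraMap (MvPolynomial (Fin (n + 1)) R) (Localization.Away h) (MvPolynomial.C r) := by
  exact (Localization.mk_one_eq_algebraMap (M := Submonoid.powers h) (MvPolynomial.C r))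

theorem liftAway_awayC (g : MvPolynomial (Fin (n + 1)) R →+* B) (hu : IsUnit (g h)) (r : R) :
    liftAway g hu (awayC h r) = g (MvPolynomial.C r) := by
  rw [liftAway, RingHom.comp_apply, HomogeneousLocalization.algebraMap_apply, val_awayC]
  exact IsLocalization.Away.lift_eq h hu _

theorem X_mem_grading (i : Fin (n + 1)) : (MvPolynomial.X i : MvPolynomial _ R) ∈ grading n R 1 :=
  MvPolynomial.isHomogeneous_X R i

/-- The coordinate function `Xⱼ / Xᵢ`. -/
def coord (i j : Fin (n + 1)) : Away (grading n R) (MvPolynomial.X i : MvPolynomial _ R) :=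
  Away.mk (grading n R) (X_mem_grading i) 1 (MvPolynomial.X j)
    (by simpa using X_mem_grading j)

theorem coord_self (i : Fin (n + 1)) : coord (R := R) i i = 1 := by
  ext
  rw [coord, Away.val_mk, HomogeneousLocalization.val_one]
  rw [Localization.mk_eq_mk', IsLocalization.mk'_eq_iff_eq_mul]
  simp

/-- Substituting the coordinate functions into a polynomial. -/
def toAway (i : Fin (n + 1)) : MvPolynomial (Fin (n + 1)) R →+*
    Away (grading n R) (MvPolynomial.X i : MvPolynomial _ R) :=
  MvPolynomial.eval₂Hom (awayC _) (coord i)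

/-- A form of degree k satisfies x(X) = Xᵢᵏ · x(X / Xᵢ). -/
theorem toAway_eq_mk (i : Fin (n + 1)) (k : ℕ) (x : MvPolynomial (Fin (n + 1)) R)
    (hx : x ∈ grading n R (k • 1)) :
    toAway i x = Away.mk (grading n R) (X_mem_grading i) k x hx := by
  set A := Localization.Away (MvPolynomial.X i : MvPolynomial (Fin (n + 1)) R)
  have h1 : MvPolynomial.eval₂ ((algebraMap (MvPolynomial (Fin (n + 1)) R) A).comp MvPolynomial.C)
      (fun j => algebraMap (MvPolynomial (Fin (n + 1)) R) A (MvPolynomial.X i) * (coord i j).val) x =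
      algebraMap (MvPolynomial (Fin (n + 1)) R) A (MvPolynomial.X i) ^ k * (toAway i x).val := by
    rw [eval₂_mul_of_isHomogeneous _ (m := k) (by simpa using hx)]
    congr 1
    rw [← HomogeneousLocalization.algebraMap_apply, toAway, MvPolynomial.coe_eval₂Hom,
      MvPolynomial.hom_eval₂]
    congr 1
  have h2 : ∀ j, algebraMap (MvPolynomial (Fin (n + 1)) R) A (MvPolynomial.X i) * (coord i j).val =
      algebraMap (MvPolynomial (Fin (n + 1)) R) A (MvPolynomial.X j) := by
    intro j
    rw [coord, Away.val_mk, Localization.mk_eq_mk', mul_comm]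
    have := IsLocalization.mk'_spec (M := Submonoid.powers (MvPolynomial.X i : MvPolynomial _ R)) A
      (MvPolynomial.X j) ⟨MvPolynomial.X i ^ 1, 1, rfl⟩
    simp only [pow_one] at this ⊢
    exact this
  simp only [h2] at h1
  rw [← MvPolynomial.hom_eval₂, MvPolynomial.eval₂_eta] at h1
  ext
  rw [Away.val_mk, Localization.mk_eq_mk', eq_comm, IsLocalization.mk'_eq_iff_eq_mul, h1]
  rw [map_pow, mul_comm]

theorem toAway_surjective (i : Fin (n + 1)) : Function.Surjective (toAway (R := R) i) := by
  intro a
  obtain ⟨k, x, hx, rfl⟩ := Away.mk_surjective (grading n R) (X_mem_grading i) a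
  exact ⟨x, toAway_eq_mk i k x hx⟩

theorem toAway_C (i : Fin (n + 1)) (r : R) : toAway i (MvPolynomial.C r) = awayC _ r := by
  simp [toAway]

theorem toAway_X (i j : Fin (n + 1)) : toAway (R := R) i (MvPolynomial.X j) = coord i j := by
  simp [toAway]

theorem liftAway_coord_mul (g : MvPolynomial (Fin (n + 1)) R →+* B) {i : Fin (n + 1)}
    (hu : IsUnit (g (MvPolynomial.X i))) (j : Fin (n + 1)) :
    liftAway g hu (coord i j) * g (MvPolynomial.X i) = g (MvPolynomial.X j) := by
  have := liftAway_mk_mul g hu (X_mem_grading i) 1 (MvPolynomial.X j)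
    (by simpa using X_mem_grading j)
  rwa [pow_one] at this

theorem away_X_hom_ext {i : Fin (n + 1)}
    {f g : Away (grading n R) (MvPolynomial.X i : MvPolynomial _ R) →+* B}
    (h0 : ∀ r, f (awayC _ r) = g (awayC _ r)) (h1 : ∀ j, f (coord i j) = g (coord i j)) :
    f = g := by
  have : f.comp (toAway i) = g.comp (toAway i) := by
    ext j
    · simpa [toAway_C] using h0 _
    · simpa [toAway_X] using h1 _
  ext a
  obtain ⟨x, rfl⟩ := toAway_surjective i a
  exact DFunLike.congr_fun this x

theorem liftAway_eq_of_X {i : Fin (n + 1)}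
    (φ : Away (grading n R) (MvPolynomial.X i : MvPolynomial _ R) →+* B)
    (hu : IsUnit ((φ.comp (toAway i)) (MvPolynomial.X i))) :
    liftAway (φ.comp (toAway i)) hu = φ := by
  refine away_X_hom_ext (fun r => ?_) fun j => ?_
  · rw [liftAway_awayC, RingHom.comp_apply, toAway_C]
  · have := liftAway_coord_mul _ hu j
    simpa [toAway_X, coord_self] using this

/-- Setting `Xᵢ = 1` in a polynomial. -/
def dehomogenize (i : Fin (n + 1)) :
    MvPolynomial (Fin (n + 1)) R →+* MvPolynomial {j : Fin (n + 1) // j ≠ i} R :=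
  MvPolynomial.eval₂Hom MvPolynomial.C fun j => if hj : j = i then 1 else MvPolynomial.X ⟨j, hj⟩

theorem dehomogenize_C (i : Fin (n + 1)) (r : R) :
    dehomogenize i (MvPolynomial.C r) = MvPolynomial.C r := by
  simp [dehomogenize]

theorem dehomogenize_X_self (i : Fin (n + 1)) :
    dehomogenize (R := R) i (MvPolynomial.X i) = 1 := by
  simp [dehomogenize]

theorem dehomogenize_X (i : Fin (n + 1)) (j : {j : Fin (n + 1) // j ≠ i}) :
    dehomogenize (R := R) i (MvPolynomial.X j) = MvPolynomial.X j := by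
  simp [dehomogenize, j.2]

theorem isUnit_dehomogenize_X_self (i : Fin (n + 1)) :
    IsUnit (dehomogenize (R := R) i (MvPolynomial.X i)) := by
  simp [dehomogenize_X_self]

theorem liftAway_dehomogenize_coord (i j : Fin (n + 1)) :
    liftAway (dehomogenize (R := R) i) (isUnit_dehomogenize_X_self i) (coord i j) =
      dehomogenize i (MvPolynomial.X j) := by
  simpa [dehomogenize_X_self] using
    liftAway_coord_mul (dehomogenize (R := R) i) (isUnit_dehomogenize_X_self i) j

/-- The chart `Xᵢ ≠ 0` of projective space has as its ring a polynomial ring in the other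
coordinates. -/
def awayEquiv (i : Fin (n + 1)) : MvPolynomial {j : Fin (n + 1) // j ≠ i} R ≃+*
    Away (grading n R) (MvPolynomial.X i : MvPolynomial _ R) :=
  RingEquiv.ofRingHom (MvPolynomial.eval₂Hom (awayC _) fun j => coord i j)
    (liftAway (dehomogenize i) (isUnit_dehomogenize_X_self i))
    (by
      refine away_X_hom_ext (fun r => ?_) fun j => ?_
      · simp [liftAway_awayC, dehomogenize_C]
      · rw [RingHom.comp_apply, liftAway_dehomogenize_coord]
        by_cases hj : j = i
        · subst hj; simp [coord_self, dehomogenize_X_self]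
        · have := dehomogenize_X (R := R) i ⟨j, hj⟩
          simp [this])
    (by
      refine MvPolynomial.ringHom_ext (fun r => ?_) fun j => ?_
      · simp only [RingHom.comp_apply, MvPolynomial.coe_eval₂Hom, MvPolynomial.eval₂_C,
          liftAway_awayC, dehomogenize_C, RingHom.id_apply]
      · simp only [RingHom.comp_apply, MvPolynomial.coe_eval₂Hom, MvPolynomial.eval₂_X,
          liftAway_dehomogenize_coord, dehomogenize_X, RingHom.id_apply])

theorem awayEquiv_C (i : Fin (n + 1)) (r : R) :
    awayEquiv i (MvPolynomial.C r) = awayC _ r := by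
  simp [awayEquiv]

theorem awayEquiv_X (i : Fin (n + 1)) (j : {j : Fin (n + 1) // j ≠ i}) :
    awayEquiv (R := R) i (MvPolynomial.X j) = coord i j := by
  simp [awayEquiv]

end Away

end

end SeveriBrauer

namespace SeveriBrauer

noncomputable section

attribute [local instance] MvPolynomial.gradedAlgebra

open HomogeneousLocalization

variable {n : ℕ} {R : Type u} [CommRing R]

/-! ### Charts of projective space and points factoring through them -/

section Chart

variable {h h' : MvPolynomial (Fin (n + 1)) R} {m m' : ℕ}

/-- The basic open subset `h ≠ 0` of projective space. -/
def ProjSpace.basicOpen (h : MvPolynomial (Fin (n + 1)) R) : (ProjSpace n R).Opens :=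
  Proj.basicOpen (grading n R) h

/-- The chart `h ≠ 0` of projective space. -/
def ProjSpace.chart (hh : h ∈ grading n R m) (hm : 0 < m) :
    Spec (CommRingCat.of (Away (grading n R) h)) ⟶ ProjSpace n R :=
  Proj.awayι (grading n R) h hh hm

instance (hh : h ∈ grading n R m) (hm : 0 < m) : IsOpenImmersion (ProjSpace.chart hh hm) :=
  inferInstanceAs (IsOpenImmersion (Proj.awayι (grading n R) h hh hm))

theorem ProjSpace.opensRange_chart (hh : h ∈ grading n R m) (hm : 0 < m) :
    (ProjSpace.chart hh hm).opensRange = ProjSpace.basicOpen h :=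
  Proj.opensRange_awayι _ _ hh hm

theorem ProjSpace.chart_toSpec (hh : h ∈ grading n R m) (hm : 0 < m) :
    ProjSpace.chart hh hm ≫ ProjSpace.toSpec n R = Spec.map (CommRingCat.ofHom (awayC h)) := by
  rw [ProjSpace.chart, ProjSpace.toSpec]
  erw [Proj.awayι_toSpecZero_assoc]
  rw [← Spec.map_comp]
  rfl

theorem ProjSpace.chart_mul (hh : h ∈ grading n R m) (hm : 0 < m) (hh' : h' ∈ grading n R m')
    (hmul : h * h' ∈ grading n R (m + m')) :
    Spec.map (CommRingCat.ofHom (awayMap (grading n R) hh' rfl)) ≫ ProjSpace.chart hh hm =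
      ProjSpace.chart hmul (hm.trans_le (m.le_add_right m')) :=
  Proj.SpecMap_awayMap_awayι (grading n R) hh hm hh' rfl

theorem liftAway_comp_awayMap {B : Type*} [CommRing B] (g : MvPolynomial (Fin (n + 1)) R →+* B)
    (hh : h ∈ grading n R m) (hh' : h' ∈ grading n R m')
    (hu : IsUnit (g h)) (hu' : IsUnit (g (h * h'))) :
    (liftAway g hu').comp (awayMap (grading n R) hh' rfl) = liftAway g hu := by
  refine away_hom_ext hh fun k x hx => ?_
  rw [RingHom.comp_apply, awayMap_mk _ hh' rfl k hh x hx]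
  have h1 := liftAway_mk_mul g hu hh k x hx
  have h2 := liftAway_mk_mul g hu' (SetLike.mul_mem_graded hh hh') k (x * h' ^ k)
    (by rw [smul_add]; exact SetLike.mul_mem_graded hx (SetLike.pow_mem_graded _ hh'))
  have h3 : IsUnit (g h') := by
    rw [map_mul] at hu'
    exact isUnit_of_mul_isUnit_right hu'
  refine (hu'.pow k).mul_right_cancel ?_
  rw [h2, map_mul, map_pow, ← h1, map_mul, mul_pow, mul_assoc]

theorem irrelevant_le_span_X : (HomogeneousIdeal.irrelevant (grading n R)).toIdeal ≤
    Ideal.span (Set.range fun i => (MvPolynomial.X i : MvPolynomial (Fin (n + 1)) R)) := by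
  rw [HomogeneousIdeal.toIdeal_irrelevant_le]
  intro m hm x hx
  change x ∈ Ideal.span _
  rw [← Set.image_univ, MvPolynomial.mem_ideal_span_X_image]
  intro d hd
  have h1 := MvPolynomial.IsHomogeneous.degree_eq_sum_deg_support hx hd
  by_contra! H
  refine hm.ne' (h1.trans (Finset.sum_eq_zero fun i _ => H i trivial))

theorem ProjSpace.iSup_basicOpen_X :
    ⨆ i : Fin (n + 1), ProjSpace.basicOpen (MvPolynomial.X i : MvPolynomial (Fin (n + 1)) R) = ⊤ := by
  exact Proj.iSup_basicOpen_eq_top (grading n R) _ irrelevant_le_span_X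

theorem ProjSpace.exists_mem_basicOpen_X (x : ProjSpace n R) :
    ∃ i : Fin (n + 1), x ∈ ProjSpace.basicOpen (MvPolynomial.X i : MvPolynomial (Fin (n + 1)) R) := by
  have : x ∈ (⊤ : (ProjSpace n R).Opens) := trivial
  rw [← ProjSpace.iSup_basicOpen_X] at this
  simpa using! this

/-- Evaluation of degree zero fractions as a point of projective space. -/
def ProjSpace.chartPoint {B : Type u} [CommRing B] (g : MvPolynomial (Fin (n + 1)) R →+* B)
    (hh : h ∈ grading n R m) (hm : 0 < m) (hu : IsUnit (g h)) :
    Spec (CommRingCat.of B) ⟶ ProjSpace n R :=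
  Spec.map (CommRingCat.ofHom (liftAway g hu)) ≫ ProjSpace.chart hh hm

/-- Both charts are compared with the chart of the product h h'. -/
theorem ProjSpace.chartPoint_eq {B : Type u} [CommRing B]
    (g : MvPolynomial (Fin (n + 1)) R →+* B)
    (hh : h ∈ grading n R m) (hm : 0 < m) (hu : IsUnit (g h))
    (hh' : h' ∈ grading n R m') (hm' : 0 < m') (hu' : IsUnit (g h')) :
    ProjSpace.chartPoint g hh hm hu = ProjSpace.chartPoint g hh' hm' hu' := by
  have key : ∀ {h h' : MvPolynomial (Fin (n + 1)) R} {m m' : ℕ}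
      (hh : h ∈ grading n R m) (hm : 0 < m) (hu : IsUnit (g h))
      (hh' : h' ∈ grading n R m') (hu' : IsUnit (g h')),
      ProjSpace.chartPoint g hh hm hu = ProjSpace.chartPoint g (SetLike.mul_mem_graded hh hh')
        (hm.trans_le (m.le_add_right m')) (by rw [map_mul]; exact hu.mul hu') := by
    intro h h' m m' hh hm hu hh' hu'
    rw [ProjSpace.chartPoint, ProjSpace.chartPoint, ← ProjSpace.chart_mul hh hm hh',
      ← Spec.map_comp_assoc, ← CommRingCat.ofHom_comp, liftAway_comp_awayMap g hh hh' hu]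
  rw [key hh hm hu hh' hu', key hh' hm' hu' hh hu]
  congr 1 <;> simp [mul_comm, add_comm]

theorem ProjSpace.chartPoint_toSpec {B : Type u} [CommRing B]
    (g : MvPolynomial (Fin (n + 1)) R →+* B)
    (hh : h ∈ grading n R m) (hm : 0 < m) (hu : IsUnit (g h)) :
    ProjSpace.chartPoint g hh hm hu ≫ ProjSpace.toSpec n R =
      Spec.map (CommRingCat.ofHom (g.comp MvPolynomial.C)) := by
  rw [ProjSpace.chartPoint, Category.assoc, ProjSpace.chart_toSpec, ← Spec.map_comp,
    ← CommRingCat.ofHom_comp]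
  congr 2
  ext r
  exact liftAway_awayC g hu r

theorem ProjSpace.SpecMap_comp_chartPoint {B C : Type u} [CommRing B] [CommRing C] (φ : B →+* C)
    (g : MvPolynomial (Fin (n + 1)) R →+* B)
    (hh : h ∈ grading n R m) (hm : 0 < m) (hu : IsUnit (g h)) :
    Spec.map (CommRingCat.ofHom φ) ≫ ProjSpace.chartPoint g hh hm hu =
      ProjSpace.chartPoint (φ.comp g) hh hm (hu.map φ) := by
  rw [ProjSpace.chartPoint, ProjSpace.chartPoint, ← Spec.map_comp_assoc,
    ← CommRingCat.ofHom_comp]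
  congr 3
  refine away_hom_ext hh fun k x hx => ?_
  have h1 := liftAway_mk_mul g hu hh k x hx
  have h2 := liftAway_mk_mul (φ.comp g) (hu.map φ) hh k x hx
  refine ((hu.map φ).pow k).mul_right_cancel ?_
  simp only [RingHom.comp_apply] at h2 ⊢
  rw [h2, ← h1, map_mul, map_pow]

theorem ProjSpace.SpecMap_comp_chart_X {B : Type u} [CommRing B] (i : Fin (n + 1))
    (φ : Away (grading n R) (MvPolynomial.X i : MvPolynomial _ R) →+* B) :
    ∃ hu : IsUnit ((φ.comp (toAway i)) (MvPolynomial.X i)),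
      Spec.map (CommRingCat.ofHom φ) ≫ ProjSpace.chart (X_mem_grading i) one_pos =
        ProjSpace.chartPoint (φ.comp (toAway i)) (X_mem_grading i) one_pos hu := by
  have hu : IsUnit ((φ.comp (toAway i)) (MvPolynomial.X i)) := by
    simp [toAway_X, coord_self]
  refine ⟨hu, ?_⟩
  rw [ProjSpace.chartPoint, liftAway_eq_of_X]

end Chart

/-! ### Field-valued points in homogeneous coordinates -/

section Point

variable {B : Type u} [Field B]

/-- The unique point of the spectrum of a field. -/
def specPt (B : Type u) [Field B] : Spec (CommRingCat.of B) := IsLocalRing.closedPoint B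

open Classical in
/-- The point of projective space with homogeneous coordinates `w` (a junk value for `w = 0`). -/
def ProjSpace.point (φ : R →+* B) (w : Fin (n + 1) → B) :
    Spec (CommRingCat.of B) ⟶ ProjSpace n R :=
  if h : ∃ i, w i ≠ 0 then
    ProjSpace.chartPoint (MvPolynomial.eval₂Hom φ w) (X_mem_grading h.choose) one_pos
      (by simpa using h.choose_spec)
  else ProjSpace.chartPoint (MvPolynomial.eval₂Hom φ 1) (X_mem_grading 0) one_pos (by simp)

variable {h : MvPolynomial (Fin (n + 1)) R} {m : ℕ}

theorem ProjSpace.point_eq_chartPoint (φ : R →+* B) {w : Fin (n + 1) → B} (hw : w ≠ 0)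
    (hh : h ∈ grading n R m) (hm : 0 < m) (hu : IsUnit (MvPolynomial.eval₂Hom φ w h)) :
    ProjSpace.point φ w = ProjSpace.chartPoint (MvPolynomial.eval₂Hom φ w) hh hm hu := by
  have h0 : ∃ i, w i ≠ 0 := Function.ne_iff.1 hw
  rw [ProjSpace.point, dif_pos h0]
  exact ProjSpace.chartPoint_eq _ _ _ _ _ _ _

theorem ProjSpace.point_eq_chartPoint_X (φ : R →+* B) {w : Fin (n + 1) → B} (i : Fin (n + 1))
    (hw : w i ≠ 0) :
    ProjSpace.point φ w = ProjSpace.chartPoint (MvPolynomial.eval₂Hom φ w) (X_mem_grading i)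
      one_pos (by simpa using hw) :=
  ProjSpace.point_eq_chartPoint φ (fun h => hw (congrFun h i)) _ _ _

theorem ProjSpace.point_toSpec (φ : R →+* B) (w : Fin (n + 1) → B) :
    ProjSpace.point φ w ≫ ProjSpace.toSpec n R = Spec.map (CommRingCat.ofHom φ) := by
  have key : ∀ w : Fin (n + 1) → B, (MvPolynomial.eval₂Hom φ w).comp MvPolynomial.C = φ := by
    intro w; ext r; simp
  rw [ProjSpace.point]
  split_ifs <;> rw [ProjSpace.chartPoint_toSpec, key]

theorem ProjSpace.SpecMap_comp_point {B' : Type u} [Field B'] (ψ : B →+* B') (φ : R →+* B)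
    {w : Fin (n + 1) → B} (hw : w ≠ 0) :
    Spec.map (CommRingCat.ofHom ψ) ≫ ProjSpace.point φ w =
      ProjSpace.point (ψ.comp φ) (ψ ∘ w) := by
  obtain ⟨i, hi⟩ := Function.ne_iff.1 hw
  rw [ProjSpace.point_eq_chartPoint_X φ i hi, ProjSpace.SpecMap_comp_chartPoint,
    ProjSpace.point_eq_chartPoint_X (w := ψ ∘ w) (ψ.comp φ) i (by simpa using hi)]
  congr 1
  ext <;> simp

theorem ProjSpace.point_specPt_mem_basicOpen (φ : R →+* B) {w : Fin (n + 1) → B} (hw : w ≠ 0)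
    (hh : h ∈ grading n R m) (hm : 0 < m) :
    ProjSpace.point φ w (specPt B) ∈ ProjSpace.basicOpen h ↔
      MvPolynomial.eval₂ φ w h ≠ 0 := by
  constructor
  · intro H
    obtain ⟨i, hi⟩ := Function.ne_iff.1 hw
    rw [ProjSpace.point_eq_chartPoint_X φ i hi, ProjSpace.chartPoint, Scheme.Hom.comp_apply] at H
    have H2 : (Spec.map (CommRingCat.ofHom (liftAway (MvPolynomial.eval₂Hom φ w) _)))
        (specPt B) ∈ Proj.awayι (grading n R) (MvPolynomial.X i)
          (X_mem_grading i) one_pos ⁻¹ᵁ Proj.basicOpen (grading n R) h := H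
    rw [Proj.awayι_preimage_basicOpen (grading n R) (X_mem_grading i) one_pos hh hm] at H2
    have H3 : liftAway (MvPolynomial.eval₂Hom φ w) (by simpa using hi)
      (Away.isLocalizationElem (X_mem_grading i) hh) ≠ 0 := by
        intro h0
        refine H2 ?_
        change liftAway (MvPolynomial.eval₂Hom φ w) _ _ ∈ IsLocalRing.maximalIdeal B
        rw [h0]
        exact zero_mem _
    -- On the chart of Xᵢ the open set h ≠ 0 is cut out by h¹ / Xᵢᵐ, whence the exponents.
    have H4 := liftAway_mk_mul (MvPolynomial.eval₂Hom φ w) (h := MvPolynomial.X i)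
      (by simpa using hi) (X_mem_grading i) m (h ^ 1)
        (by convert! SetLike.pow_mem_graded 1 hh using 2; exact mul_comm _ _)
    intro h0
    have h1 : MvPolynomial.eval₂Hom φ w (h ^ 1) = 0 := by simpa using h0
    rw [h1] at H4
    rcases mul_eq_zero.1 H4 with h5 | h5
    · exact H3 h5
    · exact hi (by simpa using eq_zero_of_pow_eq_zero h5)
  · intro H
    rw [ProjSpace.point_eq_chartPoint φ hw hh hm (by simpa using H), ← ProjSpace.opensRange_chart hh hm]
    exact ⟨_, rfl⟩

/-- The spectrum of a field is a single point, so the morphism factors through one standard chart,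
and the images of the coordinate functions are the coordinates. -/
theorem ProjSpace.exists_eq_point (f : Spec (CommRingCat.of B) ⟶ ProjSpace n R) :
    ∃ (φ : R →+* B) (w : Fin (n + 1) → B), w ≠ 0 ∧ f = ProjSpace.point φ w := by
  obtain ⟨i, hi⟩ := ProjSpace.exists_mem_basicOpen_X (f (specPt B))
  rw [← ProjSpace.opensRange_chart (X_mem_grading i) one_pos] at hi
  have hr : Set.range f ⊆ Set.range (ProjSpace.chart (R := R) (X_mem_grading i) one_pos) := by
    rintro _ ⟨x, rfl⟩
    rw [Subsingleton.elim x (specPt B)]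
    exact hi
  obtain ⟨ψ, hψ⟩ := Spec.map_surjective (IsOpenImmersion.lift
    (ProjSpace.chart (R := R) (X_mem_grading i) one_pos) f hr)
  have h1 : f = Spec.map (CommRingCat.ofHom ψ.hom) ≫
      ProjSpace.chart (R := R) (X_mem_grading i) one_pos := by
    rw [CommRingCat.ofHom_hom, hψ, IsOpenImmersion.lift_fac]
  obtain ⟨hu, h2⟩ := ProjSpace.SpecMap_comp_chart_X i ψ.hom
  set g := ψ.hom.comp (toAway i) with hg
  have h3 : g = MvPolynomial.eval₂Hom (g.comp MvPolynomial.C) (fun j => g (MvPolynomial.X j)) := by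
    ext <;> simp
  have hi' : g (MvPolynomial.X i) ≠ 0 := hu.ne_zero
  refine ⟨g.comp MvPolynomial.C, fun j => g (MvPolynomial.X j), Function.ne_iff.2 ⟨i, hi'⟩, ?_⟩
  rw [ProjSpace.point_eq_chartPoint_X _ i hi', h1, h2]
  congr 1

theorem ProjSpace.point_eq_point_iff (φ : R →+* B) {w w' : Fin (n + 1) → B} (hw : w ≠ 0)
    (hw' : w' ≠ 0) :
    ProjSpace.point φ w = ProjSpace.point φ w' ↔ ∃ c : B, w' = c • w := by
  constructor
  · intro H
    obtain ⟨i, hi⟩ := Function.ne_iff.1 hw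
    have h1 := (ProjSpace.point_specPt_mem_basicOpen φ hw (X_mem_grading i) one_pos).2
      (by simpa using hi)
    rw [H, ProjSpace.point_specPt_mem_basicOpen φ hw' (X_mem_grading i) one_pos] at h1
    have hi' : w' i ≠ 0 := by simpa using h1
    rw [ProjSpace.point_eq_chartPoint_X φ i hi, ProjSpace.point_eq_chartPoint_X φ i hi',
      ProjSpace.chartPoint, ProjSpace.chartPoint, cancel_mono, Spec.map_inj] at H
    refine ⟨w' i / w i, funext fun j => ?_⟩
    have h2 := liftAway_coord_mul (MvPolynomial.eval₂Hom φ w) (i := i) (by simpa using hi) j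
    have h3 := liftAway_coord_mul (MvPolynomial.eval₂Hom φ w') (i := i) (by simpa using hi') j
    have h4 := congr(($H).hom (coord i j))
    simp only [CommRingCat.hom_ofHom] at h4
    rw [← h4] at h3
    simp only [MvPolynomial.coe_eval₂Hom, MvPolynomial.eval₂_X] at h2 h3
    rw [Pi.smul_apply, smul_eq_mul, ← h3, ← h2]
    have : w i ≠ 0 := hi
    field_simp
  · rintro ⟨c, rfl⟩
    obtain ⟨i, hi⟩ := Function.ne_iff.1 hw
    have hc : c ≠ 0 := by rintro rfl; simp at hw'
    have hi' : (c • w) i ≠ 0 := by simpa using ⟨hc, hi⟩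
    rw [ProjSpace.point_eq_chartPoint_X φ i hi, ProjSpace.point_eq_chartPoint_X φ i hi',
      ProjSpace.chartPoint, ProjSpace.chartPoint]
    congr 3
    refine away_X_hom_ext (fun r => ?_) fun j => ?_
    · simp [liftAway_awayC]
    · have h2 := liftAway_coord_mul (MvPolynomial.eval₂Hom φ w) (i := i) (by simpa using hi) j
      have h3 := liftAway_coord_mul (MvPolynomial.eval₂Hom φ (c • w)) (i := i)
        (by simpa using hi') j
      simp only [MvPolynomial.coe_eval₂Hom, MvPolynomial.eval₂_X, Pi.smul_apply,
        smul_eq_mul] at h2 h3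
      have : c * w i ≠ 0 := mul_ne_zero hc hi
      refine mul_right_cancel₀ this ?_
      rw [h3, ← h2]
      ring

end Point

end

end SeveriBrauer

/-! ### Semilinear automorphisms of the plane are given by matrices -/

namespace SeveriBrauer

noncomputable section

attribute [local instance] MvPolynomial.gradedAlgebra

open HomogeneousLocalization

variable {L : Type u} [Field L]

theorem ProjSpace.exists_homogeneous_mem_le {n : ℕ} {x : ProjSpace n L} {U : (ProjSpace n L).Opens}
    (hx : x ∈ U) : ∃ (h : MvPolynomial (Fin (n + 1)) L) (m : ℕ), 0 < m ∧ h ∈ grading n L m ∧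
      x ∈ ProjSpace.basicOpen h ∧ ProjSpace.basicOpen h ≤ U := by
  obtain ⟨_, ⟨g, rfl⟩, h1, h2⟩ :=
    (TopologicalSpace.Opens.isBasis_iff_nbhd.1 (Proj.isBasis_basicOpen (grading n L))) hx
  have h3 := h1
  rw [Proj.basicOpen_eq_iSup_proj] at h3
  obtain ⟨k, hk⟩ := TopologicalSpace.Opens.mem_iSup.1 h3
  obtain ⟨j, hj⟩ := ProjSpace.exists_mem_basicOpen_X x
  have h4 : ProjSpace.basicOpen (GradedRing.proj (grading n L) k g * MvPolynomial.X j) =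
      ProjSpace.basicOpen (GradedRing.proj (grading n L) k g) ⊓
        ProjSpace.basicOpen (MvPolynomial.X j) := Proj.basicOpen_mul (grading n L) _ _
  -- The component of g may have degree 0; the factor Xⱼ makes the degree positive, as charts
  -- require.
  refine ⟨GradedRing.proj (grading n L) k g * MvPolynomial.X j, k + 1, k.succ_pos,
    SetLike.mul_mem_graded (SetLike.coe_mem _) (X_mem_grading j), ?_, ?_⟩
  · rw [h4]
    exact ⟨hk, hj⟩
  · rw [h4]
    refine inf_le_left.trans (le_trans ?_ h2)
    rw [Proj.basicOpen_eq_iSup_proj (grading n L) g]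
    exact le_iSup (fun i => Proj.basicOpen (grading n L) (GradedRing.proj (grading n L) i g)) k

theorem Spec_map_ofHom_inj {A B : Type u} [CommRing A] [CommRing B] {f g : A →+* B}
    (h : Spec.map (CommRingCat.ofHom f) = Spec.map (CommRingCat.ofHom g)) : f = g := by
  rw [Spec.map_inj] at h
  exact congrArg CommRingCat.Hom.hom h

theorem ProjSpace.exists_point_comp {n : ℕ} {σ : L →+* L} {f : ProjSpace n L ⟶ ProjSpace n L}
    (hf : f ≫ ProjSpace.toSpec n L = ProjSpace.toSpec n L ≫ Spec.map (CommRingCat.ofHom σ))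
    (v : Fin (n + 1) → L) :
    ∃ w, w ≠ 0 ∧ ProjSpace.point (RingHom.id L) v ≫ f = ProjSpace.point σ w := by
  obtain ⟨φ, w, hw, h⟩ := ProjSpace.exists_eq_point (ProjSpace.point (RingHom.id L) v ≫ f)
  have h1 := congrArg (· ≫ ProjSpace.toSpec n L) h
  simp only [Category.assoc, hf, ProjSpace.point_toSpec] at h1
  rw [reassoc_of% (ProjSpace.point_toSpec (RingHom.id L) v), ← Spec.map_comp,
    ← CommRingCat.ofHom_comp] at h1
  obtain rfl := Spec_map_ofHom_inj h1
  exact ⟨w, hw, h⟩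

theorem ProjSpace.exists_common_denominator {h : MvPolynomial (Fin 3) L} {m : ℕ}
    (hh : h ∈ grading 2 L m) (u : Fin 3 → Away (grading 2 L) h) :
    ∃ (k : ℕ) (A : Fin 3 → MvPolynomial (Fin 3) L) (hA : ∀ j, A j ∈ grading 2 L (k • m)),
      ∀ j, u j = Away.mk (grading 2 L) hh k (A j) (hA j) := by
  choose k a ha hu using fun j => Away.mk_surjective (grading 2 L) hh (u j)
  have hA : ∀ j, a j * h ^ (∑ i, k i - k j) ∈ grading 2 L ((∑ i, k i) • m) := by
    intro j
    have h1 := SetLike.mul_mem_graded (ha j) (SetLike.pow_mem_graded (∑ i, k i - k j) hh)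
    have h2 : k j ≤ ∑ i, k i := Finset.single_le_sum (fun _ _ => Nat.zero_le _) (Finset.mem_univ j)
    rwa [← add_smul, Nat.add_sub_cancel' h2] at h1
  refine ⟨∑ i, k i, fun j => a j * h ^ (∑ i, k i - k j), hA, fun j => ?_⟩
  have h2 : k j ≤ ∑ i, k i := Finset.single_le_sum (fun _ _ => Nat.zero_le _) (Finset.mem_univ j)
  rw [← hu j]
  ext
  rw [Away.val_mk, Away.val_mk, Localization.mk_eq_mk_iff, Localization.r_iff_exists]
  refine ⟨1, ?_⟩
  simp only [OneMemClass.coe_one, one_mul]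
  obtain ⟨d, hd⟩ := Nat.exists_eq_add_of_le h2
  rw [hd, Nat.add_sub_cancel_left]
  ring

/-- Near a point, f maps a chart h ≠ 0 into a standard chart. The pullbacks of Xⱼ / Xᵢ are fractions
with a common denominator hᵏ, whose numerators are the polynomials sought. -/
theorem ProjSpace.exists_local_polynomials {σ : L →+* L} {f : ProjSpace 2 L ⟶ ProjSpace 2 L}
    (hf : f ≫ ProjSpace.toSpec 2 L = ProjSpace.toSpec 2 L ≫ Spec.map (CommRingCat.ofHom σ))
    {v : Fin 3 → L} (hv : v ≠ 0) :
    ∃ (h : MvPolynomial (Fin 3) L) (m : ℕ) (A : Fin 3 → MvPolynomial (Fin 3) L),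
      (∀ j, (A j).IsHomogeneous m) ∧ MvPolynomial.eval v h ≠ 0 ∧
      ∀ w, w ≠ 0 → MvPolynomial.eval w h ≠ 0 → evalTriple A w ≠ 0 ∧
        ProjSpace.point (RingHom.id L) w ≫ f = ProjSpace.point σ (evalTriple A w) := by
  set x := ProjSpace.point (RingHom.id L) v (specPt L)
  obtain ⟨i, hi⟩ := ProjSpace.exists_mem_basicOpen_X (f x)
  obtain ⟨h, m, hm, hh, hxh, hle⟩ := ProjSpace.exists_homogeneous_mem_le
    (x := x) (U := f ⁻¹ᵁ ProjSpace.basicOpen (MvPolynomial.X i)) hi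
  have hev : MvPolynomial.eval v h ≠ 0 :=
    (ProjSpace.point_specPt_mem_basicOpen (RingHom.id L) hv hh hm).1 hxh
  have hr : Set.range (ProjSpace.chart hh hm ≫ f) ⊆
      Set.range (ProjSpace.chart (R := L) (X_mem_grading i) one_pos) := by
    rintro _ ⟨y, rfl⟩
    change (ProjSpace.chart hh hm ≫ f) y ∈ (ProjSpace.chart (X_mem_grading i) one_pos).opensRange
    rw [ProjSpace.opensRange_chart]
    refine hle (x := ProjSpace.chart hh hm y) ?_
    rw [← ProjSpace.opensRange_chart hh hm]
    exact ⟨y, rfl⟩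
  obtain ⟨ψ, hψ⟩ := Spec.map_surjective (IsOpenImmersion.lift
    (ProjSpace.chart (R := L) (X_mem_grading i) one_pos) (ProjSpace.chart hh hm ≫ f) hr)
  have hψ1 : Spec.map (CommRingCat.ofHom ψ.hom) ≫ ProjSpace.chart (X_mem_grading i) one_pos =
      ProjSpace.chart hh hm ≫ f := by
    rw [CommRingCat.ofHom_hom, hψ, IsOpenImmersion.lift_fac]
  have hψC : ψ.hom.comp (awayC _) = (awayC h).comp σ := by
    have h1 := congrArg (· ≫ ProjSpace.toSpec 2 L) hψ1
    simp only [Category.assoc, hf, ProjSpace.chart_toSpec] at h1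
    rw [reassoc_of% (ProjSpace.chart_toSpec hh hm), ← Spec.map_comp, ← Spec.map_comp,
      ← CommRingCat.ofHom_comp, ← CommRingCat.ofHom_comp] at h1
    exact Spec_map_ofHom_inj h1
  obtain ⟨k, A, hA, hAu⟩ := ProjSpace.exists_common_denominator hh fun j => ψ.hom (coord i j)
  refine ⟨h, k • m, A, hA, hev, fun w hw hwh => ?_⟩
  have hu : IsUnit (MvPolynomial.eval₂Hom (RingHom.id L) w h) := hwh.isUnit
  set φ := (liftAway (MvPolynomial.eval₂Hom (RingHom.id L) w) hu).comp ψ.hom with hφ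
  have hφA : ∀ j, φ (coord i j) * MvPolynomial.eval w h ^ k = MvPolynomial.eval w (A j) := by
    intro j
    rw [hφ, RingHom.comp_apply, hAu]
    exact liftAway_mk_mul (MvPolynomial.eval₂Hom (RingHom.id L) w) hu hh k (A j) (hA j)
  have hc : MvPolynomial.eval w h ^ k ≠ 0 := pow_ne_zero _ hwh
  have hev : evalTriple A w = MvPolynomial.eval w h ^ k • fun j => φ (coord i j) := by
    funext j
    rw [Pi.smul_apply, smul_eq_mul, mul_comm, hφA]
    rfl
  have hφi : φ (coord i i) = 1 := by rw [coord_self, map_one]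
  have hu0 : (fun j => φ (coord i j)) ≠ 0 := fun h0 => by simpa [hφi] using congrFun h0 i
  have hA0 : evalTriple A w ≠ 0 := by
    rw [hev]
    exact smul_ne_zero hc hu0
  refine ⟨hA0, ?_⟩
  have hg : φ.comp (toAway i) = MvPolynomial.eval₂Hom σ fun j => φ (coord i j) := by
    refine MvPolynomial.ringHom_ext (fun r => ?_) fun j => ?_
    · rw [RingHom.comp_apply, toAway_C, hφ, RingHom.comp_apply,
        show ψ.hom (awayC _ r) = awayC h (σ r) from DFunLike.congr_fun hψC r, liftAway_awayC]
      simp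
    · simp [toAway_X]
  have h2 : ProjSpace.point (RingHom.id L) w ≫ f =
      Spec.map (CommRingCat.ofHom φ) ≫ ProjSpace.chart (X_mem_grading i) one_pos := by
    rw [ProjSpace.point_eq_chartPoint (RingHom.id L) hw hh hm hu, ProjSpace.chartPoint,
      Category.assoc, ← hψ1, ← Spec.map_comp_assoc, ← CommRingCat.ofHom_comp]
  obtain ⟨hu', h3⟩ := ProjSpace.SpecMap_comp_chart_X i φ
  rw [h2, h3, ← (ProjSpace.point_eq_point_iff σ hu0 hA0).2 ⟨_, hev⟩,
    ProjSpace.point_eq_chartPoint_X σ i (by simp [hφi])]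
  congr 1

theorem comp_symm_comp {σ : L ≃+* L} (w : Fin 3 → L) : σ ∘ (σ.symm ∘ w) = w := by
  funext i; simp

theorem ProjSpace.point_eq_SpecMap (σ : L ≃+* L) {w : Fin 3 → L} (hw : w ≠ 0) :
    ProjSpace.point (σ : L →+* L) w =
      Spec.map (CommRingCat.ofHom (σ : L →+* L)) ≫
        ProjSpace.point (RingHom.id L) (σ.symm ∘ w) := by
  rw [ProjSpace.SpecMap_comp_point _ _ (comp_ne_zero σ.symm hw)]
  congr 1
  exact (comp_symm_comp w).symm

theorem ProjSpace.exists_isLocallyPolynomial {σ : L ≃+* L} {f : ProjSpace 2 L ⟶ ProjSpace 2 L}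
    (hf : f ≫ ProjSpace.toSpec 2 L =
      ProjSpace.toSpec 2 L ≫ Spec.map (CommRingCat.ofHom (σ : L →+* L))) :
    ∃ T : (Fin 3 → L) → Fin 3 → L, (∀ v, T v ≠ 0) ∧ IsLocallyPolynomial σ.symm T ∧
      ∀ v, ProjSpace.point (RingHom.id L) v ≫ f =
        Spec.map (CommRingCat.ofHom (σ : L →+* L)) ≫ ProjSpace.point (RingHom.id L) (T v) := by
  choose w hw h using ProjSpace.exists_point_comp hf
  refine ⟨fun v => σ.symm ∘ w v, fun v => comp_ne_zero σ.symm (hw v), fun v hv => ?_, fun v => ?_⟩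
  · obtain ⟨h', m, A, hA, hev, H⟩ := ProjSpace.exists_local_polynomials hf hv
    refine ⟨h', m, A, hA, hev, fun w' hw' hwh => ?_⟩
    obtain ⟨h1, h2⟩ := H w' hw' hwh
    refine ⟨h1, Proportional.comp σ.symm ?_⟩
    rw [h w', ProjSpace.point_eq_point_iff _ (hw w') h1] at h2
    obtain ⟨c, hc⟩ := h2
    rw [hc]
    exact (proportional_smul c _).symm
  · rw [h v, ProjSpace.point_eq_SpecMap σ (hw v)]

theorem ProjSpace.exists_matrix [IsAlgClosed L] (σ : L ≃+* L) (f : ProjSpace 2 L ≅ ProjSpace 2 L)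
    (hf : f.hom ≫ ProjSpace.toSpec 2 L =
      ProjSpace.toSpec 2 L ≫ Spec.map (CommRingCat.ofHom (σ : L →+* L))) :
    ∃ N : Matrix (Fin 3) (Fin 3) L, N.det ≠ 0 ∧ ∀ v, v ≠ 0 →
      ProjSpace.point (RingHom.id L) v ≫ f.hom =
        Spec.map (CommRingCat.ofHom (σ : L →+* L)) ≫
          ProjSpace.point (RingHom.id L) (N.mulVec (σ.symm ∘ v)) := by
  have hσ : Spec.map (CommRingCat.ofHom (σ : L →+* L)) ≫
      Spec.map (CommRingCat.ofHom (σ.symm : L →+* L)) = 𝟙 _ := by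
    rw [← Spec.map_comp, ← CommRingCat.ofHom_comp, ← Spec.map_id]
    congr 1
    ext; simp
  have hf' : f.inv ≫ ProjSpace.toSpec 2 L =
      ProjSpace.toSpec 2 L ≫ Spec.map (CommRingCat.ofHom (σ.symm : L →+* L)) := by
    rw [Iso.inv_comp_eq, reassoc_of% hf, hσ, Category.comp_id]
  obtain ⟨T, hT0, hT, hTf⟩ := ProjSpace.exists_isLocallyPolynomial hf
  obtain ⟨T', hT'0, hT', hTf'⟩ := ProjSpace.exists_isLocallyPolynomial hf'
  obtain ⟨N, hN, H⟩ := hT.exists_matrix hT' (fun w _ => hT0 w) (fun w _ => hT'0 w) (by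
    intro w hw
    have h1 : ProjSpace.point (RingHom.id L) w =
        ProjSpace.point (RingHom.id L) (T' (T w)) := by
      have h2 := congrArg (· ≫ f.inv) (hTf w)
      simp only [Category.assoc, Iso.hom_inv_id, Category.comp_id] at h2
      rw [h2, hTf', reassoc_of% hσ]
    rw [ProjSpace.point_eq_point_iff _ hw (hT'0 _)] at h1
    obtain ⟨c, hc⟩ := h1
    rw [hc]
    exact proportional_smul c _)
  refine ⟨N, hN, fun v hv => ?_⟩
  rw [hTf v]
  have h0 : N.mulVec (σ.symm ∘ v) ≠ 0 := fun h =>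
    comp_ne_zero σ.symm hv (Matrix.eq_zero_of_mulVec_eq_zero hN h)
  obtain ⟨c, hc⟩ := (H v hv).exists_smul h0
  rw [(ProjSpace.point_eq_point_iff _ h0 (hT0 v)).2 ⟨c, hc⟩]

end

end SeveriBrauer

/-! ### Properness, and matrices that agree on lines -/

namespace SeveriBrauer

noncomputable section

attribute [local instance] MvPolynomial.gradedAlgebra

theorem isIso_SpecMap_gradeZero (n : ℕ) (R : Type u) [CommRing R] :
    IsIso (Spec.map (CommRingCat.ofHom (algebraMap R (grading n R 0)))) := by
  have hb : Function.Bijective (algebraMap R (grading n R 0)) := by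
    refine ⟨fun a b h => ?_, fun x => ?_⟩
    · exact MvPolynomial.C_injective _ _ (congrArg Subtype.val h)
    · have h1 := (MvPolynomial.totalDegree_zero_iff_isHomogeneous (p := x.1)).2 x.2
      rw [MvPolynomial.totalDegree_eq_zero_iff_eq_C] at h1
      exact ⟨_, Subtype.ext h1.symm⟩
  have : IsIso (CommRingCat.ofHom (algebraMap R (grading n R 0))) :=
    (RingEquiv.ofBijective _ hb).toCommRingCatIso.isIso_hom
  infer_instance

instance (n : ℕ) (R : Type u) [CommRing R] : IsProper (ProjSpace.toSpec n R) := by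
  have := isIso_SpecMap_gradeZero n R
  have : Algebra.FiniteType (grading n R 0) (MvPolynomial (Fin (n + 1)) R) :=
    have : IsScalarTower R (grading n R 0) (MvPolynomial (Fin (n + 1)) R) :=
      IsScalarTower.of_algebraMap_eq (R := R) (S := grading n R 0)
        (A := MvPolynomial (Fin (n + 1)) R) fun _ => rfl
    Algebra.FiniteType.of_restrictScalars_finiteType R _ _
  exact inferInstanceAs (IsProper (Proj.toSpecZero (grading n R) ≫
    Spec.map (CommRingCat.ofHom (algebraMap R (grading n R 0)))))

theorem IsProjective.isProper {K : Type u} [Field K] {S : Scheme.{u}}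
    {π : S ⟶ Spec (CommRingCat.of K)} (h : IsProjective π) : IsProper π := by
  obtain ⟨n, i, hi, rfl⟩ := h
  infer_instance

theorem exists_eq_smul_of_forall_mulVec {L : Type*} [Field L] {A B : Matrix (Fin 3) (Fin 3) L}
    (hB : B.det ≠ 0) (h : ∀ v, v ≠ 0 → ∃ c : L, A.mulVec v = c • B.mulVec v) :
    ∃ c : L, A = c • B := by
  obtain ⟨c, hc⟩ := LinearMap.exists_eq_smul_id_of_forall_notLinearIndependent (R := L)
    (f := (B⁻¹ * A).mulVecLin) (fun v => by
      by_cases hv : v = 0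
      · subst hv; intro h; exact h.ne_zero 0 rfl
      · obtain ⟨c, hc⟩ := h v hv
        rw [LinearIndependent.pair_iff]
        intro H
        have h1 : (B⁻¹ * A).mulVecLin v = c • v := by
          rw [Matrix.mulVecLin_apply, ← Matrix.mulVec_mulVec, hc, Matrix.mulVec_smul,
            Matrix.mulVec_mulVec, Matrix.nonsing_inv_mul _ hB.isUnit, Matrix.one_mulVec]
        have := (H (-c) 1 (by rw [h1]; simp)).2
        simp at this)
  refine ⟨c, ?_⟩
  have h1 : B⁻¹ * A = c • 1 := by
    refine Matrix.toLin'.injective ?_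
    refine LinearMap.ext fun v => ?_
    have := DFunLike.congr_fun hc v
    simpa [Matrix.toLin'_apply] using this
  rw [← Matrix.mul_nonsing_inv_cancel_left B A hB.isUnit, h1]
  simp

/-! ### Galois action on the spectrum of the closure -/

section autSpec

variable {K : Type u} [Field K] {L : Type u} [Field L] [Algebra K L]

/-- The automorphism of `Spec L` given by an automorphism of `L` over `K`. -/
def autSpec (σ : L ≃ₐ[K] L) : Spec (CommRingCat.of L) ⟶ Spec (CommRingCat.of L) :=
  Spec.map (CommRingCat.ofHom ((σ : L ≃+* L) : L →+* L))

theorem autSpec_comp_specMap (σ : L ≃ₐ[K] L) : autSpec σ ≫ specMap K L = specMap K L := by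
  rw [autSpec, ← Spec.map_comp, ← CommRingCat.ofHom_comp]
  congr 2
  ext x
  exact σ.commutes x

theorem autSpec_comp_autSpec (σ τ : L ≃ₐ[K] L) : autSpec σ ≫ autSpec τ = autSpec (σ * τ) := by
  rw [autSpec, autSpec, ← Spec.map_comp, ← CommRingCat.ofHom_comp]
  rfl

theorem autSpec_one : autSpec (1 : L ≃ₐ[K] L) = 𝟙 _ :=
  Spec.map_id _

end autSpec

/-- An isomorphism over `L` of the base change of `S` with the projective plane. -/
structure Trivialization {K : Type u} [Field K] {S : Scheme.{u}} (π : S ⟶ Spec (CommRingCat.of K))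
    (L : Type u) [Field L] [Algebra K L] where
  /-- The underlying isomorphism of schemes. -/
  iso : pullback π (specMap K L) ≅ ProjSpace 2 L
  iso_hom_toSpec : iso.hom ≫ ProjSpace.toSpec 2 L = pullback.snd π (specMap K L)

/-! ### The cocycle of a trivialized surface -/

namespace Trivialization

variable {K : Type u} [Field K] {S : Scheme.{u}} {π : S ⟶ Spec (CommRingCat.of K)}
    {L : Type u} [Field L] [Algebra K L] (T : Trivialization π L)

theorem iso_inv_snd : T.iso.inv ≫ pullback.snd π (specMap K L) = ProjSpace.toSpec 2 L := by
  rw [Iso.inv_comp_eq, T.iso_hom_toSpec]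

/-- The point of `S` over `L` with given homogeneous coordinates. -/
def point (v : Fin 3 → L) : Spec (CommRingCat.of L) ⟶ S :=
  ProjSpace.point (RingHom.id L) v ≫ T.iso.inv ≫ pullback.fst π (specMap K L)

theorem SpecMap_id : Spec.map (CommRingCat.ofHom (RingHom.id L)) = 𝟙 _ :=
  Spec.map_id _

theorem point_mem (v : Fin 3 → L) : T.point v ∈ points π L := by
  change T.point v ≫ π = specMap K L
  rw [point, Category.assoc, Category.assoc, pullback.condition,
    reassoc_of% T.iso_inv_snd, reassoc_of% (ProjSpace.point_toSpec (RingHom.id L) v), SpecMap_id,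
    Category.id_comp]

theorem exists_eq_point {g : Spec (CommRingCat.of L) ⟶ S} (hg : g ∈ points π L) :
    ∃ v, v ≠ 0 ∧ g = T.point v := by
  have hg' : g ≫ π = 𝟙 _ ≫ specMap K L := by rw [Category.id_comp]; exact hg
  obtain ⟨φ, v, hv, h⟩ := ProjSpace.exists_eq_point (pullback.lift g (𝟙 _) hg' ≫ T.iso.hom)
  have h1 := congrArg (· ≫ ProjSpace.toSpec 2 L) h
  simp only [Category.assoc, T.iso_hom_toSpec, pullback.lift_snd, ProjSpace.point_toSpec,
    ← SpecMap_id] at h1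
  obtain rfl := Spec_map_ofHom_inj h1
  refine ⟨v, hv, ?_⟩
  rw [point, ← h, Category.assoc, Iso.hom_inv_id_assoc, pullback.lift_fst]

theorem point_eq_point_iff {v w : Fin 3 → L} (hv : v ≠ 0) (hw : w ≠ 0) :
    T.point v = T.point w ↔ ∃ c : L, w = c • v := by
  rw [← ProjSpace.point_eq_point_iff (RingHom.id L) hv hw]
  refine ⟨fun h => ?_, fun h => by rw [point, point, h]⟩
  rw [← cancel_mono T.iso.inv]
  refine pullback.hom_ext ?_ ?_
  · simpa [point] using h
  · simp only [Category.assoc, T.iso_inv_snd, ProjSpace.point_toSpec]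

/-- The automorphism of the base change of `S` induced by an automorphism of `L` over `K`. -/
def twist (π : S ⟶ Spec (CommRingCat.of K)) (σ : L ≃ₐ[K] L) :
    pullback π (specMap K L) ⟶ pullback π (specMap K L) :=
  pullback.lift (pullback.fst _ _) (pullback.snd _ _ ≫ autSpec σ) (by
    rw [pullback.condition, Category.assoc, autSpec_comp_specMap])

theorem twist_fst (σ : L ≃ₐ[K] L) : twist π σ ≫ pullback.fst _ _ = pullback.fst _ _ :=
  pullback.lift_fst _ _ _

theorem twist_snd (σ : L ≃ₐ[K] L) : twist π σ ≫ pullback.snd _ _ =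
    pullback.snd _ _ ≫ autSpec σ :=
  pullback.lift_snd _ _ _

theorem twist_comp_twist (σ τ : L ≃ₐ[K] L) : twist π σ ≫ twist π τ = twist π (σ * τ) := by
  refine pullback.hom_ext ?_ ?_
  · rw [Category.assoc, twist_fst, twist_fst, twist_fst]
  · rw [Category.assoc, twist_snd, reassoc_of% twist_snd σ, twist_snd, autSpec_comp_autSpec]

theorem twist_one : twist π (1 : L ≃ₐ[K] L) = 𝟙 _ := by
  refine pullback.hom_ext ?_ ?_
  · rw [twist_fst, Category.id_comp]
  · rw [twist_snd, autSpec_one, Category.id_comp, Category.comp_id]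

/-- `twist` as an isomorphism. -/
def twistIso (π : S ⟶ Spec (CommRingCat.of K)) (σ : L ≃ₐ[K] L) :
    pullback π (specMap K L) ≅ pullback π (specMap K L) where
  hom := twist π σ
  inv := twist π σ⁻¹
  hom_inv_id := by rw [twist_comp_twist, mul_inv_cancel, twist_one]
  inv_hom_id := by rw [twist_comp_twist, inv_mul_cancel, twist_one]

theorem exists_matrix [IsAlgClosed L] (σ : L ≃ₐ[K] L) :
    ∃ N : Matrix (Fin 3) (Fin 3) L, N.det ≠ 0 ∧ ∀ v, v ≠ 0 →
      autSpec σ ≫ T.point v = T.point (N.mulVec (σ ∘ v)) := by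
  -- The inverse is needed because `ProjSpace.exists_matrix` moves coordinates by the inverse of its
  -- automorphism; `twist` disappears after projection to S.
  obtain ⟨N, hN, H⟩ := ProjSpace.exists_matrix ((σ⁻¹ : L ≃ₐ[K] L) : L ≃+* L)
    (T.iso.symm ≪≫ twistIso π σ⁻¹ ≪≫ T.iso) (by
      simp only [Iso.trans_hom, Iso.symm_hom, Category.assoc, T.iso_hom_toSpec, twistIso,
        twist_snd, reassoc_of% T.iso_inv_snd]
      rfl)
  refine ⟨N, hN, fun v hv => ?_⟩
  have h1 := congrArg (fun f => autSpec σ ≫ f ≫ T.iso.inv ≫ pullback.fst π (specMap K L)) (H v hv)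
  simp only [Iso.trans_hom, Iso.symm_hom, Category.assoc, Iso.hom_inv_id_assoc, twistIso,
    twist_fst] at h1
  rw [point, h1]
  change autSpec σ ≫ autSpec σ⁻¹ ≫ _ = _
  rw [← Category.assoc, autSpec_comp_autSpec, mul_inv_cancel, autSpec_one, Category.id_comp]
  rfl

/-- In an affine neighbourhood the point is a homomorphism from a finitely generated algebra. The
images of the generators generate a finite extension E, and σ fixing E fixes the point. -/
theorem exists_fixingSubgroup [LocallyOfFiniteType π] [Algebra.IsAlgebraic K L]
    {g : Spec (CommRingCat.of L) ⟶ S} (hg : g ∈ points π L) :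
    ∃ E : IntermediateField K L, FiniteDimensional K E ∧
      ∀ σ ∈ E.fixingSubgroup, autSpec σ ≫ g = g := by
  obtain ⟨U, hU, hxU, -⟩ := exists_isAffineOpen_mem_and_subset (U := ⊤) (x := g (specPt L)) trivial
  have hr : Set.range g ⊆ Set.range hU.fromSpec := by
    rintro _ ⟨x, rfl⟩
    rw [Subsingleton.elim x (specPt L), hU.range_fromSpec]
    exact hxU
  obtain ⟨φ, hφ⟩ := Spec.map_surjective (IsOpenImmersion.lift hU.fromSpec g hr)
  have hφg : Spec.map φ ≫ hU.fromSpec = g := by rw [hφ, IsOpenImmersion.lift_fac]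
  obtain ⟨ψ, hψ⟩ := Spec.map_surjective (hU.fromSpec ≫ π)
  have hft : ψ.hom.FiniteType := by
    rw [← HasRingHomProperty.Spec_iff (P := @LocallyOfFiniteType), hψ]
    infer_instance
  have hψφ : φ.hom.comp ψ.hom = algebraMap K L := by
    have h1 : g ≫ π = specMap K L := hg
    rw [← hφg, Category.assoc, ← hψ, ← Spec.map_comp, Spec.map_inj] at h1
    exact congrArg CommRingCat.Hom.hom h1
  algebraize [ψ.hom]
  obtain ⟨s, hs⟩ := hft.1
  let φ' : Γ(S, U) →ₐ[K] L := { φ.hom with commutes' := fun r => DFunLike.congr_fun hψφ r }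
  refine ⟨IntermediateField.adjoin K (φ' '' s), ?_, fun σ hσ => ?_⟩
  · have : Finite (φ' '' (s : Set Γ(S, U))) := (s.finite_toSet.image _).to_subtype
    exact IntermediateField.finiteDimensional_adjoin fun x _ => Algebra.IsIntegral.isIntegral x
  · have h1 : ((σ : L →ₐ[K] L).comp φ') = φ' := by
      refine AlgHom.ext_of_adjoin_eq_top hs fun x hx => ?_
      exact (IntermediateField.mem_fixingSubgroup_iff _ _).1 hσ _
        (IntermediateField.subset_adjoin K _ ⟨x, hx, rfl⟩)
    rw [← hφg, autSpec, ← Spec.map_comp_assoc]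
    congr 2
    ext x
    exact DFunLike.congr_fun h1 x

theorem exists_isProjectiveCocycle [LocallyOfFiniteType π] [Algebra.IsAlgebraic K L]
    [IsAlgClosed L] :
    ∃ N : (L ≃ₐ[K] L) → Matrix (Fin 3) (Fin 3) L, IsProjectiveCocycle N ∧
      ∀ σ v, v ≠ 0 → autSpec σ ≫ T.point v = T.point ((N σ).mulVec (σ ∘ v)) := by
  choose N hN H using T.exists_matrix
  have h0 : ∀ σ v, v ≠ 0 → (N σ).mulVec (σ ∘ v) ≠ 0 := fun σ v hv h =>
    comp_ne_zero (σ : L ≃+* L) hv (Matrix.eq_zero_of_mulVec_eq_zero (hN σ) h)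
  refine ⟨N, ⟨hN, fun σ τ => ?_, fun v hv => ?_⟩, H⟩
  · refine exists_eq_smul_of_forall_mulVec (hN _) fun w hw => ?_
    set v := (σ * τ).symm ∘ w
    have hv : v ≠ 0 := comp_ne_zero ((σ * τ).symm : L ≃+* L) hw
    have hvw : (σ * τ) ∘ v = w := by funext i; simp [v]
    have h1 := H (σ * τ) v hv
    rw [← autSpec_comp_autSpec, Category.assoc, H τ v hv, H σ _ (h0 τ v hv), eq_comm,
      T.point_eq_point_iff (h0 _ v hv) (h0 _ _ (h0 τ v hv)), hvw] at h1
    obtain ⟨c, hc⟩ := h1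
    refine ⟨c, ?_⟩
    rw [← hc, map_mulVec_comp, Matrix.mulVec_mulVec, show σ ∘ τ ∘ v = w from hvw]
  · obtain ⟨E, hE, h⟩ := exists_fixingSubgroup (T.point_mem v)
    refine ⟨E, hE, fun σ hσ => ?_⟩
    have h1 := h σ hσ
    rw [H σ v hv, eq_comm, T.point_eq_point_iff hv (h0 σ v hv)] at h1
    exact h1

end Trivialization

end

end SeveriBrauer

namespace SeveriBrauer

noncomputable section

attribute [local instance] MvPolynomial.gradedAlgebra

open HomogeneousLocalization

/-! ### Morphisms of projective spaces given by matrices -/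

section ProjMap

variable {n : ℕ} {R R' : Type u} [CommRing R] [CommRing R']

/-- The homomorphism of graded rings `R[X₀, …, Xₙ] → R'[X₀, …, Xₙ]` that substitutes for the
variables the linear forms given by the rows of a matrix. -/
def substHom (φ : R →+* R') (P : Matrix (Fin (n + 1)) (Fin (n + 1)) R') :
    GradedRingHom (grading n R) (grading n R') where
  toRingHom := MvPolynomial.eval₂Hom (MvPolynomial.C.comp φ)
    fun j => ∑ k, MvPolynomial.C (P j k) * MvPolynomial.X k
  map_mem {m x} hx := by
    have := MvPolynomial.IsHomogeneous.eval₂ (n := 1) hx (MvPolynomial.C.comp φ)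
      (fun j => ∑ k, MvPolynomial.C (P j k) * MvPolynomial.X k)
      (fun r => MvPolynomial.isHomogeneous_C _ _)
      (fun j => MvPolynomial.IsHomogeneous.sum _ _ _ fun k _ => by
        simpa using (MvPolynomial.isHomogeneous_C _ _).mul (MvPolynomial.isHomogeneous_X R' k))
    rwa [one_mul] at this

theorem substHom_C (φ : R →+* R') (P : Matrix (Fin (n + 1)) (Fin (n + 1)) R') (r : R) :
    substHom φ P (MvPolynomial.C r) = MvPolynomial.C (φ r) :=
  MvPolynomial.eval₂_C _ _ _

theorem substHom_X (φ : R →+* R') (P : Matrix (Fin (n + 1)) (Fin (n + 1)) R') (j : Fin (n + 1)) :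
    substHom φ P (MvPolynomial.X j) = ∑ k, MvPolynomial.C (P j k) * MvPolynomial.X k :=
  MvPolynomial.eval₂_X _ _ _

/-- The left inverse Q expresses each variable through the substituted linear forms, so these have
no common zero and `Proj.map` is defined everywhere. -/
theorem irrelevant_le_map_substHom (φ : R →+* R') {P Q : Matrix (Fin (n + 1)) (Fin (n + 1)) R'}
    (h : Q * P = 1) :
    HomogeneousIdeal.irrelevant (grading n R') ≤
      (HomogeneousIdeal.irrelevant (grading n R)).map (substHom φ P) := by
  change (HomogeneousIdeal.irrelevant (grading n R')).toIdeal ≤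
    ((HomogeneousIdeal.irrelevant (grading n R)).map (substHom φ P)).toIdeal
  refine irrelevant_le_span_X.trans (Ideal.span_le.2 ?_)
  rintro _ ⟨k, rfl⟩
  have h1 : (MvPolynomial.X k : MvPolynomial (Fin (n + 1)) R') =
      ∑ j, MvPolynomial.C (Q k j) * substHom φ P (MvPolynomial.X j) := by
    simp only [substHom_X, Finset.mul_sum, ← mul_assoc, ← MvPolynomial.C_mul]
    rw [Finset.sum_comm]
    simp only [← Finset.sum_mul, ← map_sum]
    simp only [← Matrix.mul_apply, h]
    simp [Matrix.one_apply]
  simp only [SetLike.mem_coe]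
  rw [h1]
  refine Ideal.sum_mem _ fun j _ => Ideal.mul_mem_left _ _ ?_
  exact Ideal.mem_map_of_mem _ (HomogeneousIdeal.mem_irrelevant_of_mem _ one_pos (X_mem_grading j))

/-- The morphism of projective spaces given by an invertible matrix and a homomorphism of
the base rings. -/
def projMap (φ : R →+* R') {P Q : Matrix (Fin (n + 1)) (Fin (n + 1)) R'} (h : Q * P = 1) :
    ProjSpace n R' ⟶ ProjSpace n R :=
  Proj.map (substHom φ P) (irrelevant_le_map_substHom φ h)

theorem eval_substHom {B : Type*} [CommRing B] (φ : R →+* R')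
    (P : Matrix (Fin (n + 1)) (Fin (n + 1)) R') (φ' : R' →+* B) (w : Fin (n + 1) → B) :
    (MvPolynomial.eval₂Hom φ' w).comp (substHom φ P).toRingHom =
      MvPolynomial.eval₂Hom (φ'.comp φ) ((P.map φ').mulVec w) := by
  refine MvPolynomial.ringHom_ext (fun r => ?_) fun j => ?_
  · change MvPolynomial.eval₂Hom φ' w (substHom φ P (MvPolynomial.C r)) = _
    simp [substHom_C]
  · change MvPolynomial.eval₂Hom φ' w (substHom φ P (MvPolynomial.X j)) = _
    simp [substHom_X, Matrix.mulVec, dotProduct]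

theorem toRingHom_substHom (φ : R →+* R') (P : Matrix (Fin (n + 1)) (Fin (n + 1)) R') :
    (substHom φ P).toRingHom = MvPolynomial.eval₂Hom (MvPolynomial.C.comp φ)
      ((P.map MvPolynomial.C).mulVec MvPolynomial.X) := rfl

theorem substHom_comp {P Q : Matrix (Fin (n + 1)) (Fin (n + 1)) R} (h' : P * Q = 1) :
    (substHom (RingHom.id R) Q).comp (substHom (RingHom.id R) P) =
      GradedRingHom.id (grading n R) := by
  have h1 : (substHom (RingHom.id R) Q).toRingHom.comp (substHom (RingHom.id R) P).toRingHom =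
      RingHom.id _ := by
    rw [toRingHom_substHom (RingHom.id R) Q, eval_substHom, Matrix.mulVec_mulVec]
    have : P.map (MvPolynomial.C.comp (RingHom.id R)) *
        (Q.map MvPolynomial.C : Matrix _ _ (MvPolynomial (Fin (n + 1)) R)) = 1 := by
      rw [RingHom.comp_id, ← Matrix.map_mul, h']
      exact Matrix.map_one _ (map_zero _) (map_one _)
    rw [this, Matrix.one_mulVec]
    refine MvPolynomial.ringHom_ext (fun r => ?_) fun j => ?_ <;> simp
  exact GradedRingHom.ext fun x => DFunLike.congr_fun h1 x

theorem projMap_comp_projMap {P Q : Matrix (Fin (n + 1)) (Fin (n + 1)) R} (h : Q * P = 1)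
    (h' : P * Q = 1) : projMap (RingHom.id R) h' ≫ projMap (RingHom.id R) h = 𝟙 _ := by
  have key : ∀ (f : GradedRingHom (grading n R) (grading n R)) (hf), f = GradedRingHom.id _ →
      Proj.map f hf = 𝟙 _ := by
    rintro _ hf rfl
    exact Proj.map_id
  exact (Proj.map_comp (substHom (RingHom.id R) P) (substHom (RingHom.id R) Q)
    (irrelevant_le_map_substHom _ h) (irrelevant_le_map_substHom _ h')).symm.trans
      (key _ _ (substHom_comp h'))

/-- The automorphism of projective space given by an invertible matrix. -/
def projIso {P Q : Matrix (Fin (n + 1)) (Fin (n + 1)) R} (h : Q * P = 1) (h' : P * Q = 1) :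
    ProjSpace n R ≅ ProjSpace n R where
  hom := projMap (RingHom.id R) h
  inv := projMap (RingHom.id R) h'
  hom_inv_id := projMap_comp_projMap h' h
  inv_hom_id := projMap_comp_projMap h h'

theorem chart_comp_projMap (φ : R →+* R') {P Q : Matrix (Fin (n + 1)) (Fin (n + 1)) R'}
    (h : Q * P = 1) {s : MvPolynomial (Fin (n + 1)) R} {m : ℕ} (hs : s ∈ grading n R m)
    (hm : 0 < m) :
    ProjSpace.chart ((substHom φ P).map_mem hs) hm ≫ projMap φ h =
      Spec.map (CommRingCat.ofHom (Away.map (substHom φ P) s)) ≫ ProjSpace.chart hs hm :=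
  Proj.awayι_comp_map (substHom φ P) (irrelevant_le_map_substHom φ h) hm s hs

theorem chartPoint_comp_projMap {B : Type u} [CommRing B] (φ : R →+* R')
    {P Q : Matrix (Fin (n + 1)) (Fin (n + 1)) R'} (h : Q * P = 1)
    (g : MvPolynomial (Fin (n + 1)) R' →+* B) {s : MvPolynomial (Fin (n + 1)) R} {m m' : ℕ}
    (hs : s ∈ grading n R m) (hm : 0 < m) (hu : IsUnit (g (substHom φ P s)))
    {s' : MvPolynomial (Fin (n + 1)) R'} (hs' : s' ∈ grading n R' m') (hm' : 0 < m')
    (hu' : IsUnit (g s')) :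
    ProjSpace.chartPoint g hs' hm' hu' ≫ projMap φ h =
      ProjSpace.chartPoint (g.comp (substHom φ P).toRingHom) hs hm hu := by
  rw [ProjSpace.chartPoint_eq g hs' hm' hu' ((substHom φ P).map_mem hs) hm hu,
    ProjSpace.chartPoint, Category.assoc]
  erw [chart_comp_projMap φ h hs hm]
  rw [ProjSpace.chartPoint, ← Spec.map_comp_assoc, ← CommRingCat.ofHom_comp]
  congr 3
  refine away_hom_ext hs fun k x hx => ?_
  rw [RingHom.comp_apply, Away.map_mk]
  have h2 := liftAway_mk_mul g hu ((substHom φ P).map_mem hs) k (substHom φ P x)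
    ((substHom φ P).map_mem hx)
  have h3 := liftAway_mk_mul (g.comp (substHom φ P).toRingHom) hu hs k x hx
  refine (hu.pow k).mul_right_cancel ?_
  rw [h2]
  exact h3.symm

theorem point_comp_projMap {B : Type u} [Field B] (φ : R →+* R')
    {P Q : Matrix (Fin (n + 1)) (Fin (n + 1)) R'} (h : Q * P = 1) (φ' : R' →+* B)
    {w : Fin (n + 1) → B} (hw : w ≠ 0) :
    ProjSpace.point φ' w ≫ projMap φ h =
      ProjSpace.point (φ'.comp φ) ((P.map φ').mulVec w) := by
  have h0 : (P.map φ').mulVec w ≠ 0 := by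
    intro h1
    refine hw ?_
    have h2 : (Q.map φ') * (P.map φ') = 1 := by
      rw [← Matrix.map_mul, h]
      simp
    rw [← Matrix.one_mulVec w, ← h2, ← Matrix.mulVec_mulVec, h1, Matrix.mulVec_zero]
  obtain ⟨i, hi⟩ := Function.ne_iff.1 h0
  obtain ⟨j, hj⟩ := Function.ne_iff.1 hw
  have hi' : IsUnit (((MvPolynomial.eval₂Hom φ' w).comp (substHom φ P).toRingHom)
      (MvPolynomial.X i)) := by
    rw [eval_substHom]
    simpa using hi
  rw [ProjSpace.point_eq_chartPoint_X φ' j hj, ProjSpace.point_eq_chartPoint_X _ i hi,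
    chartPoint_comp_projMap φ h _ (X_mem_grading i) one_pos hi']
  congr 1
  exact eval_substHom φ P φ' w

theorem chart_X_eq_chartPoint (i : Fin (n + 1)) :
    ∃ hu, ProjSpace.chart (R := R) (X_mem_grading i) one_pos =
      ProjSpace.chartPoint (toAway i) (X_mem_grading i) one_pos hu := by
  obtain ⟨hu, h⟩ := ProjSpace.SpecMap_comp_chart_X (R := R) i (RingHom.id _)
  refine ⟨hu, ?_⟩
  have h1 : Spec.map (CommRingCat.ofHom (RingHom.id
    (Away (grading n R) (MvPolynomial.X i : MvPolynomial _ R)))) = 𝟙 _ := Spec.map_id _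
  rw [h1, Category.id_comp] at h
  exact h

theorem map_awayC (φ : R →+* R') (P : Matrix (Fin (n + 1)) (Fin (n + 1)) R')
    (s : MvPolynomial (Fin (n + 1)) R) (r : R) :
    Away.map (substHom φ P) s (awayC s r) = awayC (substHom φ P s) (φ r) := by
  ext
  rw [val_awayC]
  change (Localization.mk (substHom φ P (MvPolynomial.C r)) ⟨substHom φ P 1, _⟩) = _
  rw [substHom_C]
  have : (⟨substHom φ P 1, ⟨0, by simp⟩⟩ : Submonoid.powers (substHom φ P s)) = 1 :=
    Subtype.ext (map_one _)
  rw [this, Localization.mk_one_eq_algebraMap]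

theorem projMap_toSpec (φ : R →+* R') {P Q : Matrix (Fin (n + 1)) (Fin (n + 1)) R'}
    (h : Q * P = 1) : projMap φ h ≫ ProjSpace.toSpec n R =
      ProjSpace.toSpec n R' ≫ Spec.map (CommRingCat.ofHom φ) := by
  have key : ∀ {s : MvPolynomial (Fin (n + 1)) R} {m : ℕ} (hs : s ∈ grading n R m) (hm : 0 < m),
      ProjSpace.chart ((substHom φ P).map_mem hs) hm ≫ projMap φ h ≫ ProjSpace.toSpec n R =
        ProjSpace.chart ((substHom φ P).map_mem hs) hm ≫ ProjSpace.toSpec n R' ≫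
          Spec.map (CommRingCat.ofHom φ) := by
    intro s m hs hm
    rw [← Category.assoc, chart_comp_projMap φ h hs hm, Category.assoc, ProjSpace.chart_toSpec,
      ← Category.assoc, ProjSpace.chart_toSpec, ← Spec.map_comp, ← Spec.map_comp,
      ← CommRingCat.ofHom_comp, ← CommRingCat.ofHom_comp]
    congr 2
    ext r
    exact congrArg _ (map_awayC φ P s r)
  refine (Proj.mapAffineOpenCover (substHom φ P)
    (irrelevant_le_map_substHom φ h)).openCover.hom_ext _ _ fun s => ?_
  exact key s.2.2 s.1.2

end ProjMap

end

end SeveriBrauer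

namespace SeveriBrauer

noncomputable section

attribute [local instance] MvPolynomial.gradedAlgebra

open HomogeneousLocalization

/-! ### Base change of projective space -/

section BaseChange

variable (n : ℕ) (R R' : Type u) [CommRing R] [CommRing R'] [Algebra R R']

/-- The morphism `ℙⁿ_{R'} ⟶ ℙⁿ_R` for an `R`-algebra `R'`. -/
def projBaseChange : ProjSpace n R' ⟶ ProjSpace n R :=
  projMap (algebraMap R R') (P := 1) (Q := 1) (one_mul 1)

theorem projBaseChange_toSpec : projBaseChange n R R' ≫ ProjSpace.toSpec n R =
    ProjSpace.toSpec n R' ≫ Spec.map (CommRingCat.ofHom (algebraMap R R')) :=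
  projMap_toSpec _ _

variable {n}

theorem substHom_one_X (i : Fin (n + 1)) :
    substHom (algebraMap R R') 1 (MvPolynomial.X i) = MvPolynomial.X i := by
  rw [substHom_X]
  simp [Matrix.one_apply]

/-- The homomorphism of the rings of the charts `Xᵢ ≠ 0` given by an algebra. -/
def awayBaseChange (i : Fin (n + 1)) : Away (grading n R) (MvPolynomial.X i : MvPolynomial _ R) →+*
    Away (grading n R') (MvPolynomial.X i : MvPolynomial _ R') :=
  liftAway ((toAway i).comp (substHom (algebraMap R R') 1).toRingHom) (by
    change IsUnit (toAway i (substHom (algebraMap R R') 1 (MvPolynomial.X i)))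
    rw [substHom_one_X, toAway_X, coord_self]
    exact isUnit_one)

theorem chart_comp_projBaseChange (i : Fin (n + 1)) :
    ProjSpace.chart (R := R') (X_mem_grading i) one_pos ≫ projBaseChange n R R' =
      Spec.map (CommRingCat.ofHom (awayBaseChange R R' i)) ≫
        ProjSpace.chart (R := R) (X_mem_grading i) one_pos := by
  obtain ⟨hu, h⟩ := chart_X_eq_chartPoint (R := R') i
  rw [h, projBaseChange, chartPoint_comp_projMap (algebraMap R R') (one_mul 1) _ (X_mem_grading i)
    one_pos (by rw [substHom_one_X, toAway_X, coord_self]; exact isUnit_one)]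
  rfl

theorem awayBaseChange_awayEquiv (i : Fin (n + 1))
    (x : MvPolynomial {j : Fin (n + 1) // j ≠ i} R) :
    awayBaseChange R R' i (awayEquiv i x) =
      awayEquiv i (MvPolynomial.map (algebraMap R R') x) := by
  have : (awayBaseChange R R' i).comp (awayEquiv i).toRingHom =
      (awayEquiv i).toRingHom.comp (MvPolynomial.map (algebraMap R R')) := by
    refine MvPolynomial.ringHom_ext (fun r => ?_) fun j => ?_
    · change awayBaseChange R R' i (awayEquiv i (MvPolynomial.C r)) =
        awayEquiv i (MvPolynomial.map _ (MvPolynomial.C r))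
      rw [awayEquiv_C, MvPolynomial.map_C, awayEquiv_C, awayBaseChange, liftAway_awayC]
      change toAway i (substHom _ 1 (MvPolynomial.C r)) = _
      rw [substHom_C, toAway_C]
    · change awayBaseChange R R' i (awayEquiv i (MvPolynomial.X j)) =
        awayEquiv i (MvPolynomial.map _ (MvPolynomial.X j))
      rw [awayEquiv_X, MvPolynomial.map_X, awayEquiv_X, awayBaseChange]
      have hu : IsUnit (toAway i (substHom (algebraMap R R') 1 (MvPolynomial.X i))) := by
        rw [substHom_one_X, toAway_X, coord_self]
        exact isUnit_one
      have := liftAway_coord_mul ((toAway i).comp (substHom (algebraMap R R') 1).toRingHom) hu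
        (j : Fin (n + 1))
      change _ * toAway i (substHom (algebraMap R R') 1 (MvPolynomial.X i)) =
        toAway i (substHom (algebraMap R R') 1 (MvPolynomial.X _)) at this
      rwa [substHom_one_X, substHom_one_X, toAway_X, toAway_X, coord_self, mul_one] at this
  exact DFunLike.congr_fun this x

attribute [local instance] MvPolynomial.algebraMvPolynomial

theorem isPushout_awayC (i : Fin (n + 1)) :
    IsPushout (CommRingCat.ofHom (awayC (R := R) (MvPolynomial.X i : MvPolynomial (Fin (n + 1)) R)))
      (CommRingCat.ofHom (algebraMap R R')) (CommRingCat.ofHom (awayBaseChange R R' i))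
      (CommRingCat.ofHom (awayC (R := R') (MvPolynomial.X i : MvPolynomial (Fin (n + 1)) R'))) := by
  have h := CommRingCat.isPushout_of_isPushout R (MvPolynomial {j : Fin (n + 1) // j ≠ i} R) R'
    (MvPolynomial {j : Fin (n + 1) // j ≠ i} R')
  refine h.of_iso (Iso.refl _) (awayEquiv i).toCommRingCatIso (Iso.refl _)
    (awayEquiv i).toCommRingCatIso ?_ ?_ ?_ ?_
  · exact CommRingCat.hom_ext (RingHom.ext fun r => awayEquiv_C i r)
  · simp
  · exact CommRingCat.hom_ext (RingHom.ext fun x => (awayBaseChange_awayEquiv R R' i x).symm)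
  · exact CommRingCat.hom_ext (RingHom.ext fun r => awayEquiv_C i r)

theorem preimage_basicOpen_projBaseChange (i : Fin (n + 1)) :
    projBaseChange n R R' ⁻¹ᵁ (ProjSpace.chart (R := R) (X_mem_grading i) one_pos).opensRange =
      (ProjSpace.chart (R := R') (X_mem_grading i) one_pos).opensRange := by
  rw [ProjSpace.opensRange_chart, ProjSpace.opensRange_chart, ← substHom_one_X R R' i]
  rfl

theorem isPullback_chart (i : Fin (n + 1)) :
    IsPullback (Spec.map (CommRingCat.ofHom (awayBaseChange R R' i)))
      (ProjSpace.chart (R := R') (X_mem_grading i) one_pos)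
      (ProjSpace.chart (R := R) (X_mem_grading i) one_pos) (projBaseChange n R R') :=
  IsOpenImmersion.isPullback _ _ _ _ (chart_comp_projBaseChange R R' i)
    (preimage_basicOpen_projBaseChange R R' i)

/-- The charts `Xᵢ ≠ 0` cover projective space. -/
def chartCover (n : ℕ) (R : Type u) [CommRing R] : (ProjSpace n R).OpenCover :=
  (Proj.affineOpenCoverOfIrrelevantLESpan (grading n R)
    (fun i => (MvPolynomial.X i : MvPolynomial (Fin (n + 1)) R)) (m := fun _ => 1)
    X_mem_grading (fun _ => one_pos) irrelevant_le_span_X).openCover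

/-- Whether the comparison with the fibre product is an isomorphism can be tested on the standard
charts, where it is base change of polynomial rings (`isPushout_awayC`). -/
theorem isPullback_projBaseChange (n : ℕ) :
    IsPullback (projBaseChange n R R') (ProjSpace.toSpec n R') (ProjSpace.toSpec n R)
      (Spec.map (CommRingCat.ofHom (algebraMap R R'))) := by
  set φ := Spec.map (CommRingCat.ofHom (algebraMap R R'))
  set m : ProjSpace n R' ⟶ pullback (ProjSpace.toSpec n R) φ :=
    pullback.lift _ _ (projBaseChange_toSpec n R R') with hm
  have hmf : m ≫ pullback.fst _ _ = projBaseChange n R R' := pullback.lift_fst _ _ _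
  have hms : m ≫ pullback.snd _ _ = ProjSpace.toSpec n R' := pullback.lift_snd _ _ _
  suffices h : IsIso m from
    IsPullback.of_iso_pullback ⟨projBaseChange_toSpec n R R'⟩ (asIso m) hmf hms
  suffices h : MorphismProperty.isomorphisms Scheme.{u} m from h
  have key : ∀ i : Fin (n + 1), IsIso (pullback.snd m (pullback.fst (pullback.fst
      (ProjSpace.toSpec n R) φ) (ProjSpace.chart (R := R) (X_mem_grading i) one_pos))) := by
    intro i
    set c := ProjSpace.chart (n := n) (R := R) (X_mem_grading i) one_pos
    set p := pullback.fst (pullback.fst (ProjSpace.toSpec n R) φ) c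
    set q := pullback.snd (pullback.fst (ProjSpace.toSpec n R) φ) c
    have hB : IsPullback q p c (pullback.fst (ProjSpace.toSpec n R) φ) :=
      (IsPullback.of_hasPullback _ _).flip
    have hW : IsPullback q (p ≫ pullback.snd _ _) (c ≫ ProjSpace.toSpec n R) φ :=
      hB.paste_vert (IsPullback.of_hasPullback _ _)
    rw [ProjSpace.chart_toSpec] at hW
    have hC := isPullback_SpecMap_of_isPushout _ _ _ _ (isPushout_awayC (n := n) R R' i)
    set k := hW.lift _ _ hC.w
    have hk1 : k ≫ q = _ := hW.lift_fst _ _ hC.w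
    have hk2 : k ≫ p ≫ pullback.snd _ _ = _ := hW.lift_snd _ _ hC.w
    have hk : IsIso k := by
      have : k = (hC.isoIsPullback _ _ hW).hom :=
        hW.hom_ext (by rw [hk1]; simp) (by rw [hk2]; simp)
      rw [this]
      infer_instance
    have hkp : k ≫ p = ProjSpace.chart (n := n) (R := R') (X_mem_grading i) one_pos ≫ m := by
      refine pullback.hom_ext ?_ ?_
      · rw [Category.assoc, Category.assoc, hmf, chart_comp_projBaseChange, ← hk1, Category.assoc,
          hB.w]
      · rw [Category.assoc, Category.assoc, hms, hk2, ProjSpace.chart_toSpec]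
    have hA : IsPullback k (ProjSpace.chart (n := n) (R := R') (X_mem_grading i) one_pos) p m := by
      refine IsPullback.of_right ?_ hkp hB
      rw [hk1, hmf]
      exact isPullback_chart R R' i
    rw [← hA.flip.isoPullback_inv_snd]
    infer_instance
  exact IsZariskiLocalAtTarget.of_openCover (P := MorphismProperty.isomorphisms Scheme.{u})
    (𝒰 := (chartCover n R).pullback₁ (pullback.fst (ProjSpace.toSpec n R) φ)) key

end BaseChange

/-! ### Reducedness -/

section Field

variable (n : ℕ) (L : Type u) [Field L]

instance : IsReduced (ProjSpace n L) := by
  have key : ∀ i, IsReduced ((chartCover n L).X i) := fun (i : Fin (n + 1)) => by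
    have : _root_.IsReduced (Away (grading n L) (MvPolynomial.X i : MvPolynomial _ L)) :=
      isReduced_of_injective (awayEquiv i).symm (awayEquiv i).symm.injective
    exact inferInstanceAs (IsReduced (Spec (CommRingCat.of
      (Away (grading n L) (MvPolynomial.X i : MvPolynomial _ L)))))
  have : ∀ x, IsReduced ((Scheme.Cover.ulift (chartCover n L)).X x) := fun x => key _
  exact IsReduced.of_openCover _ (Scheme.Cover.ulift (chartCover n L))

end Field

open TensorProduct in
theorem isReduced_tensorProduct_of_perfectField (K L F : Type*) [Field K] [PerfectField K] [Field L]
    [Algebra K L] [Algebra.IsAlgebraic K L] [Field F] [Algebra K F] :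
    _root_.IsReduced (F ⊗[K] L) := by
  -- Reducedness is tested on the finitely generated subalgebras of L. These are finite separable
  -- extensions of K, hence unramified, and remain so over F.
  refine IsReduced.tensorProduct_of_flat_of_forall_fg fun B hB => ?_
  obtain ⟨E, rfl⟩ : ∃ E : IntermediateField K L, E.toSubalgebra = B :=
    ⟨Subalgebra.toIntermediateField' B (Subalgebra.isField_of_algebraic B), rfl⟩
  have : Algebra.FiniteType K E := (Subalgebra.fg_iff_finiteType _).1 hB
  have : Algebra.FormallyUnramified K E := Algebra.FormallyUnramified.of_isSeparable K E
  exact Algebra.FormallyUnramified.isReduced_of_field F (F ⊗[K] E)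

theorem geometricallyReduced_specMap (K L : Type u) [Field K] [PerfectField K] [Field L]
    [Algebra K L] [Algebra.IsAlgebraic K L] : GeometricallyReduced (specMap K L) := by
  refine ⟨(geometrically_iff_of_isClosedUnderIsomorphisms).2 fun F _ y => ?_⟩
  obtain ⟨ψ, rfl⟩ := Spec.map_surjective y
  let _ : Algebra K F := ψ.hom.toAlgebra
  have h := isReduced_tensorProduct_of_perfectField K L F
  have h' : _root_.IsReduced (TensorProduct K L F) :=
    isReduced_of_injective (Algebra.TensorProduct.comm K L F)
      (Algebra.TensorProduct.comm K L F).injective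
  have h2 : IsReduced (Spec (CommRingCat.of (TensorProduct K L F))) := inferInstance
  exact isReduced_of_isOpenImmersion (pullbackSpecIso K L F).hom

end

end SeveriBrauer

/-! ### Descent of the trivialization to K -/

namespace SeveriBrauer

noncomputable section

/-- Two embeddings of a normal extension in a field differ by an automorphism. -/
theorem exists_algEquiv_comp_eq {K L F : Type u} [Field K] [Field L] [Algebra K L] [Normal K L]
    [Field F] (i j : L →+* F) (h : i.comp (algebraMap K L) = j.comp (algebraMap K L)) :
    ∃ σ : L ≃ₐ[K] L, ∀ x, i (σ x) = j x := by
  algebraize [i.comp (algebraMap K L), i]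
  let j' : L →ₐ[K] F := { j with commutes' := fun r => (DFunLike.congr_fun h r).symm }
  obtain ⟨σ, hσ⟩ := (Normal.algHomEquivAut K F L).symm.surjective j'
  exact ⟨σ, fun x => DFunLike.congr_fun hσ x⟩

namespace Trivialization

variable {K : Type u} [Field K] {S : Scheme.{u}} {π : S ⟶ Spec (CommRingCat.of K)}
    {L : Type u} [Field L] [Algebra K L] (T : Trivialization π L)

/-- The change of a trivialization by an invertible matrix. -/
def changeFrame {P Q : Matrix (Fin 3) (Fin 3) L} (h : Q * P = 1) (h' : P * Q = 1) :
    Trivialization π L where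
  iso := T.iso ≪≫ (projIso h h').symm
  iso_hom_toSpec := by
    have h1 : (projIso h h').inv ≫ ProjSpace.toSpec 2 L = ProjSpace.toSpec 2 L := by
      have := projMap_toSpec (RingHom.id L) h'
      rw [SpecMap_id, Category.comp_id] at this
      exact this
    rw [Iso.trans_hom, Iso.symm_hom, Category.assoc, h1, T.iso_hom_toSpec]

theorem changeFrame_point {P Q : Matrix (Fin 3) (Fin 3) L} (h : Q * P = 1) (h' : P * Q = 1)
    {v : Fin 3 → L} (hv : v ≠ 0) : (T.changeFrame h h').point v = T.point (P.mulVec v) := by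
  have h1 := point_comp_projMap (RingHom.id L) h (RingHom.id L) hv
  rw [RingHom.comp_id] at h1
  have h2 : P.map (RingHom.id L) = P := Matrix.ext fun _ _ => rfl
  rw [h2] at h1
  change _ ≫ ((projIso h h').hom ≫ T.iso.inv) ≫ _ = _
  rw [point, Category.assoc, ← h1, Category.assoc]
  rfl

/-- Two such maps differ only in how they embed L in F over K, and for a normal extension two
embeddings differ by an automorphism. -/
theorem exists_eq_twist {F : Type u} [Field F] [Normal K L]
    {a b : Spec (CommRingCat.of F) ⟶ pullback π (specMap K L)}
    (h : a ≫ pullback.fst _ _ = b ≫ pullback.fst _ _) : ∃ σ : L ≃ₐ[K] L, a ≫ twist π σ = b := by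
  obtain ⟨i, hi⟩ := Spec.map_surjective (a ≫ pullback.snd π (specMap K L))
  obtain ⟨j, hj⟩ := Spec.map_surjective (b ≫ pullback.snd π (specMap K L))
  have h1 : Spec.map i ≫ specMap K L = Spec.map j ≫ specMap K L := by
    rw [hi, hj, Category.assoc, Category.assoc, ← pullback.condition, reassoc_of% h]
  rw [specMap, ← Spec.map_comp, ← Spec.map_comp, Spec.map_inj] at h1
  obtain ⟨σ, hσ⟩ := exists_algEquiv_comp_eq (K := K) i.hom j.hom
    (congrArg CommRingCat.Hom.hom h1)
  refine ⟨σ, pullback.hom_ext ?_ ?_⟩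
  · rw [Category.assoc, twist_fst, h]
  · rw [Category.assoc, twist_snd, ← reassoc_of% hi, ← hj, autSpec, ← Spec.map_comp]
    congr 1
    exact CommRingCat.hom_ext (RingHom.ext hσ)

theorem eq_point_comp_inv {g : Spec (CommRingCat.of L) ⟶ pullback π (specMap K L)} {v : Fin 3 → L}
    (h1 : g ≫ pullback.fst _ _ = T.point v) (h2 : g ≫ pullback.snd _ _ = 𝟙 _) :
    g = ProjSpace.point (RingHom.id L) v ≫ T.iso.inv := by
  refine pullback.hom_ext ?_ ?_
  · rw [h1, point, Category.assoc]
  · rw [h2, Category.assoc, iso_inv_snd, ProjSpace.point_toSpec, SpecMap_id]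

theorem point_comp_projBaseChange {v : Fin 3 → L} (hv : v ≠ 0) :
    ProjSpace.point (RingHom.id L) v ≫ projBaseChange 2 K L =
      ProjSpace.point (algebraMap K L) v := by
  have h1 := point_comp_projMap (algebraMap K L) (one_mul 1) (RingHom.id L) hv
  have h2 : (1 : Matrix (Fin 3) (Fin 3) L).map (RingHom.id L) = 1 := Matrix.ext fun _ _ => rfl
  rw [h2, Matrix.one_mulVec, RingHom.id_comp] at h1
  exact h1

theorem isReduced (T : Trivialization π L) : IsReduced (pullback π (specMap K L)) :=
  isReduced_of_isOpenImmersion T.iso.hom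

/-- The base change of S is reduced with dense closed points, all rational over L, so the equality
is tested on L-points, where it is the equivariance hypothesis. -/
theorem twist_comp [IsAlgClosed L] [LocallyOfFiniteType π]
    (hT : ∀ (σ : L ≃ₐ[K] L) v, v ≠ 0 → autSpec σ ≫ T.point v = T.point (σ ∘ v))
    (σ : L ≃ₐ[K] L) :
    twist π σ ≫ T.iso.hom ≫ projBaseChange 2 K L = T.iso.hom ≫ projBaseChange 2 K L := by
  have := T.isReduced
  have : JacobsonSpace ↥(pullback π (specMap K L)) :=
    LocallyOfFiniteType.jacobsonSpace (pullback.snd π (specMap K L))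
  refine ext_of_fromSpecResidueField_eq _ _ (ProjSpace.toSpec 2 K) (closedPoints _) ?_ ?_ ?_
  · rw [dense_iff_closure_eq, closure_closedPoints]
  · intro x hx
    rw [← cancel_epi (Spec.map (residueFieldIsoBase (pullback.snd π (specMap K L)) x hx).hom)]
    have hg : pointOfClosedPoint (pullback.snd π (specMap K L)) x hx ≫ _ = 𝟙 _ :=
      pointOfClosedPoint_comp _ x hx
    set g := pointOfClosedPoint (pullback.snd π (specMap K L)) x hx with hgdef
    suffices hs : g ≫ twist π σ ≫ T.iso.hom ≫ projBaseChange 2 K L =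
        g ≫ T.iso.hom ≫ projBaseChange 2 K L by
      simpa only [hgdef, pointOfClosedPoint, Category.assoc] using hs
    have hgp : g ≫ pullback.fst π (specMap K L) ∈ points π L := by
      change (g ≫ _) ≫ π = _
      rw [Category.assoc, pullback.condition, reassoc_of% hg]
    obtain ⟨v, hv, hgv⟩ := T.exists_eq_point hgp
    have h1 := T.eq_point_comp_inv hgv hg
    have hv' : ⇑(σ⁻¹) ∘ v ≠ 0 := comp_ne_zero (σ⁻¹ : L ≃ₐ[K] L).toRingEquiv hv
    -- The twisted point lies over σ on Spec L; precomposing with σ⁻¹ makes it a section over L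
    -- again, so that it has coordinates.
    have h2 : autSpec σ⁻¹ ≫ g ≫ twist π σ =
        ProjSpace.point (RingHom.id L) (⇑(σ⁻¹) ∘ v) ≫ T.iso.inv := by
      refine T.eq_point_comp_inv ?_ ?_
      · rw [Category.assoc, Category.assoc, twist_fst, hgv, hT _ v hv]
      · rw [Category.assoc, Category.assoc, twist_snd, reassoc_of% hg, autSpec_comp_autSpec,
          inv_mul_cancel, autSpec_one]
    have h3 : g ≫ twist π σ = autSpec σ ≫ ProjSpace.point (RingHom.id L) (⇑(σ⁻¹) ∘ v) ≫ T.iso.inv := by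
      rw [← h2, ← Category.assoc, autSpec_comp_autSpec, mul_inv_cancel, autSpec_one,
        Category.id_comp]
    rw [reassoc_of% h3, h1, Category.assoc, Iso.inv_hom_id_assoc,
      point_comp_projBaseChange hv, point_comp_projBaseChange hv', autSpec,
      ProjSpace.SpecMap_comp_point _ _ hv']
    congr 1
    · ext x
      exact σ.commutes x
    · funext i
      simp
  · simp only [Category.assoc, projBaseChange_toSpec, reassoc_of% T.iso_hom_toSpec]
    have : twist π σ ≫ pullback.snd π (specMap K L) ≫ specMap K L =
        pullback.snd π (specMap K L) ≫ specMap K L := by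
      rw [← Category.assoc, twist_snd, Category.assoc, autSpec_comp_specMap]
    exact this

instance : Surjective (specMap K L) :=
  ⟨fun _ => ⟨specPt L, Subsingleton.elim _ _⟩⟩

/-- A projection of the kernel pair is a base change of Spec L → Spec K, which is geometrically
reduced as K is perfect, and its target is reduced. -/
theorem isReduced_kernelPair (T : Trivialization π L) [PerfectField K] [Algebra.IsAlgebraic K L] [LocallyOfFiniteType π] :
    IsReduced (pullback (pullback.fst π (specMap K L)) (pullback.fst π (specMap K L))) := by
  have h := ((IsPullback.of_hasPullback (pullback.fst π (specMap K L))
    (pullback.fst π (specMap K L))).flip.paste_horiz (IsPullback.of_hasPullback π (specMap K L)).flip)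
  have := T.isReduced
  have := geometricallyReduced_specMap K L
  have : IsLocallyNoetherian (pullback π (specMap K L)) :=
    LocallyOfFiniteType.isLocallyNoetherian (pullback.snd π (specMap K L))
  exact GeometricallyReduced.isReduced_of_flat_of_isLocallyNoetherian
    (pullback.fst (pullback.fst π (specMap K L)) (pullback.fst π (specMap K L)))

/-- This is the descent condition. It suffices to check it on the kernel pair, and by reducedness on
field-valued points; there the two maps differ by a Galois twist, to which `twist_comp` applies. -/
theorem comp_eq_comp [PerfectField K] [Algebra.IsAlgebraic K L] [IsAlgClosed L]
    [LocallyOfFiniteType π]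
    (hT : ∀ (σ : L ≃ₐ[K] L) v, v ≠ 0 → autSpec σ ≫ T.point v = T.point (σ ∘ v))
    {Z : Scheme.{u}} (p q : Z ⟶ pullback π (specMap K L))
    (h : p ≫ pullback.fst _ _ = q ≫ pullback.fst _ _) :
    p ≫ T.iso.hom ≫ projBaseChange 2 K L = q ≫ T.iso.hom ≫ projBaseChange 2 K L := by
  have : IsAlgClosure K L := ⟨inferInstance, inferInstance⟩
  suffices H : pullback.fst (pullback.fst π (specMap K L)) (pullback.fst π (specMap K L)) ≫
      T.iso.hom ≫ projBaseChange 2 K L =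
      pullback.snd (pullback.fst π (specMap K L)) (pullback.fst π (specMap K L)) ≫
      T.iso.hom ≫ projBaseChange 2 K L by
    have := congrArg (pullback.lift p q h ≫ ·) H
    rwa [pullback.lift_fst_assoc, pullback.lift_snd_assoc] at this
  have := T.isReduced_kernelPair
  refine ext_of_fromSpecResidueField_eq _ _ (ProjSpace.toSpec 2 K) Set.univ dense_univ ?_ ?_
  · have H : ∀ {F : Type u} [Field F] (g : Spec (CommRingCat.of F) ⟶
        pullback (pullback.fst π (specMap K L)) (pullback.fst π (specMap K L))),
        g ≫ pullback.fst _ _ ≫ T.iso.hom ≫ projBaseChange 2 K L =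
        g ≫ pullback.snd _ _ ≫ T.iso.hom ≫ projBaseChange 2 K L := fun g => by
      obtain ⟨σ, hσ⟩ := exists_eq_twist (a := g ≫ pullback.fst _ _) (b := g ≫ pullback.snd _ _)
        (by rw [Category.assoc, Category.assoc, pullback.condition])
      rw [← Category.assoc g, ← Category.assoc g, ← hσ, Category.assoc (g ≫ _), T.twist_comp hT σ]
    intro z _
    exact H _
  · simp only [Category.assoc, projBaseChange_toSpec, reassoc_of% T.iso_hom_toSpec]
    have : ∀ {W : Scheme.{u}} (a : W ⟶ pullback π (specMap K L)),
        a ≫ pullback.snd π (specMap K L) ≫ specMap K L = a ≫ pullback.fst _ _ ≫ π := fun a => by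
      rw [pullback.condition]
    erw [this, this]
    rw [pullback.condition_assoc]

/-- The base change of S is an effective epimorphism onto S, so the map to the plane over K descends
to S. The descended map becomes an isomorphism over L, and being an isomorphism descends along flat
surjective quasi-compact morphisms. -/
theorem isTrivial_of_equivariant [PerfectField K] [Algebra.IsAlgebraic K L] [IsAlgClosed L]
    [LocallyOfFiniteType π]
    (hT : ∀ (σ : L ≃ₐ[K] L) v, v ≠ 0 → autSpec σ ≫ T.point v = T.point (σ ∘ v)) :
    IsTrivial π := by
  set f := EffectiveEpi.desc (pullback.fst π (specMap K L)) (T.iso.hom ≫ projBaseChange 2 K L)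
    (fun p q h => T.comp_eq_comp hT p q h)
  have hf : pullback.fst π (specMap K L) ≫ f = T.iso.hom ≫ projBaseChange 2 K L :=
    EffectiveEpi.fac _ _ _
  have hfπ : f ≫ ProjSpace.toSpec 2 K = π := by
    rw [← cancel_epi (pullback.fst π (specMap K L)), ← Category.assoc, hf, Category.assoc,
      projBaseChange_toSpec, ← Category.assoc, T.iso_hom_toSpec, pullback.condition]
  have hb := isPullback_projBaseChange K L 2
  have h1 : IsPullback (pullback.fst π (specMap K L)) T.iso.hom f (projBaseChange 2 K L) := by
    refine IsPullback.of_bot ?_ hf hb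
    rw [T.iso_hom_toSpec, hfπ]
    exact IsPullback.of_hasPullback _ _
  have hP : (@Surjective ⊓ @Flat ⊓ @QuasiCompact : MorphismProperty Scheme.{u})
      (projBaseChange 2 K L) :=
    ⟨⟨MorphismProperty.of_isPullback (P := @Surjective) hb.flip inferInstance,
      MorphismProperty.of_isPullback (P := @Flat) hb.flip inferInstance⟩,
      MorphismProperty.of_isPullback (P := @QuasiCompact) hb.flip inferInstance⟩
  have hiso : IsIso f := MorphismProperty.of_isPullback_of_descendsAlong
    (P := MorphismProperty.isomorphisms Scheme.{u}) h1.flip hP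
    (inferInstanceAs (IsIso T.iso.hom))
  exact ⟨asIso f, hfπ⟩

/-- Using the columns of P as a new frame makes every N_σ scalar, which acts trivially on lines. -/
theorem isTrivial_of_matrix [PerfectField K] [Algebra.IsAlgebraic K L] [IsAlgClosed L]
    [LocallyOfFiniteType π] {N : (L ≃ₐ[K] L) → Matrix (Fin 3) (Fin 3) L}
    (hNp : IsProjectiveCocycle N)
    (hN : ∀ σ v, v ≠ 0 → autSpec σ ≫ T.point v = T.point ((N σ).mulVec (σ ∘ v)))
    {P : Matrix (Fin 3) (Fin 3) L} (hP : P.det ≠ 0)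
    (h : ∀ σ : L ≃ₐ[K] L, ∃ c : L, N σ * P.map σ = c • P) : IsTrivial π := by
  refine (T.changeFrame (Matrix.nonsing_inv_mul P hP.isUnit)
    (Matrix.mul_nonsing_inv P hP.isUnit)).isTrivial_of_equivariant fun σ v hv => ?_
  have hv' : σ ∘ v ≠ 0 := comp_ne_zero (σ : L ≃+* L) hv
  have hP0 : ∀ {w}, w ≠ 0 → P.mulVec w ≠ 0 := fun hw h =>
    hw (Matrix.eq_zero_of_mulVec_eq_zero hP h)
  rw [changeFrame_point _ _ _ hv, changeFrame_point _ _ _ hv', hN _ _ (hP0 hv)]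
  obtain ⟨c, hc⟩ := h σ
  rw [map_mulVec_comp, Matrix.mulVec_mulVec, hc, eq_comm]
  refine (T.point_eq_point_iff (hP0 hv') ?_).2 ⟨c, by rw [Matrix.smul_mulVec]⟩
  rw [← hc, ← Matrix.mulVec_mulVec, ← map_mulVec_comp]
  exact hNp.mulVec_ne_zero σ (hP0 hv)

end Trivialization

end

end SeveriBrauer

/-! ### Galois action on geometric points -/

namespace SeveriBrauer

noncomputable section

section

variable {K : Type u} [Field K] {S : Scheme.{u}} {π : S ⟶ Spec (CommRingCat.of K)}
    {L : Type u} [Field L] [Algebra K L]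

/-- Spec L → Spec K is integral, hence universally closed, and S is separated; so g is a closed map,
with image one point. -/
theorem isClosed_closedPoint_of_mem_points [Algebra.IsAlgebraic K L] [IsSeparated π]
    {g : Spec (CommRingCat.of L) ⟶ S} (hg : g ∈ points π L) :
    IsClosed {g (IsLocalRing.closedPoint L)} := by
  have h1 : UniversallyClosed (g ≫ π) := by
    have : IsIntegralHom (specMap K L) :=
      (IsIntegralHom.SpecMap_iff).2 (algebraMap_isIntegral_iff.2 inferInstance)
    rw [show g ≫ π = specMap K L from hg]
    infer_instance
  have h2 : UniversallyClosed g := UniversallyClosed.of_comp_of_isSeparated g π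
  have h3 := g.isClosedMap _ isClosed_univ
  rw [Set.image_univ] at h3
  convert h3
  ext y
  constructor
  · rintro rfl
    exact ⟨_, rfl⟩
  · rintro ⟨z, rfl⟩
    exact congrArg g (Subsingleton.elim _ _)

theorem autSpec_comp_mem_pointsOver {x : S} {g : Spec (CommRingCat.of L) ⟶ S}
    (hg : g ∈ pointsOver π L x) (σ : L ≃ₐ[K] L) : autSpec σ ≫ g ∈ pointsOver π L x := by
  refine ⟨?_, ?_⟩
  · change (autSpec σ ≫ g) ≫ π = _
    rw [Category.assoc, show g ≫ π = _ from hg.1, autSpec_comp_specMap]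
  · exact ((Scheme.Hom.comp_apply _ g _).trans (congrArg g (Subsingleton.elim _ _))).trans hg.2

/-- An embedding of a field in an algebraically closed field extends to algebraic extensions. -/
theorem exists_ringHom_comp_eq {E F M : Type u} [Field E] [Field F] [Field M] [IsAlgClosed M]
    (φ : E →+* F) (ψ : E →+* M) (h : ∀ x, ∃ p : Polynomial E, p ≠ 0 ∧ p.eval₂ φ x = 0) :
    ∃ τ : F →+* M, τ.comp φ = ψ := by
  algebraize [φ, ψ]
  have : Algebra.IsAlgebraic E F := ⟨h⟩
  exact ⟨(IsAlgClosed.lift (R := E) (M := M) (S := F)).toRingHom, AlgHom.comp_algebraMap _⟩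

theorem exists_autSpec_comp_eq [Algebra.IsAlgebraic K L] [IsAlgClosed L] {x : S}
    {g g' : Spec (CommRingCat.of L) ⟶ S} (hg : g ∈ pointsOver π L x)
    (hg' : g' ∈ pointsOver π L x) : ∃ σ : L ≃ₐ[K] L, autSpec σ ≫ g = g' := by
  obtain ⟨⟨y, φ⟩, rfl⟩ := (Scheme.SpecToEquivOfField L S).symm.surjective g
  obtain rfl : y = x := (Scheme.fromSpecResidueField_apply y _).symm.trans hg.2
  obtain ⟨⟨z, ψ⟩, rfl⟩ := (Scheme.SpecToEquivOfField L S).symm.surjective g'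
  obtain rfl : z = y := (Scheme.fromSpecResidueField_apply z _).symm.trans hg'.2
  rw [Scheme.SpecToEquivOfField_symm_apply, Scheme.SpecToEquivOfField_symm_apply] at *
  obtain ⟨s, hs⟩ := Spec.map_surjective (S.fromSpecResidueField z ≫ π)
  have key : ∀ χ : S.residueField z ⟶ .of L, (Spec.map χ ≫ S.fromSpecResidueField z) ≫ π =
      specMap K L → ∀ a, χ.hom (s.hom a) = algebraMap K L a := fun χ hχ a => by
    rw [Category.assoc, ← hs, specMap, ← Spec.map_comp, Spec.map_inj] at hχ
    exact congr($(hχ).hom a)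
  have hφ := key φ hg.1
  have hψ := key ψ hg'.1
  -- The two points are embeddings of one residue field in L. One extends along the other because L
  -- is algebraic over K and algebraically closed.
  obtain ⟨τ, hτ⟩ := exists_ringHom_comp_eq φ.hom ψ.hom fun x => by
    obtain ⟨p, hp, hpx⟩ := Algebra.IsAlgebraic.isAlgebraic (R := K) x
    refine ⟨p.map s.hom, (Polynomial.map_ne_zero_iff s.hom.injective).2 hp, ?_⟩
    rw [Polynomial.eval₂_map, ← hpx, Polynomial.aeval_def]
    congr 1
    exact RingHom.ext hφ
  have hcomm : ∀ r, τ (algebraMap K L r) = algebraMap K L r := fun r => by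
    rw [← hφ, ← RingHom.comp_apply, hτ, hφ, hψ]
  let τ' : L →ₐ[K] L := { τ with commutes' := hcomm }
  refine ⟨AlgEquiv.ofBijective τ' (Algebra.IsAlgebraic.algHom_bijective τ'), ?_⟩
  rw [autSpec, ← Category.assoc, ← Spec.map_comp]
  congr 2
  exact CommRingCat.hom_ext hτ

/-- The automorphisms that fix the points over `x` are those that fix the splitting field of `x`. -/
theorem forall_autSpec_comp_eq_iff {x : S} (σ : L ≃ₐ[K] L) :
    (∀ g ∈ pointsOver π L x, autSpec σ ≫ g = g) ↔ ∀ a ∈ splittingField π L x, σ a = a := by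
  constructor
  · intro h a ha
    -- By minimality of the splitting field it is enough that the points are defined over the fixed
    -- field of σ.
    have hle : splittingField π L x ≤ IntermediateField.fixedField (Subgroup.zpowers σ) := by
      refine (splittingField_isLeast π L x).2 fun g hg => ?_
      obtain ⟨⟨y, φ⟩, rfl⟩ := (Scheme.SpecToEquivOfField L S).symm.surjective g
      refine (isDefinedOver_iff π L _ y φ hg.1).2 fun b => ?_
      have h1 : (Scheme.SpecToEquivOfField L S).symm ⟨y, φ ≫ CommRingCat.ofHom (σ : L →+* L)⟩ =
          (Scheme.SpecToEquivOfField L S).symm ⟨y, φ⟩ := by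
        refine Eq.trans ?_ (h _ hg)
        rw [Scheme.SpecToEquivOfField_symm_apply, Scheme.SpecToEquivOfField_symm_apply,
          Spec.map_comp, Category.assoc]
        rfl
      have h2 := eq_of_heq (Sigma.mk.inj ((Scheme.SpecToEquivOfField L S).symm.injective h1)).2
      rw [IntermediateField.mem_fixedField_iff]
      intro τ hτ
      exact Subgroup.zpowers_le (H := MulAction.stabilizer (L ≃ₐ[K] L) (φ.hom b)).2
        congr($(h2).hom b) hτ
    exact (IntermediateField.mem_fixedField_iff _ _).1 (hle ha) σ (Subgroup.mem_zpowers σ)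
  · intro h g hg
    obtain ⟨f, -, rfl⟩ := (splittingField_isLeast π L x).1 g hg
    rw [← Category.assoc, autSpec, ← Spec.map_comp]
    congr 2
    ext a
    exact h _ a.2

theorem comp_mem_pointsOver {x y : S} (α : S ≅ S) (hα : α.hom ≫ π = π) (h : α.hom x = y)
    {g : Spec (CommRingCat.of L) ⟶ S} (hg : g ∈ pointsOver π L y) :
    g ≫ α.inv ∈ pointsOver π L x := by
  refine ⟨?_, ?_⟩
  · change (g ≫ α.inv) ≫ π = _
    rw [Category.assoc, ← hg.1]
    nth_rw 1 [← hα]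
    rw [Iso.inv_hom_id_assoc]
  · refine (Scheme.Hom.comp_apply g _ _).trans ?_
    rw [hg.2, ← h, ← Scheme.Hom.comp_apply, Iso.hom_inv_id]
    rfl

end

/-! ### Points of degree three from eigenframes -/

namespace Trivialization

variable {K : Type u} [Field K] {S : Scheme.{u}} {π : S ⟶ Spec (CommRingCat.of K)}
    {L : Type u} [Field L] [Algebra K L] (T : Trivialization π L)
    {N : (L ≃ₐ[K] L) → Matrix (Fin 3) (Fin 3) L}

theorem autSpec_comp_point_of_isEigenframe (hNp : IsProjectiveCocycle N)
    (hN : ∀ σ v, v ≠ 0 → autSpec σ ≫ T.point v = T.point ((N σ).mulVec (σ ∘ v)))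
    {a : Matrix (Fin 3) (Fin 3) L} (ha : a ∈ twistedAlgebra N) {ev : Fin 3 → L}
    {vec : Fin 3 → Fin 3 → L} (h : IsEigenframe K a ev vec) {σ : L ≃ₐ[K] L} {i j : Fin 3}
    (hσ : σ (ev i) = ev j) : autSpec σ ≫ T.point (vec i) = T.point (vec j) := by
  obtain ⟨c, hc⟩ := h.twisted_mulVec_eq ha hσ
  rw [hN _ _ (h.ne_zero i), eq_comm]
  exact (T.point_eq_point_iff (h.ne_zero j) (hNp.mulVec_ne_zero σ (h.ne_zero i))).2 ⟨c, hc⟩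

theorem point_injective_of_isEigenframe {a : Matrix (Fin 3) (Fin 3) L} {ev : Fin 3 → L}
    {vec : Fin 3 → Fin 3 → L} (h : IsEigenframe K a ev vec) :
    Function.Injective fun i => T.point (vec i) := fun i j hij => by
  obtain ⟨c, hc⟩ := (T.point_eq_point_iff (h.ne_zero i) (h.ne_zero j)).1 hij
  exact (h.eq_of_smul_eq hc).symm

theorem exists_pointsOver_eq_range [Algebra.IsAlgebraic K L] [IsAlgClosed L] [IsSeparated π]
    (hNp : IsProjectiveCocycle N)
    (hN : ∀ σ v, v ≠ 0 → autSpec σ ≫ T.point v = T.point ((N σ).mulVec (σ ∘ v)))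
    {a : Matrix (Fin 3) (Fin 3) L} (ha : a ∈ twistedAlgebra N) {ev : Fin 3 → L}
    {vec : Fin 3 → Fin 3 → L} (h : IsEigenframe K a ev vec) :
    ∃ x : S, IsClosed {x} ∧ pointsOver π L x = Set.range fun i => T.point (vec i) := by
  refine ⟨_, isClosed_closedPoint_of_mem_points (T.point_mem (vec 0)), Set.ext fun g => ?_⟩
  have h0 : T.point (vec 0) ∈ pointsOver π L _ := ⟨T.point_mem (vec 0), rfl⟩
  constructor
  · intro hg
    obtain ⟨σ, rfl⟩ := exists_autSpec_comp_eq h0 hg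
    obtain ⟨j, hj⟩ := h.orbit σ 0
    exact ⟨j, (T.autSpec_comp_point_of_isEigenframe hNp hN ha h hj).symm⟩
  · rintro ⟨j, rfl⟩
    obtain ⟨σ, hσ⟩ := h.transitive 0 j
    have := autSpec_comp_mem_pointsOver h0 σ
    rwa [T.autSpec_comp_point_of_isEigenframe hNp hN ha h hσ] at this

theorem isPointOfDegree_three {a : Matrix (Fin 3) (Fin 3) L} {ev : Fin 3 → L}
    {vec : Fin 3 → Fin 3 → L} (h : IsEigenframe K a ev vec) {x : S} (hx : IsClosed {x})
    (hxv : pointsOver π L x = Set.range fun i => T.point (vec i)) : IsPointOfDegree π L 3 x := by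
  refine ⟨hx, ?_⟩
  rw [hxv, ← Set.image_univ, Set.ncard_image_of_injective _ (T.point_injective_of_isEigenframe h),
    Set.ncard_univ, Nat.card_eq_fintype_card, Fintype.card_fin]

end Trivialization

end

end SeveriBrauer

theorem mainTheorem9 {K : Type u} [Field K] [PerfectField K]
    (Kbar : Type u) [Field Kbar] [Algebra K Kbar] [IsAlgClosure K Kbar]
    (S : Scheme.{u}) (π : S ⟶ Spec (CommRingCat.of K))
    (hS : SeveriBrauer.IsSeveriBrauerSurface π Kbar)
    (hnontriv : ¬ SeveriBrauer.IsTrivial π) :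
    ∃ p q : S,
      SeveriBrauer.IsPointOfDegree π Kbar 3 p ∧ SeveriBrauer.IsPointOfDegree π Kbar 3 q ∧
      SeveriBrauer.splittingField π Kbar p ≠ SeveriBrauer.splittingField π Kbar q ∧
      ∀ α : S ≅ S, α.hom ≫ π = π → α.hom p ≠ q := by
  open SeveriBrauer in
  have : IsProper π := hS.projective.isProper
  have : IsAlgClosed Kbar := IsAlgClosure.isAlgClosed K
  have : Algebra.IsAlgebraic K Kbar := IsAlgClosure.isAlgebraic
  have : IsGalois K Kbar := {}
  obtain ⟨e, he⟩ := hS.geometric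
  let T : Trivialization π Kbar := ⟨e, he⟩
  obtain ⟨N, hNp, hN⟩ := T.exists_isProjectiveCocycle
  have hdiv := hNp.exists_trivialization_or_det_ne_zero.resolve_left fun ⟨P, hP, h⟩ =>
    hnontriv (T.isTrivial_of_matrix hNp hN hP h)
  obtain ⟨a, ha, b, hb, ev, u, ev', w, hu, hw, σ, hσ, i, hi⟩ := hNp.exists_isEigenframe_pair hdiv
  obtain ⟨p, hp, hpu⟩ := T.exists_pointsOver_eq_range hNp hN ha hu
  obtain ⟨q, hq, hqw⟩ := T.exists_pointsOver_eq_range hNp hN hb hw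
  have hσp : ∀ g ∈ pointsOver π Kbar p, autSpec σ ≫ g = g := by
    rw [hpu]
    rintro _ ⟨j, rfl⟩
    exact T.autSpec_comp_point_of_isEigenframe hNp hN ha hu (hσ j)
  have hσq : ¬ ∀ g ∈ pointsOver π Kbar q, autSpec σ ≫ g = g := fun h => by
    obtain ⟨j, hj⟩ := hw.orbit σ i
    have h1 := h (T.point (w i)) (by rw [hqw]; exact ⟨i, rfl⟩)
    rw [T.autSpec_comp_point_of_isEigenframe hNp hN hb hw hj] at h1
    exact hi (hj.trans (congrArg ev' (T.point_injective_of_isEigenframe hw h1)))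
  refine ⟨p, q, T.isPointOfDegree_three hu hp hpu, T.isPointOfDegree_three hw hq hqw,
    fun h => hσq ?_, fun α hα hpq => hσq fun g hg => ?_⟩
  -- The automorphism σ fixes the splitting field of p pointwise but not that of q.
  · rwa [forall_autSpec_comp_eq_iff, ← h, ← forall_autSpec_comp_eq_iff]
  -- Composition with the inverse of α carries geometric points over q to points over p and commutes
  -- with σ, so σ would fix every point over q.
  · rw [← cancel_mono α.inv, Category.assoc]
    exact hσp _ (comp_mem_pointsOver α hα hpq hg)
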